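/- For $\Omega\in\{\mathbb{R}_+,\mathbb{R}\}$, $\mathbb{R}_+=(0,\infty)$, let $X(\Omega)$ be one of the following Banach spaces of (classes of) Lebesgue measurable functions $f:\Omega\to\mathbb{C}$. (a) The Lorentz space $L^{p,q}(\Omega)$, $1<p,q<\infty$, with the norm $\|f\|=\big(\int_0^\infty (t^{1/p}f^{**}(t))^q\,\frac{dt}{t}\big)^{1/q}$, where $f^{**}(t)=\frac1t\int_0^t f^*(s)\,ds$ and $f^*(t)=\inf\{\lambda\ge0: |\{x\in\Omega:|f(x)|>\lambda\}|\le t\}$. (b) A reflexive Orlicz space $L^\Phi(\Omega)$ with the Luxemburg norm $\|f\|=\inf\{\lambda>0:\int_\Omega\Phi(|f(x)|/\lambda)\,dx\le1\}$, where $\Phi(x)=\int_0^x\phi(t)\,dt$ and $\phi:[0,\infty)\to[0,\infty]$ is nondecreasing and left-continuous with $\phi(0)=0$, $\lim_{t\to\infty}\phi(t)=\infty$, and $\phi$ is not identically $\infty$ on $(0,\infty)$. (c) The variable Lebesgue space $L^{p(\cdot)}(\Omega)$ with the norm $\|f\|=\inf\{\lambda>0:\int_\Omega|f(x)/\lambda|^{p(x)}\,dx\le1\}$,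 where $p(\cdot):\mathbb{R}\to[1,\infty)$ is measurable, $1<\operatorname{ess\,inf}p\le\operatorname{ess\,sup}p<\infty$, and the Hardy–Littlewood maximal operator $(Mf)(x)=\sup_{I\ni x}\frac1{|I|}\int_I|f(t)|\,dt$ (supremum over bounded intervals $I$ containing $x$) is bounded on $L^{p(\cdot)}(\mathbb{R})$. Let $F$ be the Fourier transform on $L^2(\mathbb{R})$, $(Ff)(\xi)=\int_{\mathbb{R}}f(x)e^{i\xi x}\,dx$ for $f\in L^1(\mathbb{R})\cap L^2(\mathbb{R})$. A function $a\in L^\infty(\mathbb{R})$ is a Fourier multiplier on $X(\mathbb{R})$ if $f\mapsto F^{-1}(a\cdot Ff)$ maps $L^2(\mathbb{R})\cap X(\mathbb{R})$ into $X(\mathbb{R})$ and extends to a bounded linear operator $W^0(a)$ on $X(\mathbb{R})$; the Wiener–Hopf operator with symbol $a$ is then $W(a)=r_+W^0(a)\ell_+$ on $X(\mathbb{R}_+)$, where $r_+:X(\mathbb{R})\to X(\mathbb{R}_+)$ is restriction and $\ell_+:X(\mathbb{R}_+)\to X(\mathbb{R})$ is extension by zero. Theorem. For every $n\in\mathbb{Z}$,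 the function $r_n(\xi)=\big(\frac{\xi-i}{\xi+i}\big)^n$, $\xi\in\mathbb{R}$, is a Fourier multiplier on $X(\mathbb{R})$, and the Wiener–Hopf operator $W(r_n)$ is Fredholm on $X(\mathbb{R}_+)$ with index $\dim\operatorname{Ker}W(r_n)-\dim X(\mathbb{R}_+)/\operatorname{Im}W(r_n)=-n$. -/

import Mathlib

open MeasureTheory Set Filter Topology
open scoped ENNReal NNReal FourierTransform

noncomputable section

namespace WienerHopf

/-! ### Function norms and the spaces they generate -/

/-- A function norm over the measure `μ`, given on nonnegative functions (the moduli of the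
elements of the space). -/
structure FunctionNorm (μ : Measure ℝ) where
  toFun : (ℝ → ℝ≥0∞) → ℝ≥0∞
  mono : ∀ {g h : ℝ → ℝ≥0∞}, g ≤ᵐ[μ] h → toFun g ≤ toFun h
  zero : toFun (fun _ => 0) = 0
  add_le : ∀ {g h : ℝ → ℝ≥0∞}, AEMeasurable g μ → AEMeasurable h μ →
    toFun (fun x => g x + h x) ≤ toFun g + toFun h
  smul_le : ∀ (c : ℝ≥0), c ≠ 0 → ∀ g : ℝ → ℝ≥0∞, toFun (fun x => c * g x) ≤ c * toFun g
  eq_zero : ∀ {g : ℝ → ℝ≥0∞}, AEMeasurable g μ → toFun g = 0 → g =ᵐ[μ] fun _ => 0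

namespace FunctionNorm

variable {μ : Measure ℝ}

theorem congr (ρ : FunctionNorm μ) {g h : ℝ → ℝ≥0∞} (hgh : g =ᵐ[μ] h) :
    ρ.toFun g = ρ.toFun h :=
  le_antisymm (ρ.mono hgh.le) (ρ.mono hgh.symm.le)

/-- The norm of a class of complex-valued measurable functions, possibly infinite. -/
def eval (ρ : FunctionNorm μ) (f : ℝ →ₘ[μ] ℂ) : ℝ≥0∞ := ρ.toFun fun x => ‖f x‖ₑ

theorem eval_zero (ρ : FunctionNorm μ) : ρ.eval 0 = 0 := by
  rw [← ρ.zero]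
  refine ρ.congr ?_
  filter_upwards [AEEqFun.coeFn_zero (μ := μ) (β := ℂ)] with x hx
  simp [hx]

theorem aemeasurable_enorm (f : ℝ →ₘ[μ] ℂ) : AEMeasurable (fun x => ‖f x‖ₑ) μ :=
  f.aestronglyMeasurable.enorm

theorem eval_add_le (ρ : FunctionNorm μ) (f g : ℝ →ₘ[μ] ℂ) :
    ρ.eval (f + g) ≤ ρ.eval f + ρ.eval g := by
  refine le_trans (ρ.mono ?_) (ρ.add_le (aemeasurable_enorm f) (aemeasurable_enorm g))
  filter_upwards [AEEqFun.coeFn_add f g] with x hx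
  simp only [hx, Pi.add_apply]
  exact enorm_add_le _ _

theorem eval_smul_le (ρ : FunctionNorm μ) (c : ℂ) (f : ℝ →ₘ[μ] ℂ) :
    ρ.eval (c • f) ≤ ‖c‖ₑ * ρ.eval f := by
  by_cases hc : c = 0
  · have h0 : c • f = 0 := by
      refine AEEqFun.ext ?_
      filter_upwards [AEEqFun.coeFn_smul c f, AEEqFun.coeFn_zero (μ := μ) (β := ℂ)] with x hx hy
      rw [hx, hy, hc]
      simp
    rw [h0, eval_zero]
    exact zero_le
  · refine le_trans (ρ.mono ?_) (ρ.smul_le ‖c‖₊ (by simpa using hc) _)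
    filter_upwards [AEEqFun.coeFn_smul c f] with x hx
    simp only [hx, Pi.smul_apply, enorm_smul]
    exact le_of_eq rfl

theorem eval_neg (ρ : FunctionNorm μ) (f : ℝ →ₘ[μ] ℂ) : ρ.eval (-f) = ρ.eval f := by
  refine ρ.congr ?_
  filter_upwards [AEEqFun.coeFn_neg f] with x hx
  simp [hx]

theorem eq_zero_of_eval (ρ : FunctionNorm μ) {f : ℝ →ₘ[μ] ℂ} (hf : ρ.eval f = 0) : f = 0 := by
  refine AEEqFun.ext ?_
  filter_upwards [ρ.eq_zero (aemeasurable_enorm f) hf,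
    AEEqFun.coeFn_zero (μ := μ) (β := ℂ)] with x hx h0
  rw [h0]
  simpa using hx

/-- The function space of all (classes of) measurable functions of finite norm. -/
def space (ρ : FunctionNorm μ) : Submodule ℂ (ℝ →ₘ[μ] ℂ) where
  carrier := {f | ρ.eval f < ∞}
  add_mem' {f g} hf hg := lt_of_le_of_lt (ρ.eval_add_le f g) (ENNReal.add_lt_top.2 ⟨hf, hg⟩)
  zero_mem' := by simp [eval_zero]
  smul_mem' c f hf :=
    lt_of_le_of_lt (ρ.eval_smul_le c f) (ENNReal.mul_lt_top enorm_lt_top hf)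

instance (ρ : FunctionNorm μ) : NormedAddCommGroup ρ.space :=
  AddGroupNorm.toNormedAddCommGroup
    { toFun := fun f => (ρ.eval (f : ℝ →ₘ[μ] ℂ)).toReal
      map_zero' := by simp [eval_zero]
      add_le' := fun f g => by
        rw [← ENNReal.toReal_add f.2.ne g.2.ne]
        exact ENNReal.toReal_mono (ENNReal.add_ne_top.2 ⟨f.2.ne, g.2.ne⟩) (ρ.eval_add_le _ _)
      neg' := fun f => by
        simp [eval_neg]
      eq_zero_of_map_eq_zero' := fun f hf => by
        rcases (ENNReal.toReal_eq_zero_iff _).1 hf with h | h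
        · exact Subtype.ext (ρ.eq_zero_of_eval h)
        · exact absurd h f.2.ne }

theorem norm_def (ρ : FunctionNorm μ) (f : ρ.space) :
    ‖f‖ = (ρ.eval (f : ℝ →ₘ[μ] ℂ)).toReal := rfl

instance (ρ : FunctionNorm μ) : NormedSpace ℂ ρ.space where
  norm_smul_le c f := by
    have h := ENNReal.toReal_mono (ENNReal.mul_ne_top enorm_ne_top f.2.ne)
      (ρ.eval_smul_le c (f : ℝ →ₘ[μ] ℂ))
    rw [ENNReal.toReal_mul, toReal_enorm] at h
    exact h

end FunctionNorm

/-! ### Restriction to the half-line and extension by zero -/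

/-- Lebesgue measure on the half-line `ℝ₊ = (0, ∞)`. -/
abbrev halfVolume : Measure ℝ := volume.restrict (Ioi 0)

/-- Restriction of (classes of) functions from `ℝ` to `ℝ₊`. -/
def restrictFun (f : ℝ →ₘ[volume] ℂ) : ℝ →ₘ[halfVolume] ℂ :=
  AEEqFun.mk f f.aestronglyMeasurable.restrict

/-- Extension of (classes of) functions from `ℝ₊` to `ℝ` by zero. -/
def extendFun (f : ℝ →ₘ[halfVolume] ℂ) : ℝ →ₘ[volume] ℂ :=
  AEEqFun.mk ((Ioi 0).indicator f)
    ((aestronglyMeasurable_indicator_iff measurableSet_Ioi).2 f.aestronglyMeasurable)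

theorem coeFn_restrictFun (f : ℝ →ₘ[volume] ℂ) : restrictFun f =ᵐ[halfVolume] f :=
  AEEqFun.coeFn_mk _ _

theorem coeFn_extendFun (f : ℝ →ₘ[halfVolume] ℂ) :
    extendFun f =ᵐ[volume] (Ioi 0).indicator f :=
  AEEqFun.coeFn_mk _ _

/-- A function space considered both over `ℝ` and over `ℝ₊`: the two norms are compatible with
extension by zero. -/
structure SpacePair where
  line : FunctionNorm volume
  half : FunctionNorm halfVolume
  indicator_eq : ∀ g : ℝ → ℝ≥0∞, line.toFun ((Ioi 0).indicator g) = half.toFun g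

namespace SpacePair

theorem eval_extendFun (X : SpacePair) (f : ℝ →ₘ[halfVolume] ℂ) :
    X.line.eval (extendFun f) = X.half.eval f := by
  rw [FunctionNorm.eval, FunctionNorm.eval, ← X.indicator_eq]
  refine X.line.congr ?_
  filter_upwards [coeFn_extendFun f] with x hx
  rw [hx]
  by_cases h : x ∈ Ioi (0 : ℝ) <;> simp [indicator, h]

theorem eval_restrictFun_le (X : SpacePair) (f : ℝ →ₘ[volume] ℂ) :
    X.half.eval (restrictFun f) ≤ X.line.eval f := by
  have h : X.half.eval (restrictFun f) = X.half.toFun (fun x => ‖f x‖ₑ) := by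
    refine X.half.congr ?_
    filter_upwards [coeFn_restrictFun f] with x hx
    rw [hx]
  rw [h, ← X.indicator_eq]
  exact X.line.mono (Eventually.of_forall fun x => indicator_le_self' (by simp) x)

/-- The restriction operator `r₊ : X(ℝ) → X(ℝ₊)`. -/
def restrict (X : SpacePair) : X.line.space →L[ℂ] X.half.space :=
  LinearMap.mkContinuous
    { toFun := fun f => ⟨restrictFun f, lt_of_le_of_lt (X.eval_restrictFun_le _) f.2⟩
      map_add' := fun f g => by
        refine Subtype.ext (AEEqFun.ext ?_)
        change restrictFun ((f : ℝ →ₘ[volume] ℂ) + g) =ᵐ[halfVolume]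
          (restrictFun f + restrictFun g : ℝ →ₘ[halfVolume] ℂ)
        filter_upwards [coeFn_restrictFun ((f : ℝ →ₘ[volume] ℂ) + g),
          coeFn_restrictFun (f : ℝ →ₘ[volume] ℂ), coeFn_restrictFun (g : ℝ →ₘ[volume] ℂ),
          AEEqFun.coeFn_add (restrictFun (f : ℝ →ₘ[volume] ℂ)) (restrictFun g),
          ae_restrict_of_ae (AEEqFun.coeFn_add (f : ℝ →ₘ[volume] ℂ) g)] with x h1 h2 h3 h4 h5
        rw [h1, h4, h5, Pi.add_apply, Pi.add_apply, h2, h3]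
      map_smul' := fun c f => by
        refine Subtype.ext (AEEqFun.ext ?_)
        change restrictFun (c • (f : ℝ →ₘ[volume] ℂ)) =ᵐ[halfVolume]
          (c • restrictFun f : ℝ →ₘ[halfVolume] ℂ)
        filter_upwards [coeFn_restrictFun (c • (f : ℝ →ₘ[volume] ℂ)),
          coeFn_restrictFun (f : ℝ →ₘ[volume] ℂ),
          AEEqFun.coeFn_smul c (restrictFun (f : ℝ →ₘ[volume] ℂ)),
          ae_restrict_of_ae (AEEqFun.coeFn_smul c (f : ℝ →ₘ[volume] ℂ))] with x h1 h2 h3 h4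
        rw [h1, h3, h4, Pi.smul_apply, Pi.smul_apply, h2] }
    1 fun f => by
      rw [one_mul]
      exact ENNReal.toReal_mono f.2.ne (X.eval_restrictFun_le _)

/-- The zero extension operator `ℓ₊ : X(ℝ₊) → X(ℝ)`. -/
def extend (X : SpacePair) : X.half.space →L[ℂ] X.line.space :=
  LinearMap.mkContinuous
    { toFun := fun f => ⟨extendFun f, lt_of_eq_of_lt (X.eval_extendFun _) f.2⟩
      map_add' := fun f g => by
        refine Subtype.ext (AEEqFun.ext ?_)
        change extendFun ((f : ℝ →ₘ[halfVolume] ℂ) + g) =ᵐ[volume]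
          (extendFun f + extendFun g : ℝ →ₘ[volume] ℂ)
        filter_upwards [coeFn_extendFun ((f : ℝ →ₘ[halfVolume] ℂ) + g),
          coeFn_extendFun (f : ℝ →ₘ[halfVolume] ℂ), coeFn_extendFun (g : ℝ →ₘ[halfVolume] ℂ),
          AEEqFun.coeFn_add (extendFun (f : ℝ →ₘ[halfVolume] ℂ)) (extendFun g),
          (ae_restrict_iff' measurableSet_Ioi).1
            (AEEqFun.coeFn_add (f : ℝ →ₘ[halfVolume] ℂ) g)] with x h1 h2 h3 h4 h5
        rw [h1, h4, Pi.add_apply, h2, h3]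
        by_cases hx : x ∈ Ioi (0 : ℝ)
        · simp only [indicator_of_mem hx, h5 hx, Pi.add_apply]
        · simp only [indicator_of_notMem hx, add_zero]
      map_smul' := fun c f => by
        refine Subtype.ext (AEEqFun.ext ?_)
        change extendFun (c • (f : ℝ →ₘ[halfVolume] ℂ)) =ᵐ[volume]
          (c • extendFun f : ℝ →ₘ[volume] ℂ)
        filter_upwards [coeFn_extendFun (c • (f : ℝ →ₘ[halfVolume] ℂ)),
          coeFn_extendFun (f : ℝ →ₘ[halfVolume] ℂ),
          AEEqFun.coeFn_smul c (extendFun (f : ℝ →ₘ[halfVolume] ℂ)),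
          (ae_restrict_iff' measurableSet_Ioi).1
            (AEEqFun.coeFn_smul c (f : ℝ →ₘ[halfVolume] ℂ))] with x h1 h2 h3 h4
        rw [h1, h3, Pi.smul_apply, h2]
        by_cases hx : x ∈ Ioi (0 : ℝ)
        · simp only [indicator_of_mem hx, h4 hx, Pi.smul_apply]
        · simp only [indicator_of_notMem hx, smul_zero] }
    1 fun f => by
      rw [one_mul]
      exact ENNReal.toReal_mono f.2.ne (X.eval_extendFun _).le

end SpacePair

/-! ### Luxemburg norms -/

/-- The Luxemburg norm `inf {s > 0 : ∫ Ψ(x, g(x) / s) dμ(x) ≤ 1}`. -/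
def luxemburg (μ : Measure ℝ) (Ψ : ℝ → ℝ≥0∞ → ℝ≥0∞) (g : ℝ → ℝ≥0∞) : ℝ≥0∞ :=
  ⨅ (s : ℝ≥0) (_ : 0 < s) (_ : ∫⁻ x, Ψ x (g x / s) ∂μ ≤ 1), (s : ℝ≥0∞)

theorem luxemburg_le {μ : Measure ℝ} {Ψ : ℝ → ℝ≥0∞ → ℝ≥0∞} {g : ℝ → ℝ≥0∞} {s : ℝ≥0}
    (hs : 0 < s) (h : ∫⁻ x, Ψ x (g x / s) ∂μ ≤ 1) : luxemburg μ Ψ g ≤ s :=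
  iInf₂_le_of_le s hs (iInf_le _ h)

theorem exists_of_luxemburg_lt {μ : Measure ℝ} {Ψ : ℝ → ℝ≥0∞ → ℝ≥0∞} {g : ℝ → ℝ≥0∞}
    {t : ℝ≥0∞} (h : luxemburg μ Ψ g < t) :
    ∃ s : ℝ≥0, 0 < s ∧ ∫⁻ x, Ψ x (g x / s) ∂μ ≤ 1 ∧ (s : ℝ≥0∞) < t := by
  simp only [luxemburg, iInf_lt_iff] at h
  obtain ⟨s, hs, h1, h2⟩ := h
  exact ⟨s, hs, h1, h2⟩

/-- The properties of an integrand that make the Luxemburg functional a norm. -/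
structure IsYoungIntegrand (μ : Measure ℝ) (Ψ : ℝ → ℝ≥0∞ → ℝ≥0∞) : Prop where
  zero : ∀ x, Ψ x 0 = 0
  mono : ∀ x, Monotone (Ψ x)
  convex : ∀ x (a b s t : ℝ≥0∞), a + b = 1 → Ψ x (a * s + b * t) ≤ a * Ψ x s + b * Ψ x t
  unbounded : ∀ x s, s ≠ 0 → ∃ k : ℕ, Ψ x (k * s) ≠ 0
  aemeasurable : ∀ g : ℝ → ℝ≥0∞, AEMeasurable g μ → AEMeasurable (fun x => Ψ x (g x)) μ

namespace IsYoungIntegrand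

variable {μ : Measure ℝ} {Ψ : ℝ → ℝ≥0∞ → ℝ≥0∞}

theorem mul_le (h : IsYoungIntegrand μ Ψ) (x : ℝ) {a : ℝ≥0∞} (ha : a ≤ 1) (s : ℝ≥0∞) :
    Ψ x (a * s) ≤ a * Ψ x s := by
  have := h.convex x a (1 - a) s 0 (add_tsub_cancel_of_le ha)
  simpa [h.zero x] using this

theorem luxemburg_add_le (h : IsYoungIntegrand μ Ψ) {g g' : ℝ → ℝ≥0∞}
    (hg : AEMeasurable g μ) :
    luxemburg μ Ψ (fun x => g x + g' x) ≤ luxemburg μ Ψ g + luxemburg μ Ψ g' := by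
  refine ENNReal.le_of_forall_pos_le_add fun ε hε hfin => ?_
  obtain ⟨h1, h2⟩ := ENNReal.add_lt_top.1 hfin
  have hε2 : (0 : ℝ≥0∞) < ((ε / 2 : ℝ≥0) : ℝ≥0∞) := by
    exact_mod_cast half_pos hε
  obtain ⟨s, hs, hs1, hs2⟩ := exists_of_luxemburg_lt (ENNReal.lt_add_right h1.ne hε2.ne')
  obtain ⟨t, ht, ht1, ht2⟩ := exists_of_luxemburg_lt (ENNReal.lt_add_right h2.ne hε2.ne')
  have hst : 0 < s + t := add_pos hs ht
  have key : luxemburg μ Ψ (fun x => g x + g' x) ≤ ((s + t : ℝ≥0) : ℝ≥0∞) := by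
    refine luxemburg_le hst ?_
    set a : ℝ≥0 := s / (s + t) with ha
    set b : ℝ≥0 := t / (s + t) with hb
    have hab : (a : ℝ≥0∞) + b = 1 := by
      rw [← ENNReal.coe_add, ha, hb, ← add_div, div_self hst.ne', ENNReal.coe_one]
    have hpt : ∀ x, (g x + g' x) / ((s + t : ℝ≥0) : ℝ≥0∞)
        = a * (g x / s) + b * (g' x / t) := by
      intro x
      have e1 : (a : ℝ≥0∞) * (g x / s) = g x / ((s + t : ℝ≥0) : ℝ≥0∞) := by
        rw [ha, ENNReal.coe_div hst.ne', ENNReal.div_eq_inv_mul, ENNReal.div_eq_inv_mul,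
          ENNReal.div_eq_inv_mul, mul_assoc, ← mul_assoc (s : ℝ≥0∞),
          ENNReal.mul_inv_cancel (by exact_mod_cast hs.ne') ENNReal.coe_ne_top, one_mul]
      have e2 : (b : ℝ≥0∞) * (g' x / t) = g' x / ((s + t : ℝ≥0) : ℝ≥0∞) := by
        rw [hb, ENNReal.coe_div hst.ne', ENNReal.div_eq_inv_mul, ENNReal.div_eq_inv_mul,
          ENNReal.div_eq_inv_mul, mul_assoc, ← mul_assoc (t : ℝ≥0∞),
          ENNReal.mul_inv_cancel (by exact_mod_cast ht.ne') ENNReal.coe_ne_top, one_mul]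
      rw [e1, e2, ENNReal.add_div]
    calc ∫⁻ x, Ψ x ((g x + g' x) / ((s + t : ℝ≥0) : ℝ≥0∞)) ∂μ
        ≤ ∫⁻ x, (a * Ψ x (g x / s) + b * Ψ x (g' x / t)) ∂μ := by
          refine lintegral_mono fun x => ?_
          rw [hpt x]
          exact h.convex x _ _ _ _ hab
      _ = a * ∫⁻ x, Ψ x (g x / s) ∂μ + b * ∫⁻ x, Ψ x (g' x / t) ∂μ := by
          rw [lintegral_add_left' ((h.aemeasurable _ (hg.div_const _)).const_mul _),
            lintegral_const_mul' _ _ ENNReal.coe_ne_top,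
            lintegral_const_mul' _ _ ENNReal.coe_ne_top]
      _ ≤ a * 1 + b * 1 := by gcongr
      _ = 1 := by simpa using hab
  refine key.trans ?_
  calc ((s + t : ℝ≥0) : ℝ≥0∞) = s + t := ENNReal.coe_add _ _
    _ ≤ (luxemburg μ Ψ g + ((ε / 2 : ℝ≥0) : ℝ≥0∞))
        + (luxemburg μ Ψ g' + ((ε / 2 : ℝ≥0) : ℝ≥0∞)) := add_le_add hs2.le ht2.le
    _ = luxemburg μ Ψ g + luxemburg μ Ψ g' + (((ε / 2 : ℝ≥0) : ℝ≥0∞) + ((ε / 2 : ℝ≥0) : ℝ≥0∞)) :=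
        by abel
    _ = luxemburg μ Ψ g + luxemburg μ Ψ g' + ε := by
        rw [← ENNReal.coe_add, add_halves]

theorem luxemburg_smul_le (c : ℝ≥0) (hc : c ≠ 0) (g : ℝ → ℝ≥0∞) :
    luxemburg μ Ψ (fun x => c * g x) ≤ c * luxemburg μ Ψ g := by
  refine le_of_forall_gt fun t ht => ?_
  have hc0 : (c : ℝ≥0∞) ≠ 0 := by exact_mod_cast hc
  have h1 : luxemburg μ Ψ g < t / c := by
    rw [ENNReal.lt_div_iff_mul_lt (Or.inl hc0) (Or.inl ENNReal.coe_ne_top), mul_comm]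
    exact ht
  obtain ⟨s, hs, hs1, hs2⟩ := exists_of_luxemburg_lt h1
  have h2 : luxemburg μ Ψ (fun x => c * g x) ≤ ((c * s : ℝ≥0) : ℝ≥0∞) := by
    refine luxemburg_le (mul_pos (pos_iff_ne_zero.2 hc) hs) ?_
    convert hs1 using 4 with x
    rw [ENNReal.coe_mul, ENNReal.mul_div_mul_left _ _ hc0 ENNReal.coe_ne_top]
  refine h2.trans_lt ?_
  rw [ENNReal.lt_div_iff_mul_lt (Or.inl hc0) (Or.inl ENNReal.coe_ne_top), mul_comm] at hs2
  exact_mod_cast hs2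

theorem eq_zero_of_luxemburg (h : IsYoungIntegrand μ Ψ) {g : ℝ → ℝ≥0∞}
    (hg : AEMeasurable g μ) (h0 : luxemburg μ Ψ g = 0) : g =ᵐ[μ] fun _ => 0 := by
  have h1 : ∀ k : ℕ, ∫⁻ x, Ψ x (k * g x) ∂μ = 0 := by
    intro k
    refine le_antisymm (ENNReal.le_of_forall_pos_le_add fun ε hε _ => ?_) zero_le
    rw [zero_add]
    set a : ℝ≥0 := min ε 1 with ha
    have ha0 : 0 < a := lt_min hε one_pos
    have hk : (0 : ℝ≥0) < a / (k + 1) := div_pos ha0 (by positivity)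
    obtain ⟨s, hs, hs1, hs2⟩ := exists_of_luxemburg_lt
      (t := ((a / (k + 1) : ℝ≥0) : ℝ≥0∞)) (by rw [h0]; exact_mod_cast hk)
    have hs3 : (k : ℝ≥0) * s ≤ a := by
      have h5 : s < a / (k + 1) := by exact_mod_cast hs2
      rw [lt_div_iff₀ (by positivity)] at h5
      calc (k : ℝ≥0) * s ≤ s * (k + 1) := by
            rw [mul_comm]
            gcongr
            exact le_self_add
        _ ≤ a := h5.le
    have hpt : ∀ x, Ψ x (k * g x) ≤ a * Ψ x (g x / s) := by
      intro x
      refine le_trans (h.mono x ?_) (h.mul_le x (a := a) (by exact_mod_cast min_le_right _ _) _)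
      have hs0 : (s : ℝ≥0∞) ≠ 0 := by exact_mod_cast hs.ne'
      calc (k : ℝ≥0∞) * g x = (k * s) * (g x / s) := by
            rw [mul_assoc, ENNReal.mul_div_cancel hs0 ENNReal.coe_ne_top]
        _ ≤ a * (g x / s) := by
            gcongr
            exact_mod_cast hs3
    calc ∫⁻ x, Ψ x (k * g x) ∂μ ≤ ∫⁻ x, a * Ψ x (g x / s) ∂μ := lintegral_mono hpt
      _ = a * ∫⁻ x, Ψ x (g x / s) ∂μ := lintegral_const_mul' _ _ ENNReal.coe_ne_top
      _ ≤ a * 1 := by gcongr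
      _ ≤ ε := by
        rw [mul_one]
        exact_mod_cast min_le_left _ _
  have h2 : ∀ᵐ x ∂μ, ∀ k : ℕ, Ψ x (k * g x) = 0 := by
    rw [ae_all_iff]
    intro k
    exact (lintegral_eq_zero_iff' (h.aemeasurable _ (hg.const_mul _))).1 (h1 k)
  filter_upwards [h2] with x hx
  by_contra hne
  obtain ⟨k, hk⟩ := h.unbounded x (g x) hne
  exact hk (hx k)

/-- The Luxemburg norm as a function norm. -/
def functionNorm (h : IsYoungIntegrand μ Ψ) : FunctionNorm μ where
  toFun := luxemburg μ Ψ
  mono {g g'} hgg := by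
    refine le_of_forall_gt fun t ht => ?_
    obtain ⟨s, hs, hs1, hs2⟩ := exists_of_luxemburg_lt ht
    refine lt_of_le_of_lt (luxemburg_le hs (le_trans (lintegral_mono_ae ?_) hs1)) hs2
    filter_upwards [hgg] with x hx
    exact h.mono x (ENNReal.div_le_div_right hx _)
  zero := by
    refine le_antisymm (ENNReal.le_of_forall_pos_le_add fun ε hε _ => ?_) zero_le
    rw [zero_add]
    exact luxemburg_le hε (by simp [h.zero])
  add_le hg _ := h.luxemburg_add_le hg
  smul_le c hc g := luxemburg_smul_le c hc g
  eq_zero hg h0 := h.eq_zero_of_luxemburg hg h0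

/-- A function belongs to the space of the Luxemburg norm if and only if
`∫ Ψ(x, |f(x)| / s) dμ(x) < ∞` for some `s > 0`. -/
theorem mem_space_iff (h : IsYoungIntegrand μ Ψ) (f : ℝ →ₘ[μ] ℂ) :
    f ∈ h.functionNorm.space ↔ ∃ s : ℝ≥0, 0 < s ∧ ∫⁻ x, Ψ x (‖f x‖ₑ / s) ∂μ < ∞ := by
  constructor
  · intro hf
    obtain ⟨s, hs, hs1, -⟩ := exists_of_luxemburg_lt (show luxemburg μ Ψ _ < ∞ from hf)
    exact ⟨s, hs, hs1.trans_lt ENNReal.one_lt_top⟩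
  · rintro ⟨s, hs, hs1⟩
    lift ∫⁻ x, Ψ x (‖f x‖ₑ / s) ∂μ to ℝ≥0 using hs1.ne with I hI
    have hI1 : (0 : ℝ≥0) < I + 1 := by positivity
    refine lt_of_le_of_lt (luxemburg_le (s := s * (I + 1)) (mul_pos hs hI1) ?_)
      ENNReal.coe_lt_top
    have hpt : ∀ x, Ψ x (‖f x‖ₑ / ((s * (I + 1) : ℝ≥0) : ℝ≥0∞))
        ≤ ((I + 1)⁻¹ : ℝ≥0) * Ψ x (‖f x‖ₑ / s) := by
      intro x
      refine le_trans (h.mono x (le_of_eq ?_)) (h.mul_le x ?_ _)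
      · rw [ENNReal.coe_inv hI1.ne', ENNReal.coe_mul, ENNReal.div_eq_inv_mul,
          ENNReal.div_eq_inv_mul, ENNReal.mul_inv (Or.inr ENNReal.coe_ne_top)
          (Or.inl ENNReal.coe_ne_top), ← mul_assoc, mul_comm (s : ℝ≥0∞)⁻¹]
      · exact_mod_cast inv_le_one_of_one_le₀ (le_add_self : (1 : ℝ≥0) ≤ I + 1)
    refine (lintegral_mono hpt).trans ?_
    rw [lintegral_const_mul' _ _ ENNReal.coe_ne_top, ← hI, ← ENNReal.coe_mul]
    have : (I + 1)⁻¹ * I ≤ 1 := by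
      rw [inv_mul_le_iff₀ hI1, mul_one]
      exact le_self_add
    exact_mod_cast this

/-- The function space generated by an integrand, over `ℝ` and over `ℝ₊`. -/
def spacePair (h : IsYoungIntegrand volume Ψ) (h' : IsYoungIntegrand halfVolume Ψ) :
    SpacePair where
  line := h.functionNorm
  half := h'.functionNorm
  indicator_eq g := by
    change luxemburg volume Ψ _ = luxemburg halfVolume Ψ g
    have key : ∀ s : ℝ≥0, ∫⁻ x, Ψ x ((Ioi (0 : ℝ)).indicator g x / s)
        = ∫⁻ x in Ioi 0, Ψ x (g x / s) := by
      intro s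
      rw [← lintegral_indicator measurableSet_Ioi]
      refine lintegral_congr fun x => ?_
      by_cases hx : x ∈ Ioi (0 : ℝ)
      · simp only [indicator_of_mem hx]
      · simp only [indicator_of_notMem hx, ENNReal.zero_div, h.zero]
    simp only [luxemburg, key]

end IsYoungIntegrand

/-! ### Orlicz spaces -/

/-- A function `φ : [0, ∞) → [0, ∞]` (its values at negative numbers play no role) whose integral
is a Young function: nondecreasing, left-continuous, `φ(0) = 0`, `φ(∞) = ∞`, and not identically
infinite on `(0, ∞)`. -/
structure IsYoungDensity (φ : ℝ → ℝ≥0∞) : Prop where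
  mono : MonotoneOn φ (Ici 0)
  left_cont : ∀ t, 0 < t → ContinuousWithinAt φ (Iio t) t
  zero : φ 0 = 0
  tendsto : Tendsto φ atTop (𝓝 ∞)
  finite : ∃ t, 0 < t ∧ φ t < ∞

/-- The Young function `Φ(s) = ∫₀ˢ φ(t) dt`. -/
def youngFunction (φ : ℝ → ℝ≥0∞) (s : ℝ≥0∞) : ℝ≥0∞ :=
  ∫⁻ t in {t : ℝ | 0 < t ∧ ENNReal.ofReal t ≤ s}, φ t

theorem youngFunction_mono (φ : ℝ → ℝ≥0∞) : Monotone (youngFunction φ) := fun _ _ h =>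
  lintegral_mono_set fun _ ht => ⟨ht.1, ht.2.trans h⟩

theorem youngFunction_coe (φ : ℝ → ℝ≥0∞) (s : ℝ≥0) :
    youngFunction φ s = ∫⁻ t in Ioc 0 (s : ℝ), φ t := by
  have : {t : ℝ | 0 < t ∧ ENNReal.ofReal t ≤ s} = Ioc 0 (s : ℝ) := by
    ext t
    simp only [mem_ofPred_eq, mem_Ioc]
    refine and_congr_right fun _ => ?_
    rw [ENNReal.ofReal_le_iff_le_toReal ENNReal.coe_ne_top, ENNReal.coe_toReal]
  rw [youngFunction, this]

namespace IsYoungDensity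

variable {φ : ℝ → ℝ≥0∞}

theorem youngFunction_le (h : IsYoungDensity φ) {s m : ℝ≥0} (hsm : s ≤ m) :
    youngFunction φ m ≤ youngFunction φ s + (m - s : ℝ≥0) * φ m := by
  rw [youngFunction_coe, youngFunction_coe,
    ← Ioc_union_Ioc_eq_Ioc s.2 (show (s : ℝ) ≤ m from hsm)]
  refine (lintegral_union_le _ _ _).trans (add_le_add le_rfl ?_)
  calc ∫⁻ t in Ioc (s : ℝ) m, φ t ≤ ∫⁻ _ in Ioc (s : ℝ) m, φ m :=
        setLIntegral_mono measurable_const fun t ht =>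
          h.mono (s.2.trans ht.1.le) m.2 ht.2
    _ = (m - s : ℝ≥0) * φ m := by
        rw [setLIntegral_const, Real.volume_Ioc, mul_comm, ← NNReal.coe_sub hsm,
          ENNReal.ofReal_coe_nnreal]

theorem le_youngFunction (h : IsYoungDensity φ) {m t : ℝ≥0} (hmt : m ≤ t) :
    youngFunction φ m + (t - m : ℝ≥0) * φ m ≤ youngFunction φ t := by
  rw [youngFunction_coe, youngFunction_coe,
    ← Ioc_union_Ioc_eq_Ioc m.2 (show (m : ℝ) ≤ t from hmt),
    lintegral_union measurableSet_Ioc (by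
      rw [Set.disjoint_left]
      intro x hx hx'
      exact absurd hx.2 (not_le.2 hx'.1))]
  refine add_le_add le_rfl ?_
  calc ((t - m : ℝ≥0) : ℝ≥0∞) * φ m = ∫⁻ _ in Ioc (m : ℝ) t, φ m := by
        rw [setLIntegral_const, Real.volume_Ioc, mul_comm, ← NNReal.coe_sub hmt,
          ENNReal.ofReal_coe_nnreal]
    _ ≤ ∫⁻ u in Ioc (m : ℝ) t, φ u :=
        setLIntegral_mono' measurableSet_Ioc fun u hu =>
          h.mono m.2 (show (0 : ℝ) ≤ u from m.2.trans hu.1.le) hu.1.le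

theorem youngFunction_top (h : IsYoungDensity φ) : youngFunction φ ∞ = ∞ := by
  obtain ⟨c, hc⟩ := (h.tendsto.eventually
    (lt_mem_nhds (show (1 : ℝ≥0∞) < ∞ from ENNReal.one_lt_top))).exists_forall_of_atTop
  refine top_unique ?_
  calc (∞ : ℝ≥0∞) = ∫⁻ _ in Ioi (max c 0), (1 : ℝ≥0∞) := by simp
    _ ≤ ∫⁻ t in Ioi (max c 0), φ t :=
        setLIntegral_mono' measurableSet_Ioi fun t ht =>
          (hc t ((le_max_left _ _).trans (le_of_lt ht))).le
    _ ≤ youngFunction φ ∞ :=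
        lintegral_mono_set fun t ht => ⟨(le_max_right _ _).trans_lt ht, le_top⟩

theorem youngFunction_convex (h : IsYoungDensity φ) (a b s t : ℝ≥0∞) (hab : a + b = 1) :
    youngFunction φ (a * s + b * t) ≤ a * youngFunction φ s + b * youngFunction φ t := by
  wlog hst : s ≤ t generalizing a b s t
  · rw [add_comm (a * s), add_comm (a * youngFunction φ s)]
    exact this b a t s (by rw [add_comm, hab]) (le_of_not_ge hst)
  have ha : a ≠ ∞ := fun h' => by simp [h'] at hab
  have hb : b ≠ ∞ := fun h' => by simp [h'] at hab
  by_cases ht : t = ∞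
  · by_cases hb0 : b = 0
    · have : a = 1 := by simpa [hb0] using hab
      simp [hb0, this]
    · rw [ht, h.youngFunction_top, ENNReal.mul_top hb0]
      simp
  have hs : s ≠ ∞ := ne_top_of_le_ne_top ht hst
  lift a to ℝ≥0 using ha
  lift b to ℝ≥0 using hb
  lift s to ℝ≥0 using hs
  lift t to ℝ≥0 using ht
  have hab' : a + b = 1 := by exact_mod_cast hab
  have hst' : s ≤ t := by exact_mod_cast hst
  set m : ℝ≥0 := a * s + b * t with hm
  have hcoe : (a : ℝ≥0∞) * s + b * t = (m : ℝ≥0∞) := by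
    rw [hm]
    push_cast
    rfl
  rw [hcoe]
  have hsm : s ≤ m := by
    calc s = a * s + b * s := by rw [← add_mul, hab', one_mul]
      _ ≤ m := by rw [hm]; gcongr
  have hmt : m ≤ t := by
    calc m ≤ a * t + b * t := by rw [hm]; gcongr
      _ = t := by rw [← add_mul, hab', one_mul]
  have hbal : a * (m - s) = b * (t - m) := by
    have e : (a : ℝ) + b = 1 := by exact_mod_cast hab'
    have e2 : (m : ℝ) = a * s + b * t := by rw [hm]; push_cast; rfl
    apply NNReal.coe_injective
    rw [NNReal.coe_mul, NNReal.coe_mul, NNReal.coe_sub hsm, NNReal.coe_sub hmt, e2]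
    have e3 : (a : ℝ) = 1 - b := by linarith
    rw [e3]
    ring
  calc youngFunction φ m = a * youngFunction φ m + b * youngFunction φ m := by
        rw [← add_mul, hab, one_mul]
    _ ≤ a * (youngFunction φ s + (m - s : ℝ≥0) * φ m) + b * youngFunction φ m := by
        gcongr
        exact h.youngFunction_le hsm
    _ = a * youngFunction φ s + ((a * (m - s) : ℝ≥0) * φ m + b * youngFunction φ m) := by
        rw [ENNReal.coe_mul, mul_add, mul_assoc, add_assoc]
    _ = a * youngFunction φ s + b * (youngFunction φ m + (t - m : ℝ≥0) * φ m) := by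
        rw [hbal, ENNReal.coe_mul, mul_add, mul_assoc, add_comm ((b : ℝ≥0∞) * _) (b * _)]
    _ ≤ a * youngFunction φ s + b * youngFunction φ t := by
        gcongr
        exact h.le_youngFunction hmt

theorem isYoungIntegrand (h : IsYoungDensity φ) (μ : Measure ℝ) :
    IsYoungIntegrand μ (fun _ => youngFunction φ) where
  zero _ := by
    have := youngFunction_coe φ 0
    simpa using this
  mono _ := youngFunction_mono φ
  convex _ := h.youngFunction_convex
  unbounded _ s hs := by
    by_contra! hall
    obtain ⟨c, hc⟩ :=
      (h.tendsto.eventually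
        (lt_mem_nhds (show (0 : ℝ≥0∞) < ∞ from ENNReal.zero_lt_top))).exists_forall_of_atTop
    obtain ⟨k, hk⟩ := ENNReal.exists_nat_mul_gt hs (b := ENNReal.ofReal (max c 0 + 1))
      ENNReal.ofReal_ne_top
    have h1 : ∫⁻ t in Ioc (max c 0) (max c 0 + 1), φ t = 0 := by
      refine le_antisymm ?_ zero_le
      rw [← hall k]
      refine lintegral_mono_set fun t ht => ⟨(le_max_right _ _).trans_lt ht.1, ?_⟩
      exact (ENNReal.ofReal_le_ofReal ht.2).trans hk.le
    have h2 : 0 < φ (max c 0) := hc _ (le_max_left _ _)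
    have h3 : φ (max c 0) ≤ ∫⁻ t in Ioc (max c 0) (max c 0 + 1), φ t := by
      calc φ (max c 0) = ∫⁻ _ in Ioc (max c 0) (max c 0 + 1), φ (max c 0) := by
            rw [setLIntegral_const, Real.volume_Ioc]
            simp
        _ ≤ _ := setLIntegral_mono' measurableSet_Ioc fun u hu =>
            h.mono (show (0 : ℝ) ≤ max c 0 from le_max_right _ _)
              (show (0 : ℝ) ≤ u from (le_max_right _ _).trans hu.1.le) hu.1.le
    rw [h1] at h3
    exact absurd h3 (not_le.2 h2)
  aemeasurable _ hg := (youngFunction_mono φ).measurable.comp_aemeasurable hg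

end IsYoungDensity

/-- The Orlicz space `L^Φ`, where `Φ(s) = ∫₀ˢ φ(t) dt`. -/
def orlicz {φ : ℝ → ℝ≥0∞} (h : IsYoungDensity φ) : SpacePair :=
  IsYoungIntegrand.spacePair (h.isYoungIntegrand volume) (h.isYoungIntegrand halfVolume)

/-- A normed space is reflexive if the canonical map into its bidual is onto. -/
def IsReflexive (E : Type*) [NormedAddCommGroup E] [NormedSpace ℂ E] : Prop :=
  Function.Surjective (NormedSpace.inclusionInDoubleDual ℂ E)

/-! ### Variable Lebesgue spaces -/

/-- A variable exponent: a (Lebesgue) measurable function with values in `[1, ∞)`. -/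
structure IsVariableExponent (p : ℝ → ℝ) : Prop where
  aemeasurable : AEMeasurable p volume
  one_le : ∀ x, 1 ≤ p x

theorem IsVariableExponent.isYoungIntegrand {p : ℝ → ℝ} (h : IsVariableExponent p)
    {μ : Measure ℝ} (hμ : μ ≪ volume) : IsYoungIntegrand μ (fun x s => s ^ p x) where
  zero x := ENNReal.zero_rpow_of_pos (zero_lt_one.trans_le (h.one_le x))
  mono x := ENNReal.monotone_rpow_of_nonneg (zero_le_one.trans (h.one_le x))
  convex x a b s t hab := ENNReal.rpow_arith_mean_le_arith_mean2_rpow a b s t hab (h.one_le x)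
  unbounded x s hs := ⟨1, by
    rw [Nat.cast_one, one_mul]
    intro h0
    rcases ENNReal.rpow_eq_zero_iff.1 h0 with h1 | h1
    · exact hs h1.1
    · exact absurd h1.2 (not_lt.2 (zero_le_one.trans (h.one_le x)))⟩
  aemeasurable g hg := hg.pow (h.aemeasurable.mono_ac hμ)

/-- The variable Lebesgue space `L^{p(·)}`. -/
def variableLebesgue {p : ℝ → ℝ} (h : IsVariableExponent p) : SpacePair :=
  IsYoungIntegrand.spacePair (h.isYoungIntegrand Measure.AbsolutelyContinuous.rfl)
    (h.isYoungIntegrand Measure.absolutelyContinuous_restrict)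

/-- The Hardy-Littlewood maximal function: the supremum of the averages of `|f|` over the bounded
intervals that contain `x` (closed intervals suffice). -/
def maximalFunction (f : ℝ → ℂ) (x : ℝ) : ℝ≥0∞ :=
  ⨆ (a : ℝ) (b : ℝ) (_ : a < b) (_ : x ∈ Icc a b),
    (∫⁻ t in Icc a b, ‖f t‖ₑ) / ENNReal.ofReal (b - a)

/-- The class `𝓑_M(ℝ)`: `1 < p₋`, `p₊ < ∞`, and the maximal operator is bounded on
`L^{p(·)}(ℝ)`. -/
structure IsMaximalExponent (p : ℝ → ℝ) : Prop extends IsVariableExponent p where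
  one_lt_inf : ∃ c, 1 < c ∧ ∀ᵐ x, c ≤ p x
  sup_lt_top : ∃ c, ∀ᵐ x, p x ≤ c
  maximal_bounded : ∃ C : ℝ≥0, ∀ f : ℝ →ₘ[volume] ℂ,
    f ∈ (variableLebesgue toIsVariableExponent).line.space →
      (variableLebesgue toIsVariableExponent).line.toFun (maximalFunction f)
        ≤ C * (variableLebesgue toIsVariableExponent).line.eval f

/-! ### Lorentz spaces -/

/-- The distribution function `μ_g`. -/
def distribution (μ : Measure ℝ) (g : ℝ → ℝ≥0∞) (l : ℝ≥0∞) : ℝ≥0∞ := μ {x | l < g x}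

/-- The nonincreasing rearrangement `g*(t) = inf {l ≥ 0 : μ_g(l) ≤ t}` (`inf ∅ = ∞`). -/
def rearrangement (μ : Measure ℝ) (g : ℝ → ℝ≥0∞) (t : ℝ) : ℝ≥0∞ :=
  sInf {l : ℝ≥0∞ | distribution μ g l ≤ ENNReal.ofReal t}

/-- The maximal average `g**(t) = t⁻¹ ∫₀ᵗ g*(s) ds`. -/
def rearrangementAverage (μ : Measure ℝ) (g : ℝ → ℝ≥0∞) (t : ℝ) : ℝ≥0∞ :=
  (∫⁻ s in Ioo 0 t, rearrangement μ g s) / ENNReal.ofReal t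

/-- The Lorentz norm `(∫₀^∞ (t^{1/p} g**(t))^q dt / t)^{1/q}`. -/
def lorentzFun (μ : Measure ℝ) (p q : ℝ) (g : ℝ → ℝ≥0∞) : ℝ≥0∞ :=
  (∫⁻ t in Ioi (0 : ℝ),
    (ENNReal.ofReal (t ^ (1 / p)) * rearrangementAverage μ g t) ^ q / ENNReal.ofReal t) ^ (1 / q)

section Lorentz

variable {μ : Measure ℝ} {g h : ℝ → ℝ≥0∞}

theorem distribution_mono (hgh : g ≤ᵐ[μ] h) (l : ℝ≥0∞) :
    distribution μ g l ≤ distribution μ h l := by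
  refine measure_mono_ae ?_
  filter_upwards [hgh] with x hx hl
  exact lt_of_lt_of_le hl hx

theorem rearrangement_mono (hgh : g ≤ᵐ[μ] h) (t : ℝ) :
    rearrangement μ g t ≤ rearrangement μ h t :=
  sInf_le_sInf fun l hl => (distribution_mono hgh l).trans hl

theorem rearrangement_antitone (μ : Measure ℝ) (g : ℝ → ℝ≥0∞) : Antitone (rearrangement μ g) :=
  fun _ _ hst => sInf_le_sInf fun _ hl => le_trans hl (ENNReal.ofReal_le_ofReal hst)

theorem rearrangement_le_iff {t : ℝ} {l : ℝ≥0∞} :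
    rearrangement μ g t ≤ l ↔ distribution μ g l ≤ ENNReal.ofReal t := by
  refine ⟨fun hl => ?_, fun hl => sInf_le hl⟩
  by_cases htop : l = ∞
  · simp [htop, distribution]
  have hgt : ∀ m, l < m → distribution μ g m ≤ ENNReal.ofReal t := by
    intro m hm
    obtain ⟨k, hk, hkm⟩ := sInf_lt_iff.1 (lt_of_le_of_lt hl hm)
    exact le_trans (measure_mono fun x hx => lt_trans hkm hx) hk
  obtain ⟨u, hu, hul, hulim⟩ := exists_seq_strictAnti_tendsto' (lt_top_iff_ne_top.2 htop)
  have hset : {x | l < g x} = ⋃ k, {x | u k < g x} := by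
    ext x
    simp only [mem_ofPred_eq, mem_iUnion]
    refine ⟨fun hx => (hulim.eventually (gt_mem_nhds hx)).exists, ?_⟩
    rintro ⟨k, hk⟩
    exact (hul k).1.trans hk
  have hmono : Monotone fun k => {x | u k < g x} :=
    fun i j hij x hx => lt_of_le_of_lt (hu.antitone hij) hx
  rw [distribution, hset, hmono.measure_iUnion]
  exact iSup_le fun k => hgt _ (hul k).1

theorem distribution_rearrangement (μ : Measure ℝ) (g : ℝ → ℝ≥0∞) (t : ℝ) :
    μ {x | rearrangement μ g t < g x} ≤ ENNReal.ofReal t :=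
  rearrangement_le_iff.1 le_rfl

theorem volume_ofReal_lt (y : ℝ≥0∞) : volume {s : ℝ | 0 < s ∧ ENNReal.ofReal s < y} = y := by
  by_cases hy : y = ∞
  · have : {s : ℝ | 0 < s ∧ ENNReal.ofReal s < y} = Ioi 0 := by
      ext s
      simp [hy]
    rw [this, hy, Real.volume_Ioi]
  · have : {s : ℝ | 0 < s ∧ ENNReal.ofReal s < y} = Ioo 0 y.toReal := by
      ext s
      simp only [mem_ofPred_eq, mem_Ioo]
      refine and_congr_right fun hs => ?_
      rw [ENNReal.ofReal_lt_iff_lt_toReal hs.le hy]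
    rw [this, Real.volume_Ioo, sub_zero, ENNReal.ofReal_toReal hy]

theorem lintegral_eq_distribution [SFinite μ] (hg : Measurable g) :
    ∫⁻ x, g x ∂μ = ∫⁻ l in Ioi (0 : ℝ), distribution μ g (ENNReal.ofReal l) := by
  have hmeas : MeasurableSet {z : ℝ × ℝ | ENNReal.ofReal z.2 < g z.1} :=
    measurableSet_lt (ENNReal.measurable_ofReal.comp measurable_snd) (hg.comp measurable_fst)
  have e1 : ∀ x, g x = ∫⁻ l in Ioi (0 : ℝ),
      {z : ℝ × ℝ | ENNReal.ofReal z.2 < g z.1}.indicator (fun _ => (1 : ℝ≥0∞)) (x, l) := by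
    intro x
    have hm : MeasurableSet {l : ℝ | ENNReal.ofReal l < g x} :=
      measurableSet_lt ENNReal.measurable_ofReal measurable_const
    have : ∀ l : ℝ, {z : ℝ × ℝ | ENNReal.ofReal z.2 < g z.1}.indicator
        (fun _ => (1 : ℝ≥0∞)) (x, l)
        = {l : ℝ | ENNReal.ofReal l < g x}.indicator (fun _ => 1) l := fun l => rfl
    simp only [this]
    rw [lintegral_indicator hm, setLIntegral_one, Measure.restrict_apply hm]
    conv_lhs => rw [← volume_ofReal_lt (g x)]
    congr 1
    ext l
    simp [and_comm]
  calc ∫⁻ x, g x ∂μ = ∫⁻ x, (∫⁻ l in Ioi (0 : ℝ),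
        {z : ℝ × ℝ | ENNReal.ofReal z.2 < g z.1}.indicator (fun _ => (1 : ℝ≥0∞)) (x, l)) ∂μ :=
        lintegral_congr e1
    _ = ∫⁻ l in Ioi (0 : ℝ), ∫⁻ x,
        {z : ℝ × ℝ | ENNReal.ofReal z.2 < g z.1}.indicator (fun _ => (1 : ℝ≥0∞)) (x, l) ∂μ :=
        lintegral_lintegral_swap (μ := μ) (ν := volume.restrict (Ioi (0 : ℝ)))
          (f := fun x l => {z : ℝ × ℝ | ENNReal.ofReal z.2 < g z.1}.indicator
          (fun _ => (1 : ℝ≥0∞)) (x, l)) (measurable_const.indicator hmeas).aemeasurable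
    _ = _ := by
        refine lintegral_congr fun l => ?_
        have hm : MeasurableSet {x : ℝ | ENNReal.ofReal l < g x} :=
          measurableSet_lt measurable_const hg
        have : ∀ x : ℝ, {z : ℝ × ℝ | ENNReal.ofReal z.2 < g z.1}.indicator
            (fun _ => (1 : ℝ≥0∞)) (x, l)
            = {x : ℝ | ENNReal.ofReal l < g x}.indicator (fun _ => 1) x := fun x => rfl
        simp only [this]
        rw [lintegral_indicator hm, setLIntegral_one, distribution]

theorem lintegral_rearrangement [SFinite μ] (hg : AEMeasurable g μ) :
    ∫⁻ s in Ioi (0 : ℝ), rearrangement μ g s = ∫⁻ x, g x ∂μ := by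
  have hr : ∀ t, rearrangement μ g t = rearrangement μ (hg.mk g) t := fun t =>
    le_antisymm (rearrangement_mono hg.ae_eq_mk.le t) (rearrangement_mono hg.ae_eq_mk.symm.le t)
  rw [lintegral_congr_ae hg.ae_eq_mk, lintegral_eq_distribution hg.measurable_mk]
  simp only [hr]
  rw [lintegral_eq_distribution (rearrangement_antitone μ _).measurable]
  refine lintegral_congr fun l => ?_
  have hm : MeasurableSet {s : ℝ | ENNReal.ofReal l < rearrangement μ (hg.mk g) s} :=
    measurableSet_lt measurable_const (rearrangement_antitone μ _).measurable
  rw [distribution, Measure.restrict_apply hm]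
  conv_rhs => rw [← volume_ofReal_lt (distribution μ (hg.mk g) (ENNReal.ofReal l))]
  congr 1
  ext s
  simp only [mem_inter_iff, mem_ofPred_eq, mem_Ioi]
  rw [and_comm]
  refine and_congr_right fun _ => ?_
  rw [← not_le, rearrangement_le_iff, not_le]

theorem lintegral_Ioo_rearrangement_le [SFinite μ] (hg : AEMeasurable g μ) (t : ℝ) (l : ℝ≥0∞) :
    ∫⁻ s in Ioo 0 t, rearrangement μ g s
      ≤ ∫⁻ x, (g x - l) ∂μ + ENNReal.ofReal t * l := by
  have h1 : ∀ s, rearrangement μ g s ≤ rearrangement μ (fun x => g x - l) s + l := by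
    intro s
    rw [rearrangement_le_iff]
    refine le_trans (measure_mono ?_) (distribution_rearrangement μ (fun x => g x - l) s)
    intro x hx
    exact lt_tsub_iff_right.2 (show _ + l < g x from hx)
  calc ∫⁻ s in Ioo 0 t, rearrangement μ g s
      ≤ ∫⁻ s in Ioo 0 t, (rearrangement μ (fun x => g x - l) s + l) := lintegral_mono h1
    _ = (∫⁻ s in Ioo 0 t, rearrangement μ (fun x => g x - l) s) + ENNReal.ofReal t * l := by
        rw [lintegral_add_right _ measurable_const, setLIntegral_const, Real.volume_Ioo, sub_zero,
          mul_comm l]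
    _ ≤ (∫⁻ s in Ioi (0 : ℝ), rearrangement μ (fun x => g x - l) s) + ENNReal.ofReal t * l :=
        add_le_add (lintegral_mono_set Ioo_subset_Ioi_self) le_rfl
    _ = _ := by rw [lintegral_rearrangement (hg.sub_const l)]

theorem exists_lintegral_Ioo_rearrangement [SFinite μ] (hg : AEMeasurable g μ) {t : ℝ}
    (ht : 0 < t) :
    ∃ l : ℝ≥0∞, ∫⁻ x, (g x - l) ∂μ + ENNReal.ofReal t * l
      ≤ ∫⁻ s in Ioo 0 t, rearrangement μ g s := by
  set l := rearrangement μ g t with hl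
  have hlow : ∀ s ∈ Ioo 0 t, l ≤ rearrangement μ g s := fun s hs =>
    rearrangement_antitone μ g hs.2.le
  have hle : ∀ s, rearrangement μ (fun x => g x - l) s ≤ rearrangement μ g s - l := by
    intro s
    rw [rearrangement_le_iff]
    refine le_trans (measure_mono ?_) (distribution_rearrangement μ g s)
    intro x hx
    by_contra hcon
    exact absurd hx (not_lt.2 (tsub_le_tsub_right (not_lt.1 hcon) l))
  refine ⟨l, ?_⟩
  rw [← lintegral_rearrangement (hg.sub_const l), ← Ioo_union_Ici_eq_Ioi ht]
  have hz : ∫⁻ s in Ici t, rearrangement μ (fun x => g x - l) s = 0 := by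
    refine le_antisymm ?_ zero_le
    calc _ ≤ ∫⁻ _ in Ici t, (0 : ℝ≥0∞) := setLIntegral_mono' measurableSet_Ici fun s hs =>
          (hle s).trans (tsub_le_iff_right.2 (by
            rw [zero_add]
            exact rearrangement_antitone μ g hs))
      _ = 0 := by simp
  calc _ ≤ ((∫⁻ s in Ioo 0 t, rearrangement μ (fun x => g x - l) s)
          + ∫⁻ s in Ici t, rearrangement μ (fun x => g x - l) s) + ENNReal.ofReal t * l :=
        add_le_add (lintegral_union_le _ _ _) le_rfl
    _ ≤ (∫⁻ s in Ioo 0 t, (rearrangement μ g s - l)) + ENNReal.ofReal t * l := by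
        rw [hz, add_zero]
        exact add_le_add (lintegral_mono hle) le_rfl
    _ = ∫⁻ s in Ioo 0 t, ((rearrangement μ g s - l) + l) := by
        rw [lintegral_add_right _ measurable_const, setLIntegral_const, Real.volume_Ioo, sub_zero,
          mul_comm]
    _ = ∫⁻ s in Ioo 0 t, rearrangement μ g s :=
        setLIntegral_congr_fun measurableSet_Ioo fun s hs => tsub_add_cancel_of_le (hlow s hs)

theorem rearrangementAverage_add_le [SFinite μ] (hg : AEMeasurable g μ) (hh : AEMeasurable h μ)
    {t : ℝ} (ht : 0 < t) :
    rearrangementAverage μ (fun x => g x + h x) t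
      ≤ rearrangementAverage μ g t + rearrangementAverage μ h t := by
  rw [rearrangementAverage, rearrangementAverage, rearrangementAverage, ← ENNReal.add_div]
  refine ENNReal.div_le_div_right ?_ _
  obtain ⟨l, hl⟩ := exists_lintegral_Ioo_rearrangement hg ht
  obtain ⟨m, hm⟩ := exists_lintegral_Ioo_rearrangement hh ht
  calc ∫⁻ s in Ioo 0 t, rearrangement μ (fun x => g x + h x) s
      ≤ ∫⁻ x, (g x + h x - (l + m)) ∂μ + ENNReal.ofReal t * (l + m) :=
        lintegral_Ioo_rearrangement_le (hg.add hh) t _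
    _ ≤ ∫⁻ x, ((g x - l) + (h x - m)) ∂μ + ENNReal.ofReal t * (l + m) := by
        gcongr with x
        exact add_tsub_add_le_tsub_add_tsub
    _ = (∫⁻ x, (g x - l) ∂μ + ENNReal.ofReal t * l)
        + (∫⁻ x, (h x - m) ∂μ + ENNReal.ofReal t * m) := by
        rw [lintegral_add_left' (hg.sub_const l), mul_add]
        abel
    _ ≤ _ := add_le_add hl hm

theorem measurable_rearrangementAverage (μ : Measure ℝ) (g : ℝ → ℝ≥0∞) :
    Measurable (rearrangementAverage μ g) := by
  refine Measurable.div (Monotone.measurable fun s t hst => ?_) ENNReal.measurable_ofReal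
  exact lintegral_mono_set (Ioo_subset_Ioo_right hst)

theorem rearrangement_smul_le (c : ℝ≥0) (hc : c ≠ 0) (t : ℝ) :
    rearrangement μ (fun x => c * g x) t ≤ c * rearrangement μ g t := by
  rw [rearrangement_le_iff]
  refine le_trans (measure_mono ?_) (distribution_rearrangement μ g t)
  intro x hx
  exact (ENNReal.mul_lt_mul_iff_right (by exact_mod_cast hc) ENNReal.coe_ne_top).1 hx

theorem lorentzFun_eq_lpNorm (μ : Measure ℝ) (p q : ℝ) (g : ℝ → ℝ≥0∞) :
    lorentzFun μ p q g = (∫⁻ t, (ENNReal.ofReal (t ^ (1 / p)) * rearrangementAverage μ g t) ^ q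
      ∂((volume.restrict (Ioi (0 : ℝ))).withDensity fun t => (ENNReal.ofReal t)⁻¹)) ^ (1 / q) := by
  rw [lorentzFun, lintegral_withDensity_eq_lintegral_mul _ (f := fun t => (ENNReal.ofReal t)⁻¹)
    ENNReal.measurable_ofReal.inv]
  · simp only [Pi.mul_apply, ENNReal.div_eq_inv_mul]
  · exact ((ENNReal.measurable_ofReal.comp (by fun_prop)).mul
      (measurable_rearrangementAverage μ g)).pow_const q

theorem lorentzFun_mono_of_average {p q : ℝ} (hq : 0 ≤ q) {ν : Measure ℝ}
    (H : ∀ t, 0 < t → rearrangementAverage μ g t ≤ rearrangementAverage ν h t) :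
    lorentzFun μ p q g ≤ lorentzFun ν p q h := by
  refine ENNReal.rpow_le_rpow (setLIntegral_mono' measurableSet_Ioi fun t ht => ?_) (by positivity)
  refine ENNReal.div_le_div_right (ENNReal.rpow_le_rpow ?_ hq) _
  gcongr
  exact H t ht

theorem lorentzFun_add_le [SFinite μ] {p q : ℝ} (hq : 1 < q) (hg : AEMeasurable g μ)
    (hh : AEMeasurable h μ) :
    lorentzFun μ p q (fun x => g x + h x) ≤ lorentzFun μ p q g + lorentzFun μ p q h := by
  have hm : ∀ k : ℝ → ℝ≥0∞, Measurable
      fun t : ℝ => ENNReal.ofReal (t ^ (1 / p)) * rearrangementAverage μ k t := fun k =>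
    (ENNReal.measurable_ofReal.comp (by fun_prop)).mul (measurable_rearrangementAverage μ k)
  rw [lorentzFun_eq_lpNorm μ p q g, lorentzFun_eq_lpNorm μ p q h, lorentzFun_eq_lpNorm]
  refine le_trans ?_
    (ENNReal.lintegral_Lp_add_le (hm g).aemeasurable (hm h).aemeasurable hq.le)
  refine ENNReal.rpow_le_rpow (lintegral_mono_ae ?_) (one_div_nonneg.2 (zero_le_one.trans hq.le))
  refine (withDensity_absolutelyContinuous _ _).ae_le ?_
  filter_upwards [ae_restrict_mem measurableSet_Ioi] with t ht
  refine ENNReal.rpow_le_rpow ?_ (by positivity)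
  rw [Pi.add_apply, ← mul_add]
  gcongr
  exact rearrangementAverage_add_le hg hh ht

theorem lorentzFun_smul_le {p q : ℝ} (hq : 1 < q) (c : ℝ≥0) (hc : c ≠ 0) (g : ℝ → ℝ≥0∞) :
    lorentzFun μ p q (fun x => c * g x) ≤ c * lorentzFun μ p q g := by
  have hq0 : 0 < q := by positivity
  have hav : ∀ t, rearrangementAverage μ (fun x => c * g x) t
      ≤ c * rearrangementAverage μ g t := by
    intro t
    rw [rearrangementAverage, rearrangementAverage, ← mul_div_assoc]
    refine ENNReal.div_le_div_right ?_ _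
    rw [← lintegral_const_mul' _ _ ENNReal.coe_ne_top]
    exact lintegral_mono fun s => rearrangement_smul_le c hc s
  have hcq : (c : ℝ≥0∞) ^ q ≠ ∞ := ENNReal.rpow_ne_top_of_nonneg hq0.le ENNReal.coe_ne_top
  calc lorentzFun μ p q (fun x => c * g x)
      ≤ (∫⁻ t in Ioi (0 : ℝ), (c : ℝ≥0∞) ^ q * ((ENNReal.ofReal (t ^ (1 / p))
          * rearrangementAverage μ g t) ^ q / ENNReal.ofReal t)) ^ (1 / q) := by
        refine ENNReal.rpow_le_rpow (lintegral_mono fun t => ?_) (by positivity)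
        rw [← mul_div_assoc, ← ENNReal.mul_rpow_of_nonneg _ _ hq0.le]
        refine ENNReal.div_le_div_right (ENNReal.rpow_le_rpow ?_ hq0.le) _
        rw [mul_left_comm]
        gcongr
        exact hav t
    _ = c * lorentzFun μ p q g := by
        rw [lintegral_const_mul' _ _ hcq, ENNReal.mul_rpow_of_nonneg _ _ (by positivity),
          ← ENNReal.rpow_mul, mul_one_div_cancel hq0.ne', ENNReal.rpow_one, lorentzFun]

theorem eq_zero_of_lorentzFun {p q : ℝ} (hq : 1 < q) (h0 : lorentzFun μ p q g = 0) :
    g =ᵐ[μ] fun _ => 0 := by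
  have hq0 : 0 < q := by positivity
  have hm : Measurable fun t : ℝ => (ENNReal.ofReal (t ^ (1 / p))
      * rearrangementAverage μ g t) ^ q / ENNReal.ofReal t :=
    (((ENNReal.measurable_ofReal.comp (by fun_prop)).mul
      (measurable_rearrangementAverage μ g)).pow_const q).div ENNReal.measurable_ofReal
  rw [lorentzFun, ENNReal.rpow_eq_zero_iff_of_pos (by positivity), lintegral_eq_zero_iff hm] at h0
  have hav : ∀ᵐ t ∂(volume.restrict (Ioi (0 : ℝ))),
      ∫⁻ s in Ioo 0 t, rearrangement μ g s = 0 := by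
    filter_upwards [h0, ae_restrict_mem measurableSet_Ioi] with t ht ht0
    have ht0' : (0 : ℝ) < t := ht0
    have h3 : 0 < t ^ p⁻¹ := Real.rpow_pos_of_pos ht0' _
    simpa [ENNReal.div_eq_zero_iff, ENNReal.rpow_eq_zero_iff_of_pos hq0, rearrangementAverage,
      not_le.2 h3] using ht
  have hex : ∃ t, 0 < t ∧ ∫⁻ s in Ioo 0 t, rearrangement μ g s = 0 := by
    have hne : NeBot (ae (volume.restrict (Ioi (0 : ℝ)))) := by
      rw [ae_neBot]
      intro hz
      have := congrArg (fun m : Measure ℝ => m univ) hz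
      simp at this
    obtain ⟨t, ht1, ht2⟩ := (hav.and (ae_restrict_mem measurableSet_Ioi)).exists
    exact ⟨t, ht2, ht1⟩
  obtain ⟨t, ht, hI⟩ := hex
  rw [lintegral_eq_zero_iff (rearrangement_antitone μ g).measurable] at hI
  have hall : ∀ s, 0 < s → rearrangement μ g s = 0 := by
    intro s hs
    have hne : NeBot (ae (volume.restrict (Ioo 0 (min s t)))) := by
      rw [ae_neBot]
      intro hz
      have := congrArg (fun m : Measure ℝ => m univ) hz
      simp at this
      exact this.elim (not_le.2 hs) (not_le.2 ht)
    obtain ⟨r, hr1, hr2⟩ := ((ae_restrict_of_ae_restrict_of_subset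
      (Ioo_subset_Ioo_right (min_le_right s t)) hI).and (ae_restrict_mem measurableSet_Ioo)).exists
    refine le_antisymm ?_ zero_le
    calc rearrangement μ g s ≤ rearrangement μ g r :=
          rearrangement_antitone μ g (hr2.2.le.trans (min_le_left _ _))
      _ = 0 := hr1
  have hd : distribution μ g 0 = 0 := by
    refine le_antisymm (ENNReal.le_of_forall_pos_le_add fun ε hε _ => ?_) zero_le
    rw [zero_add]
    have := rearrangement_le_iff.1 (hall (ε : ℝ) (by exact_mod_cast hε)).le
    simpa using this
  rw [Filter.EventuallyEq, ae_iff]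
  simpa [distribution, pos_iff_ne_zero] using hd

end Lorentz

/-- The Lorentz norm as a function norm. -/
def lorentzNorm (μ : Measure ℝ) [SFinite μ] (p q : ℝ) (hq : 1 < q) : FunctionNorm μ where
  toFun := lorentzFun μ p q
  mono hgh := lorentzFun_mono_of_average (by positivity) fun t _ =>
    ENNReal.div_le_div_right (lintegral_mono fun s => rearrangement_mono hgh s) _
  zero := by
    have h1 : ∀ t, rearrangement μ (fun _ => 0) t = 0 := fun t =>
      le_antisymm (rearrangement_le_iff.2 (by simp [distribution])) zero_le
    have hq0 : 0 < q := by positivity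
    simp [lorentzFun, rearrangementAverage, h1, hq0]
  add_le hg hh := lorentzFun_add_le hq hg hh
  smul_le c hc g := lorentzFun_smul_le hq c hc g
  eq_zero _ h0 := eq_zero_of_lorentzFun hq h0

/-- The Lorentz space `L^{p,q}`. -/
def lorentz (p q : ℝ) (hq : 1 < q) : SpacePair where
  line := lorentzNorm volume p q hq
  half := lorentzNorm halfVolume p q hq
  indicator_eq g := by
    have h1 : ∀ l, distribution volume ((Ioi (0 : ℝ)).indicator g) l
        = distribution halfVolume g l := by
      intro l
      rw [distribution, distribution, Measure.restrict_apply' measurableSet_Ioi]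
      congr 1
      ext x
      by_cases hx : x ∈ Ioi (0 : ℝ)
      · simp only [mem_ofPred_eq, mem_inter_iff, indicator_of_mem hx, hx, and_true]
      · simp only [mem_ofPred_eq, mem_inter_iff, indicator_of_notMem hx, hx, and_false,
          not_lt_zero]
    change lorentzFun volume p q _ = lorentzFun halfVolume p q g
    simp only [lorentzFun, rearrangementAverage, rearrangement, h1]

/-! ### The three classes of spaces -/

/-- The spaces under consideration: Lorentz spaces `L^{p,q}` with `1 < p, q < ∞`, reflexive Orlicz
spaces, and variable Lebesgue spaces with exponent in `𝓑_M(ℝ)`. -/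
inductive IsAdmissible : SpacePair → Prop
  | lorentz (p q : ℝ) (hp : 1 < p) (hq : 1 < q) : IsAdmissible (lorentz p q hq)
  | orlicz (φ : ℝ → ℝ≥0∞) (hφ : IsYoungDensity φ) (hrefl : IsReflexive (orlicz hφ).half.space) :
      IsAdmissible (orlicz hφ)
  | variableLebesgue (p : ℝ → ℝ) (hp : IsMaximalExponent p) :
      IsAdmissible (variableLebesgue hp.toIsVariableExponent)

/-! ### Fourier convolution operators and Wiener-Hopf operators -/

/-- The Fourier transform `(F f)(ξ) = ∫ f(x) exp(i ξ x) dx` on `L²(ℝ)`. The transform of the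
library has the kernel `exp(-2 π i ξ x)`, so that `(F f)(ξ)` is its value at `-ξ / (2 π)`. -/
def fourierL2 (u : Lp ℂ 2 (volume : Measure ℝ)) : ℝ → ℂ :=
  fun ξ => (𝓕 u : Lp ℂ 2 (volume : Measure ℝ)) (-ξ / (2 * Real.pi))

/-- `v = F⁻¹(a · F u)` for `u, v ∈ L²(ℝ)`. -/
def IsConvolutionL2 (a : ℝ → ℂ) (u v : Lp ℂ 2 (volume : Measure ℝ)) : Prop :=
  fourierL2 v =ᵐ[volume] fun ξ => a ξ * fourierL2 u ξ

/-- `T` is a bounded operator on `X(ℝ)` with `T f = F⁻¹(a · F f)` for all `f ∈ L²(ℝ) ∩ X(ℝ)`. -/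
def ExtendsConvolution (X : SpacePair) (a : ℝ → ℂ) (T : X.line.space →L[ℂ] X.line.space) : Prop :=
  ∀ (f : X.line.space) (u : Lp ℂ 2 (volume : Measure ℝ)),
    (f : ℝ →ₘ[volume] ℂ) = (u : ℝ →ₘ[volume] ℂ) →
    ∃ v : Lp ℂ 2 (volume : Measure ℝ), IsConvolutionL2 a u v ∧
      (T f : ℝ →ₘ[volume] ℂ) = (v : ℝ →ₘ[volume] ℂ)

/-- `a` is a Fourier multiplier on `X(ℝ)`. -/
def IsFourierMultiplier (X : SpacePair) (a : ℝ → ℂ) : Prop :=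
  MemLp a ∞ (volume : Measure ℝ) ∧ ∃ T, ExtendsConvolution X a T

open Classical in
/-- The Fourier convolution operator `W⁰(a)` on `X(ℝ)`: the bounded extension of
`f ↦ F⁻¹(a · F f)` from `L²(ℝ) ∩ X(ℝ)`, which is unique when `L²(ℝ) ∩ X(ℝ)` is dense in `X(ℝ)`
(and `0` if `a` is not a Fourier multiplier on `X(ℝ)`). -/
def fourierConvolution (X : SpacePair) (a : ℝ → ℂ) : X.line.space →L[ℂ] X.line.space :=
  if h : IsFourierMultiplier X a then h.2.choose else 0

/-- The Wiener-Hopf operator `W(a) = r₊ W⁰(a) ℓ₊` on `X(ℝ₊)`. -/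
def wienerHopf (X : SpacePair) (a : ℝ → ℂ) : X.half.space →L[ℂ] X.half.space :=
  X.restrict ∘L fourierConvolution X a ∘L X.extend

/-- The Fredholm index `dim Ker T - dim E / Im T`. -/
def fredholmIndex {E : Type*} [NormedAddCommGroup E] [NormedSpace ℂ E] (T : E →L[ℂ] E) : ℤ :=
  (Module.finrank ℂ T.ker : ℤ) - (Module.finrank ℂ (E ⧸ T.range) : ℤ)

/-- The symbol `r_n(ξ) = ((ξ - i) / (ξ + i)) ^ n`. -/
def rSymbol (n : ℤ) (ξ : ℝ) : ℂ := (((ξ : ℂ) - Complex.I) / ((ξ : ℂ) + Complex.I)) ^ n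

end WienerHopf

end

open MeasureTheory Set Filter Topology
open scoped ENNReal NNReal FourierTransform

noncomputable section

namespace WienerHopf

/-! The symbols are rational, so the convolution operators can be written down. Averaging against
the exponential distribution, f ↦ ∫ f(x - σy) e^{-y} dy over y > 0, has symbol 1/(1 - iσξ). Since r₁
= 1 - 2/(1 - iξ) and r₋₁ = 1 - 2/(1 + iξ), the identity minus twice this average realizes r₁ for σ =
1 and r₋₁ for σ = -1. Hence boundedness of exponential averaging on X(ℝ) makes every r_n a
multiplier, powers of these two operators giving the rest (`extendsConvolution_pow`). The symbol of
the average is computed on Schwartz functions, where it solves u + σu' = f (`expConv_schwartz`), and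
passes to L² by density (`fourier_expConvL2`).

Let A and B be the compressions to the half-line for r₁ and r₋₁. Averaging over the past preserves
support in (0, ∞), and averaging over the future, restricted to (0, ∞), sees only the values there.
Therefore compression commutes with powers on each side (`compression_pow_one`,
`compression_pow_neg_one`) and BA = 1 (`compression_leftInverse`). An explicit computation gives (1
- AB)f = 2(∫ f(y) e^{-y} dy) e^{-x} (`sub_compression_compression`), so Ker B is spanned by e^{-x}.
From BA = 1 it follows that dim Ker Bⁿ = n, that Aⁿ is injective with Im Aⁿ complementary to Ker Bⁿ,
and that Bⁿ is onto; the indices are -n and n.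

The definition of W⁰(a) chooses an arbitrary bounded extension from L² ∩ X. For its compression to
be the explicit operator it suffices that square-integrable functions are dense in X(ℝ₊)
(`comp_extend_eq`, `wienerHopf_eq`). Three facts about X thus remain, collected in
`wienerHopf_rSymbol`: boundedness of both averages, this density, and membership of the indicator of
(0, 1), which makes Ker B nonzero.

Boundedness: Jensen's inequality for Orlicz spaces; domination by the maximal function for variable
exponents; for Lorentz spaces the formula t·g**(t) = min over l of ∫ (g - l)⁺ + tl, whose right side
does not increase under averaging. Density: dominated convergence of truncations for Lorentz and
variable Lebesgue spaces. In a reflexive space the bounded sequence of truncations has a weak limit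
along an ultrafilter, which integration against e^{-y} dy identifies as the function itself;
Hahn–Banach then turns weak approximation into norm approximation. -/

/-! ### Averages of translates against the exponential distribution -/

/-- The exponential distribution `e^{-y} dy` on `(0, ∞)`. -/
def expLaw : Measure ℝ :=
  (volume.restrict (Ioi 0)).withDensity fun y => ENNReal.ofReal (Real.exp (-y))

theorem measurable_expDensity : Measurable fun y : ℝ => ENNReal.ofReal (Real.exp (-y)) := by
  fun_prop

theorem lintegral_expLaw (g : ℝ → ℝ≥0∞) :
    ∫⁻ y, g y ∂expLaw = ∫⁻ y in Ioi (0 : ℝ), ENNReal.ofReal (Real.exp (-y)) * g y := by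
  rw [expLaw, lintegral_withDensity_eq_lintegral_mul_non_measurable _ measurable_expDensity
    (Eventually.of_forall fun y => ENNReal.ofReal_lt_top)]
  rfl

theorem integral_expLaw (g : ℝ → ℂ) :
    ∫ y, g y ∂expLaw = ∫ y in Ioi (0 : ℝ), (Real.exp (-y) : ℂ) * g y := by
  rw [expLaw, integral_withDensity_eq_integral_toReal_smul measurable_expDensity
    (Eventually.of_forall fun y => ENNReal.ofReal_lt_top)]
  refine integral_congr_ae (Eventually.of_forall fun y => ?_)
  simp [ENNReal.toReal_ofReal (Real.exp_pos _).le]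

theorem lintegral_Ioi_exp_neg (a : ℝ) :
    ∫⁻ y in Ioi a, ENNReal.ofReal (Real.exp (-y)) = ENNReal.ofReal (Real.exp (-a)) := by
  rw [← ofReal_integral_eq_lintegral_ofReal (integrableOn_exp_neg_Ioi a)
    (Eventually.of_forall fun y => (Real.exp_pos _).le), integral_exp_neg_Ioi]

instance : IsProbabilityMeasure expLaw where
  measure_univ := by
    rw [← setLIntegral_one, setLIntegral_univ, lintegral_expLaw]
    simp only [mul_one]
    rw [lintegral_Ioi_exp_neg]
    simp

theorem expLaw_absolutelyContinuous : expLaw ≪ volume.restrict (Ioi (0 : ℝ)) :=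
  withDensity_absolutelyContinuous _ _

/-- The average `x ↦ ∫ g(x - σ y) e^{-y} dy` of a nonnegative function. -/
def expAvg (σ : ℝ) (g : ℝ → ℝ≥0∞) (x : ℝ) : ℝ≥0∞ := ∫⁻ y, g (x - σ * y) ∂expLaw

/-- The average `x ↦ ∫ f(x - σ y) e^{-y} dy` of a complex-valued function. -/
def expConv (σ : ℝ) (f : ℝ → ℂ) (x : ℝ) : ℂ := ∫ y, f (x - σ * y) ∂expLaw

theorem measurable_shear (σ : ℝ) : Measurable fun z : ℝ × ℝ => z.1 - σ * z.2 := by fun_prop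

theorem measurable_expAvg (σ : ℝ) {g : ℝ → ℝ≥0∞} (hg : Measurable g) :
    Measurable (expAvg σ g) :=
  Measurable.lintegral_prod_right' (f := fun z : ℝ × ℝ => g (z.1 - σ * z.2))
    (hg.comp (measurable_shear σ))

theorem stronglyMeasurable_expConv (σ : ℝ) {f : ℝ → ℂ} (hf : StronglyMeasurable f) :
    StronglyMeasurable (expConv σ f) :=
  StronglyMeasurable.integral_prod_right (f := fun x y => f (x - σ * y))
    (hf.comp_measurable (measurable_shear σ))

/-- Translation invariance makes each slice of the exceptional set null, and Fubini exchanges the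
quantifiers. The measurable hull stands in for the exceptional set, which need not be measurable.
This makes the averages well defined on classes of functions. -/
theorem ae_ae_sub {p : ℝ → Prop} (h : ∀ᵐ x, p x) (σ : ℝ) :
    ∀ᵐ x : ℝ, ∀ᵐ y ∂expLaw, p (x - σ * y) := by
  set N := toMeasurable volume {x | ¬ p x}
  have hN : volume N = 0 := by rw [measure_toMeasurable]; exact h
  have hNm : MeasurableSet N := measurableSet_toMeasurable _ _
  have h1 : ∀ᵐ x : ℝ, ∀ᵐ y ∂expLaw, x - σ * y ∉ N := by
    rw [Measure.ae_ae_comm (p := fun x y : ℝ => x - σ * y ∉ N) (measurable_shear σ hNm.compl)]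
    refine Eventually.of_forall fun y => ?_
    have := (measurePreserving_sub_right volume (σ * y)).quasiMeasurePreserving.ae
      (measure_eq_zero_iff_ae_notMem.1 hN)
    exact this
  filter_upwards [h1] with x hx
  filter_upwards [hx] with y hy
  by_contra hp
  exact hy (subset_toMeasurable _ _ hp)

theorem expAvg_congr (σ : ℝ) {g h : ℝ → ℝ≥0∞} (hgh : g =ᵐ[volume] h) :
    expAvg σ g =ᵐ[volume] expAvg σ h := by
  filter_upwards [ae_ae_sub hgh σ] with x hx
  exact lintegral_congr_ae hx

theorem expConv_congr (σ : ℝ) {f g : ℝ → ℂ} (hfg : f =ᵐ[volume] g) :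
    expConv σ f =ᵐ[volume] expConv σ g := by
  filter_upwards [ae_ae_sub hfg σ] with x hx
  exact integral_congr_ae hx

theorem enorm_expConv_le (σ : ℝ) (f : ℝ → ℂ) (x : ℝ) :
    ‖expConv σ f x‖ₑ ≤ expAvg σ (fun x => ‖f x‖ₑ) x :=
  enorm_integral_le_lintegral_enorm _

/-- Tonelli, translation invariance and total mass one. -/
theorem lintegral_expAvg (σ : ℝ) {g : ℝ → ℝ≥0∞} (hg : Measurable g) :
    ∫⁻ x, expAvg σ g x = ∫⁻ x, g x := by
  simp only [expAvg]
  rw [lintegral_lintegral_swap (f := fun x y => g (x - σ * y))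
    (hg.comp (measurable_shear σ)).aemeasurable]
  have : ∀ y : ℝ, ∫⁻ x, g (x - σ * y) = ∫⁻ x, g x := fun y =>
    lintegral_sub_right_eq_self (μ := volume) g (σ * y)
  simp [this]

/-! ### Exponential averaging as an operator -/

/-- Exponential averaging of a class of functions. -/
def expConvFun (σ : ℝ) (f : ℝ →ₘ[volume] ℂ) : ℝ →ₘ[volume] ℂ :=
  AEEqFun.mk (expConv σ f) (stronglyMeasurable_expConv σ f.stronglyMeasurable).aestronglyMeasurable

theorem coeFn_expConvFun (σ : ℝ) (f : ℝ →ₘ[volume] ℂ) :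
    expConvFun σ f =ᵐ[volume] expConv σ f :=
  AEEqFun.coeFn_mk _ _

theorem integrable_translate {σ : ℝ} (f : ℝ →ₘ[volume] ℂ)
    (hf : ∀ᵐ x, expAvg σ (fun x => ‖f x‖ₑ) x < ∞) :
    ∀ᵐ x, Integrable (fun y => f (x - σ * y)) expLaw := by
  filter_upwards [hf] with x hx
  exact ⟨(f.stronglyMeasurable.comp_measurable (by fun_prop)).aestronglyMeasurable, hx⟩

theorem expConvFun_add {σ : ℝ} {f g : ℝ →ₘ[volume] ℂ}
    (hf : ∀ᵐ x, expAvg σ (fun x => ‖f x‖ₑ) x < ∞) (hg : ∀ᵐ x, expAvg σ (fun x => ‖g x‖ₑ) x < ∞) :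
    expConvFun σ (f + g) = expConvFun σ f + expConvFun σ g := by
  refine AEEqFun.ext ?_
  filter_upwards [coeFn_expConvFun σ (f + g), coeFn_expConvFun σ f, coeFn_expConvFun σ g,
    AEEqFun.coeFn_add (expConvFun σ f) (expConvFun σ g), integrable_translate f hf,
    integrable_translate g hg, expConv_congr σ (AEEqFun.coeFn_add f g)] with x h1 h2 h3 h4 h5 h6 h7
  rw [h1, h4, Pi.add_apply, h2, h3, h7]
  exact integral_add h5 h6

theorem expConvFun_smul (σ : ℝ) (c : ℂ) (f : ℝ →ₘ[volume] ℂ) :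
    expConvFun σ (c • f) = c • expConvFun σ f := by
  refine AEEqFun.ext ?_
  filter_upwards [coeFn_expConvFun σ (c • f), coeFn_expConvFun σ f,
    AEEqFun.coeFn_smul c (expConvFun σ f), expConv_congr σ (AEEqFun.coeFn_smul c f)]
    with x h1 h2 h3 h4
  rw [h1, h3, Pi.smul_apply, h2, h4]
  exact integral_smul c _

namespace FunctionNorm

/-- The function equal to ∞ on {g = ∞} and 0 elsewhere is its own half, so by homogeneity its norm
is at most half of itself. Being finite, this norm vanishes. -/
theorem ae_lt_top {μ : Measure ℝ} (ρ : FunctionNorm μ) {g : ℝ → ℝ≥0∞} (hg : AEMeasurable g μ)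
    (hfin : ρ.toFun g < ∞) : ∀ᵐ x ∂μ, g x < ∞ := by
  set h : ℝ → ℝ≥0∞ := fun x => {t : ℝ≥0∞ | t = ∞}.indicator (fun _ => ∞) (g x) with hh
  have hm : AEMeasurable h μ :=
    (measurable_const.indicator (measurableSet_singleton ∞)).comp_aemeasurable hg
  have hle : ρ.toFun h ≤ ρ.toFun g := ρ.mono (Eventually.of_forall fun x => by
    by_cases hx : g x = ∞ <;> simp [hh, hx])
  have hhalf : ρ.toFun h ≤ ((1 / 2 : ℝ≥0) : ℝ≥0∞) * ρ.toFun h := by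
    refine le_trans (ρ.mono (Eventually.of_forall fun x => ?_)) (ρ.smul_le (1 / 2) (by simp) h)
    by_cases hx : g x = ∞ <;> simp [hh, hx]
  have h0 : ρ.toFun h = 0 := by
    by_contra hne
    lift ρ.toFun h to ℝ≥0 using (hle.trans_lt hfin).ne with r hr
    have h1 : r ≤ (1 / 2 : ℝ≥0) * r := by exact_mod_cast hhalf
    have h2 : (0 : ℝ≥0) < r := pos_iff_ne_zero.2 (by exact_mod_cast hne)
    have h3 : (r : ℝ) ≤ (1 / 2) * r := by exact_mod_cast h1
    have h4 : (0 : ℝ) < r := by exact_mod_cast h2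
    linarith
  filter_upwards [ρ.eq_zero hm h0] with x hx
  by_contra hcon
  simp [hh, not_lt_top_iff.1 hcon] at hx

/-- Exponential averaging is bounded in the function norm. -/
def AveragingBounded (ρ : FunctionNorm volume) (σ : ℝ) : Prop :=
  ∃ C : ℝ≥0, ∀ f : ℝ →ₘ[volume] ℂ, ρ.toFun (expAvg σ fun x => ‖f x‖ₑ) ≤ C * ρ.eval f

variable {ρ : FunctionNorm volume} {σ : ℝ}

theorem AveragingBounded.ae_lt_top (h : ρ.AveragingBounded σ) {f : ℝ →ₘ[volume] ℂ}
    (hf : f ∈ ρ.space) : ∀ᵐ x, expAvg σ (fun x => ‖f x‖ₑ) x < ∞ := by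
  obtain ⟨C, hC⟩ := h
  exact ρ.ae_lt_top (measurable_expAvg σ f.stronglyMeasurable.enorm).aemeasurable
    ((hC f).trans_lt (ENNReal.mul_lt_top ENNReal.coe_lt_top hf))

theorem AveragingBounded.eval_expConvFun_le {C : ℝ≥0}
    (hC : ∀ f : ℝ →ₘ[volume] ℂ, ρ.toFun (expAvg σ fun x => ‖f x‖ₑ) ≤ C * ρ.eval f)
    (f : ℝ →ₘ[volume] ℂ) : ρ.eval (expConvFun σ f) ≤ C * ρ.eval f := by
  refine le_trans (ρ.mono ?_) (hC f)
  filter_upwards [coeFn_expConvFun σ f] with x hx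
  rw [hx]
  exact enorm_expConv_le σ f x

/-- Exponential averaging as a bounded operator on a function space. -/
def AveragingBounded.op (h : ρ.AveragingBounded σ) : ρ.space →L[ℂ] ρ.space :=
  LinearMap.mkContinuous
    { toFun := fun f => ⟨expConvFun σ f, lt_of_le_of_lt (eval_expConvFun_le h.choose_spec f)
        (ENNReal.mul_lt_top ENNReal.coe_lt_top f.2)⟩
      map_add' := fun f g => Subtype.ext (expConvFun_add (h.ae_lt_top f.2) (h.ae_lt_top g.2))
      map_smul' := fun c f => Subtype.ext (expConvFun_smul σ c f) }
    h.choose fun f => by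
      have := ENNReal.toReal_mono (ENNReal.mul_ne_top ENNReal.coe_ne_top f.2.ne)
        (eval_expConvFun_le h.choose_spec (f : ℝ →ₘ[volume] ℂ))
      rwa [ENNReal.toReal_mul, ENNReal.coe_toReal] at this

end FunctionNorm

/-! ### Exponential averaging on `L²` -/

/-- Hölder against the constant 1 on a probability space. -/
theorem sq_lintegral_expLaw_le {g : ℝ → ℝ≥0∞} (hg : Measurable g) :
    (∫⁻ y, g y ∂expLaw) ^ (2 : ℝ) ≤ ∫⁻ y, g y ^ (2 : ℝ) ∂expLaw := by
  have h := ENNReal.lintegral_mul_le_Lp_mul_Lq expLaw Real.HolderConjugate.two_two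
    hg.aemeasurable (aemeasurable_const (b := (1 : ℝ≥0∞)))
  simp only [Pi.mul_apply, mul_one, ENNReal.one_rpow, lintegral_one, measure_univ] at h
  calc (∫⁻ y, g y ∂expLaw) ^ (2 : ℝ)
      ≤ ((∫⁻ y, g y ^ (2 : ℝ) ∂expLaw) ^ (1 / (2 : ℝ))) ^ (2 : ℝ) := by gcongr
    _ = _ := by rw [← ENNReal.rpow_mul]; norm_num

theorem lintegral_sq_expAvg_le (σ : ℝ) {g : ℝ → ℝ≥0∞} (hg : Measurable g) :
    ∫⁻ x, expAvg σ g x ^ (2 : ℝ) ≤ ∫⁻ x, g x ^ (2 : ℝ) := by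
  rw [← lintegral_expAvg σ (g := fun x => g x ^ (2 : ℝ)) (hg.pow_const _)]
  exact lintegral_mono fun x => sq_lintegral_expLaw_le (by fun_prop)

theorem eLpNorm_expConvFun_le (σ : ℝ) (f : ℝ →ₘ[volume] ℂ) :
    eLpNorm (expConvFun σ f) 2 volume ≤ eLpNorm f 2 volume := by
  rw [eLpNorm_congr_ae (coeFn_expConvFun σ f),
    eLpNorm_eq_lintegral_rpow_enorm_toReal two_ne_zero ENNReal.ofNat_ne_top,
    eLpNorm_eq_lintegral_rpow_enorm_toReal two_ne_zero ENNReal.ofNat_ne_top]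
  simp only [ENNReal.toReal_ofNat]
  gcongr ?_ ^ _
  refine le_trans (lintegral_mono fun x => ?_)
    (lintegral_sq_expAvg_le σ f.stronglyMeasurable.enorm)
  exact ENNReal.rpow_le_rpow (enorm_expConv_le σ f x) (by norm_num)

theorem expAvg_lt_top_of_memLp (σ : ℝ) (f : Lp ℂ 2 (volume : Measure ℝ)) :
    ∀ᵐ x, expAvg σ (fun x => ‖f x‖ₑ) x < ∞ := by
  have hm := measurable_expAvg σ (Lp.stronglyMeasurable f).enorm
  have hfin : ∫⁻ x, ‖f x‖ₑ ^ (2 : ℝ) ≠ ∞ := by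
    have := (lintegral_rpow_enorm_lt_top_of_eLpNorm_lt_top two_ne_zero ENNReal.ofNat_ne_top
      (Lp.memLp f).2).ne
    simpa using this
  have := ae_lt_top (hm.pow_const 2)
    (ne_top_of_le_ne_top hfin (lintegral_sq_expAvg_le σ (Lp.stronglyMeasurable f).enorm))
  filter_upwards [this] with x hx
  by_contra hcon
  simp [not_lt_top_iff.1 hcon] at hx

/-- Exponential averaging on `L²(ℝ)`. -/
def expConvL2 (σ : ℝ) : Lp ℂ 2 (volume : Measure ℝ) →L[ℂ] Lp ℂ 2 (volume : Measure ℝ) :=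
  LinearMap.mkContinuous
    { toFun := fun f => ⟨expConvFun σ f, Lp.mem_Lp_iff_eLpNorm_lt_top.2
        ((eLpNorm_expConvFun_le σ f).trans_lt (Lp.memLp f).2)⟩
      map_add' := fun f g => Subtype.ext
        (expConvFun_add (expAvg_lt_top_of_memLp σ f) (expAvg_lt_top_of_memLp σ g))
      map_smul' := fun c f => Subtype.ext (expConvFun_smul σ c f) }
    1 fun f => by
      rw [one_mul, Lp.norm_def, Lp.norm_def]
      exact ENNReal.toReal_mono (Lp.memLp f).2.ne (eLpNorm_expConvFun_le σ f)

/-! ### The symbol of exponential averaging -/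

/-- The Fourier multiplier of exponential averaging, in the normalization of the library. -/
def expSymbol (σ : ℝ) (η : ℝ) : ℂ := (1 + 2 * Real.pi * Complex.I * σ * η)⁻¹

theorem one_add_I_mul_ne_zero (t : ℝ) : (1 : ℂ) + t * Complex.I ≠ 0 := by
  intro h
  have := congrArg Complex.re h
  simp at this

theorem expSymbol_eq (σ η : ℝ) :
    expSymbol σ η = (1 + ((2 * Real.pi * σ * η : ℝ) : ℂ) * Complex.I)⁻¹ := by
  rw [expSymbol]
  push_cast
  ring_nf

theorem expSymbol_denom_ne_zero (σ η : ℝ) : (1 + 2 * Real.pi * Complex.I * σ * η : ℂ) ≠ 0 := by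
  have := one_add_I_mul_ne_zero (2 * Real.pi * σ * η)
  intro h
  apply this
  rw [← h]
  push_cast
  ring

theorem continuous_expSymbol (σ : ℝ) : Continuous (expSymbol σ) :=
  Continuous.inv₀ (by fun_prop) (expSymbol_denom_ne_zero σ)

theorem norm_expSymbol_le (σ η : ℝ) : ‖expSymbol σ η‖ ≤ 1 := by
  rw [expSymbol_eq, norm_inv]
  refine inv_le_one_of_one_le₀ ?_
  have := Complex.abs_re_le_norm (1 + ((2 * Real.pi * σ * η : ℝ) : ℂ) * Complex.I)
  simpa using this

theorem memLp_expSymbol (σ : ℝ) : MemLp (expSymbol σ) ∞ (volume : Measure ℝ) :=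
  memLp_top_of_bound (continuous_expSymbol σ).aestronglyMeasurable 1
    (Eventually.of_forall (norm_expSymbol_le σ))

/-- Rationalizing, 1/(1 + it) = (1 - it)/(1 + t²), reduces the claim to a known power of 1 + t²
times a polynomial. -/
theorem hasTemperateGrowth_expSymbol (σ : ℝ) : (expSymbol σ).HasTemperateGrowth := by
  have h1 : (fun η : ℝ => (1 + ‖2 * Real.pi * σ * η‖ ^ 2) ^ (-1 : ℝ)).HasTemperateGrowth :=
    (Function.hasTemperateGrowth_one_add_norm_sq_rpow ℝ (-1)).comp
      (f := fun η : ℝ => 2 * Real.pi * σ * η) (by fun_prop)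
  have h2 : (fun η : ℝ => (((1 + ‖2 * Real.pi * σ * η‖ ^ 2) ^ (-1 : ℝ) : ℝ) : ℂ)
      * (1 - 2 * Real.pi * Complex.I * σ * (η : ℂ))).HasTemperateGrowth :=
    (Function.Complex.hasTemperateGrowth_ofReal.comp h1).mul (by fun_prop)
  convert h2 using 1
  ext η
  rw [Real.rpow_neg_one, expSymbol, inv_eq_iff_eq_inv, mul_inv, Complex.ofReal_inv, inv_inv]
  have h3 : (1 - 2 * Real.pi * Complex.I * σ * η : ℂ) ≠ 0 := by
    have := expSymbol_denom_ne_zero (-σ) η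
    intro h
    apply this
    rw [← h]
    push_cast
    ring
  rw [← div_eq_mul_inv, eq_div_iff h3, Real.norm_eq_abs, sq_abs]
  push_cast
  ring_nf
  rw [Complex.I_sq]
  ring

open SchwartzMap in
/-- The resolvent `(1 + σ d/dx)⁻¹` on Schwartz functions. -/
def schwartzResolvent (σ : ℝ) (f : 𝓢(ℝ, ℂ)) : 𝓢(ℝ, ℂ) :=
  𝓕⁻ (SchwartzMap.smulLeftCLM ℂ (expSymbol σ) (𝓕 f))

open SchwartzMap in
theorem fourier_schwartzResolvent (σ : ℝ) (f : 𝓢(ℝ, ℂ)) (η : ℝ) :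
    𝓕 (schwartzResolvent σ f) η = expSymbol σ η * 𝓕 f η := by
  rw [schwartzResolvent, FourierTransform.fourier_fourierInv_eq,
    SchwartzMap.smulLeftCLM_apply_apply (hasTemperateGrowth_expSymbol σ), smul_eq_mul]

open SchwartzMap in
-- On the Fourier side 1 + σ d/dx is multiplication by 1 + 2πiση, the inverse of the symbol.
theorem schwartzResolvent_add_deriv (σ : ℝ) (f : 𝓢(ℝ, ℂ)) (x : ℝ) :
    schwartzResolvent σ f x + σ * deriv (schwartzResolvent σ f) x = f x := by
  set u := schwartzResolvent σ f with hu
  have key : u + (σ : ℂ) • SchwartzMap.derivCLM ℂ ℂ u = f := by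
    have h : 𝓕 (u + (σ : ℂ) • SchwartzMap.derivCLM ℂ ℂ u) = 𝓕 f := by
      rw [FourierTransform.fourier_add, FourierTransform.fourier_smul]
      ext η
      have h1 : 𝓕 (SchwartzMap.derivCLM ℂ ℂ u) η = (2 * Real.pi * Complex.I * η) * 𝓕 u η := by
        have h2 := Real.fourier_deriv u.integrable u.differentiable
          (SchwartzMap.derivCLM ℂ ℂ u).integrable
        have h3 := congrFun h2 η
        exact h3
      rw [_root_.add_apply, _root_.smul_apply, h1, hu, fourier_schwartzResolvent,
        smul_eq_mul]
      have := expSymbol_denom_ne_zero σ η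
      rw [expSymbol]
      field_simp
    rw [← FourierTransform.fourierInv_fourier_eq (F := 𝓢(ℝ, ℂ)) f, ← h,
      FourierTransform.fourierInv_fourier_eq]
  have := congrArg (fun g : 𝓢(ℝ, ℂ) => g x) key
  simpa using this

open SchwartzMap in
-- By the differential equation u + σu' = f, the integrand e^{-y} f(x - σy) is the derivative in y
-- of -e^{-y} u(x - σy). This primitive vanishes at infinity and equals -u(x) at y = 0.
theorem expConv_schwartz (σ : ℝ) (f : 𝓢(ℝ, ℂ)) : expConv σ f = schwartzResolvent σ f := by
  ext x
  set u := schwartzResolvent σ f with hu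
  obtain ⟨Cf, hCf⟩ : ∃ C, ∀ z, ‖f z‖ ≤ C :=
    ⟨_, f.toBoundedContinuousFunction.norm_coe_le_norm⟩
  obtain ⟨Cu, hCu⟩ : ∃ C, ∀ z, ‖u z‖ ≤ C :=
    ⟨_, u.toBoundedContinuousFunction.norm_coe_le_norm⟩
  rw [expConv, integral_expLaw]
  have hderiv : ∀ y ∈ Ici (0 : ℝ), HasDerivAt
      (fun y : ℝ => -((Real.exp (-y) : ℝ) : ℂ) * u (x - σ * y))
      ((Real.exp (-y) : ℂ) * f (x - σ * y)) y := by
    intro y _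
    have h1 : HasDerivAt (fun y : ℝ => ((Real.exp (-y) : ℝ) : ℂ)) (((-Real.exp (-y) : ℝ) : ℂ)) y :=
      HasDerivAt.ofReal_comp (by simpa using (hasDerivAt_neg y).exp)
    have h2 : HasDerivAt (fun y : ℝ => x - σ * y) (-σ) y := by
      simpa using ((hasDerivAt_id y).const_mul σ).const_sub x
    have h3 : HasDerivAt (fun y : ℝ => u (x - σ * y)) ((-σ : ℝ) • deriv u (x - σ * y)) y :=
      HasDerivAt.scomp y (u.differentiable _).hasDerivAt h2
    refine (h1.neg.mul h3).congr_deriv ?_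
    rw [← schwartzResolvent_add_deriv σ f (x - σ * y), ← hu]
    simp only [Pi.neg_apply, Complex.real_smul]
    push_cast
    ring
  have hint : IntegrableOn (fun y : ℝ => (Real.exp (-y) : ℂ) * f (x - σ * y)) (Ioi 0) := by
    refine Integrable.mul_bdd (c := Cf) ?_ ?_ ?_
    · exact (integrableOn_exp_neg_Ioi 0).ofReal
    · exact (f.continuous.comp (by fun_prop)).aestronglyMeasurable
    · exact Eventually.of_forall fun y => hCf _
  have hlim : Tendsto (fun y : ℝ => -((Real.exp (-y) : ℝ) : ℂ) * u (x - σ * y)) atTop (𝓝 0) := by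
    rw [tendsto_zero_iff_norm_tendsto_zero]
    have h1 : Tendsto (fun y : ℝ => Real.exp (-y) * Cu) atTop (𝓝 0) := by
      simpa using (Real.tendsto_exp_neg_atTop_nhds_zero).mul_const Cu
    refine squeeze_zero (fun y => norm_nonneg _) (fun y => ?_) h1
    rw [norm_mul, norm_neg, Complex.norm_real, Real.norm_eq_abs, abs_of_pos (Real.exp_pos _)]
    gcongr
    exact hCu _
  rw [integral_Ioi_of_hasDerivAt_of_tendsto' hderiv hint hlim]
  simp

/-- Multiplication by the symbol on `L²(ℝ)`. -/
def expSymbolMul (σ : ℝ) : Lp ℂ 2 (volume : Measure ℝ) →L[ℂ] Lp ℂ 2 (volume : Measure ℝ) :=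
  (ContinuousLinearMap.mul ℂ ℂ).holderL volume ∞ 2 2 ((memLp_expSymbol σ).toLp _)

theorem coeFn_expSymbolMul (σ : ℝ) (u : Lp ℂ 2 (volume : Measure ℝ)) :
    expSymbolMul σ u =ᵐ[volume] fun η => expSymbol σ η * u η := by
  have h1 : expSymbolMul σ u =ᵐ[volume] _ :=
    ContinuousLinearMap.coeFn_holder (r := 2) (B := ContinuousLinearMap.mul ℂ ℂ)
      ((memLp_expSymbol σ).toLp _) u
  filter_upwards [h1, (memLp_expSymbol σ).coeFn_toLp] with η h1 h2
  rw [h1, h2]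
  rfl

/-- Both sides are continuous on L², and on the dense Schwartz functions averaging is the resolvent,
which is defined through its symbol. -/
theorem fourier_expConvL2 (σ : ℝ) (u : Lp ℂ 2 (volume : Measure ℝ)) :
    𝓕 (expConvL2 σ u) = expSymbolMul σ (𝓕 u) := by
  refine (SchwartzMap.denseRange_toLpCLM (E := ℝ) (F := ℂ) (p := 2)
    ENNReal.ofNat_ne_top).induction_on (p := fun u => 𝓕 (expConvL2 σ u) = expSymbolMul σ (𝓕 u))
    u ?_ ?_
  · have hF : Continuous fun u : Lp ℂ 2 (volume : Measure ℝ) => 𝓕 u :=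
      (Lp.fourierTransformₗᵢ ℝ ℂ).continuous
    exact isClosed_eq (hF.comp (expConvL2 σ).continuous) ((expSymbolMul σ).continuous.comp hF)
  · intro f
    simp only [SchwartzMap.toLpCLM_apply]
    have h1 : expConvL2 σ (f.toLp 2) = (schwartzResolvent σ f).toLp 2 := by
      refine Lp.ext ?_
      have h2 : expConvL2 σ (f.toLp 2) =ᵐ[volume] expConv σ (f.toLp 2 : ℝ → ℂ) :=
        coeFn_expConvFun σ _
      refine h2.trans ((expConv_congr σ (f.coeFn_toLp 2)).trans ?_)
      rw [expConv_schwartz]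
      exact ((schwartzResolvent σ f).coeFn_toLp 2).symm
    rw [h1, SchwartzMap.toLp_fourier_eq, SchwartzMap.toLp_fourier_eq]
    refine Lp.ext ?_
    filter_upwards [(𝓕 (schwartzResolvent σ f)).coeFn_toLp 2, coeFn_expSymbolMul σ ((𝓕 f).toLp 2),
      (𝓕 f).coeFn_toLp 2] with η h3 h4 h5
    rw [h3, h4, h5, fourier_schwartzResolvent]

/-- Transports almost everywhere identities from the library's transform to F, which is evaluated at
-ξ/(2π). -/
theorem quasiMeasurePreserving_fourierScale :
    Measure.QuasiMeasurePreserving (fun ξ : ℝ => -ξ / (2 * Real.pi)) volume volume := by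
  have h0 : (-(2 * Real.pi)⁻¹ : ℝ) ≠ 0 := by
    have := Real.pi_pos
    exact neg_ne_zero.2 (by positivity)
  have he : (fun ξ : ℝ => -ξ / (2 * Real.pi)) = fun ξ => (-(2 * Real.pi)⁻¹) * ξ := by
    ext ξ
    ring
  rw [he]
  refine ⟨by fun_prop, ?_⟩
  rw [Real.map_volume_mul_left h0]
  exact Measure.smul_absolutelyContinuous

theorem isConvolutionL2_expConvL2 (σ : ℝ) (u : Lp ℂ 2 (volume : Measure ℝ)) :
    IsConvolutionL2 (fun ξ => expSymbol σ (-ξ / (2 * Real.pi))) u (expConvL2 σ u) := by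
  have h := coeFn_expSymbolMul σ (𝓕 u)
  rw [← fourier_expConvL2] at h
  exact quasiMeasurePreserving_fourierScale.ae h

theorem fourierL2_add (u v : Lp ℂ 2 (volume : Measure ℝ)) :
    fourierL2 (u + v) =ᵐ[volume] fourierL2 u + fourierL2 v := by
  have h := Lp.coeFn_add (𝓕 u) (𝓕 v)
  rw [← FourierTransform.fourier_add] at h
  exact quasiMeasurePreserving_fourierScale.ae h

theorem fourierL2_smul (c : ℂ) (u : Lp ℂ 2 (volume : Measure ℝ)) :
    fourierL2 (c • u) =ᵐ[volume] c • fourierL2 u := by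
  have h := Lp.coeFn_smul c (𝓕 u)
  rw [← FourierTransform.fourier_smul] at h
  exact quasiMeasurePreserving_fourierScale.ae h

/-- The symbol `1 - 2 / (1 - i σ ξ)` of the identity minus twice exponential averaging. -/
theorem isConvolutionL2_sub (σ : ℝ) (u : Lp ℂ 2 (volume : Measure ℝ)) :
    IsConvolutionL2 (fun ξ => 1 - 2 * expSymbol σ (-ξ / (2 * Real.pi))) u
      (u + (-2 : ℂ) • expConvL2 σ u) := by
  filter_upwards [fourierL2_add u ((-2 : ℂ) • expConvL2 σ u), fourierL2_smul (-2) (expConvL2 σ u),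
    isConvolutionL2_expConvL2 σ u] with ξ h1 h2 h3
  rw [h1, Pi.add_apply, h2, Pi.smul_apply, h3, smul_eq_mul]
  ring

theorem expSymbol_scale (σ ξ : ℝ) :
    expSymbol σ (-ξ / (2 * Real.pi)) = (1 - Complex.I * σ * ξ)⁻¹ := by
  have hpi : (Real.pi : ℂ) ≠ 0 := by exact_mod_cast Real.pi_ne_zero
  rw [expSymbol]
  congr 1
  push_cast
  field_simp
  ring

/-! ### The symbols r_n. -/

theorem ofReal_add_I_ne_zero (ξ : ℝ) : (ξ : ℂ) + Complex.I ≠ 0 := by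
  intro h
  have := congrArg Complex.im h
  simp at this

theorem ofReal_sub_I_ne_zero (ξ : ℝ) : (ξ : ℂ) - Complex.I ≠ 0 := by
  intro h
  have := congrArg Complex.im h
  simp at this

theorem rSymbol_one_eq :
    rSymbol 1 = fun ξ => 1 - 2 * expSymbol 1 (-ξ / (2 * Real.pi)) := by
  ext ξ
  have h1 := ofReal_add_I_ne_zero ξ
  have h2 : (1 - Complex.I * (1 : ℝ) * ξ : ℂ) = -Complex.I * (ξ + Complex.I) := by
    push_cast
    linear_combination Complex.I_mul_I
  rw [expSymbol_scale, rSymbol, zpow_one, h2, mul_inv, inv_neg, Complex.inv_I]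
  field_simp
  ring

theorem rSymbol_neg_one_eq :
    rSymbol (-1) = fun ξ => 1 - 2 * expSymbol (-1) (-ξ / (2 * Real.pi)) := by
  ext ξ
  have h1 := ofReal_sub_I_ne_zero ξ
  have h3 := ofReal_add_I_ne_zero ξ
  have h2 : (1 - Complex.I * (-1 : ℝ) * ξ : ℂ) = Complex.I * (ξ - Complex.I) := by
    push_cast
    linear_combination Complex.I_mul_I
  rw [expSymbol_scale, rSymbol, zpow_neg_one, inv_div, h2, mul_inv, Complex.inv_I]
  field_simp
  ring

theorem rSymbol_add (m n : ℤ) (ξ : ℝ) : rSymbol (m + n) ξ = rSymbol m ξ * rSymbol n ξ :=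
  zpow_add₀ (div_ne_zero (ofReal_sub_I_ne_zero ξ) (ofReal_add_I_ne_zero ξ)) m n

theorem norm_rSymbol (n : ℤ) (ξ : ℝ) : ‖rSymbol n ξ‖ = 1 := by
  have h : ‖(ξ : ℂ) - Complex.I‖ = ‖(ξ : ℂ) + Complex.I‖ := by
    rw [← Complex.norm_conj ((ξ : ℂ) + Complex.I)]
    simp [sub_eq_add_neg]
  rw [rSymbol, norm_zpow, norm_div, h, div_self (norm_ne_zero_iff.2 (ofReal_add_I_ne_zero ξ)),
    one_zpow]

theorem memLp_rSymbol (n : ℤ) : MemLp (rSymbol n) ∞ (volume : Measure ℝ) := by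
  refine memLp_top_of_bound (Continuous.aestronglyMeasurable ?_) 1
    (Eventually.of_forall fun ξ => (norm_rSymbol n ξ).le)
  refine Continuous.zpow₀ ?_ n fun ξ =>
    Or.inl (div_ne_zero (ofReal_sub_I_ne_zero ξ) (ofReal_add_I_ne_zero ξ))
  exact Continuous.div (by fun_prop) (by fun_prop) ofReal_add_I_ne_zero

/-! ### Powers of a one-sided inverse -/

section OneSided

variable {E : Type*} [NormedAddCommGroup E] [NormedSpace ℂ E] {A B : E →L[ℂ] E}

theorem pow_apply_pow_apply (h : ∀ x, B (A x) = x) (n : ℕ) (x : E) : (B ^ n) ((A ^ n) x) = x := by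
  induction n generalizing x with
  | zero => simp
  | succ n ih =>
    rw [pow_succ B, pow_succ' A, mul_apply_eq_comp, mul_apply_eq_comp,
      h, ih]

/-- If `B A = 1` then `Ker Bⁿ⁺¹` is the direct sum of `A (Ker Bⁿ)` and `Ker B`. -/
def kerPowSuccEquiv (h : ∀ x, B (A x) = x) (n : ℕ) :
    (B ^ (n + 1)).ker ≃ₗ[ℂ] (B ^ n).ker × B.ker where
  toFun x := (⟨B x, by
      have h1 : (B ^ (n + 1)) (x : E) = 0 := x.2
      have h2 : (B ^ (n + 1)) (x : E) = (B ^ n) (B x) :=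
        congrArg (fun T : E →L[ℂ] E => T x) (pow_succ B n)
      exact h2.symm.trans h1⟩,
    ⟨x - A (B x), by simp [h]⟩)
  map_add' x y := by
    ext
    · simp
    · simp only [Submodule.coe_add, map_add, Prod.mk_add_mk, AddMemClass.mk_add_mk]
      abel
  map_smul' c x := by
    ext
    · simp
    · simp [smul_sub]
  invFun z := ⟨A z.1 + z.2, by
    have h1 : (B ^ n) (z.1 : E) = 0 := z.1.2
    have h2 : B (z.2 : E) = 0 := z.2.2
    rw [LinearMap.mem_ker, ContinuousLinearMap.coe_coe, pow_succ, mul_apply_eq_comp,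
      map_add, h, h2, add_zero, h1]⟩
  left_inv x := by simp
  right_inv z := by
    have h2 : B (z.2 : E) = 0 := z.2.2
    ext <;> simp [h, h2]

/-- Each further power of B adds one copy of Ker B to the kernel, by `kerPowSuccEquiv`. -/
theorem finrank_ker_pow (h : ∀ x, B (A x) = x) (h1 : Module.finrank ℂ B.ker = 1) (n : ℕ) :
    FiniteDimensional ℂ (B ^ n).ker ∧ Module.finrank ℂ (B ^ n).ker = n := by
  have hB : FiniteDimensional ℂ B.ker := Module.finite_of_finrank_pos (by omega)
  induction n with
  | zero =>
    have : ((B ^ 0).ker : Submodule ℂ E) = ⊥ := by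
      ext x
      simp
    rw [this]
    exact ⟨inferInstance, finrank_bot ℂ E⟩
  | succ n ih =>
    obtain ⟨hf, hr⟩ := ih
    refine ⟨(kerPowSuccEquiv h n).symm.finiteDimensional, ?_⟩
    rw [(kerPowSuccEquiv h n).finrank_eq, Module.finrank_prod, hr, h1]

/-- AB is idempotent, with range Im A and kernel Ker B. -/
theorem isCompl_range_ker (h : ∀ x, B (A x) = x) : IsCompl A.range B.ker := by
  constructor
  · rw [Submodule.disjoint_def]
    rintro _ ⟨x, rfl⟩ hx
    have : B (A x) = 0 := hx
    rw [h] at this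
    simp [this]
  · rw [codisjoint_iff, eq_top_iff]
    intro x _
    refine Submodule.mem_sup.2 ⟨A (B x), ⟨B x, rfl⟩, x - A (B x), ?_, by abel⟩
    simp [h]

open scoped LinearMap.FiniteRangeSetoid in
-- BA = 1 exactly, while 1 - AB maps into Ker B and so has finite rank.
theorem isQuasiInverse_of_leftInverse (h : ∀ x, B (A x) = x) (hB : FiniteDimensional ℂ B.ker) :
    LinearMap.IsQuasiInverse (B : E →ₗ[ℂ] E) (A : E →ₗ[ℂ] E) := by
  have h1 : (B : E →ₗ[ℂ] E) ∘ₗ (A : E →ₗ[ℂ] E) = LinearMap.id := LinearMap.ext h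
  refine ⟨?_, ?_⟩
  · rw [LinearMap.IsLeftQuasiInverse, h1]
  · rw [LinearMap.IsRightQuasiInverse, Setoid.comm,
      LinearMap.FiniteRangeSetoid.equiv_iff_hasNoetherianRange,
      LinearMap.hasNoetherianRange_iff_range]
    have hle : LinearMap.range (LinearMap.id - (A : E →ₗ[ℂ] E) ∘ₗ (B : E →ₗ[ℂ] E)) ≤ B.ker := by
      rintro _ ⟨x, rfl⟩
      simp [h]
    exact isNoetherian_of_le hle

theorem isFredholm_left (h : ∀ x, B (A x) = x) (hB : FiniteDimensional ℂ B.ker) :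
    A.IsFredholm ∧ fredholmIndex A = -(Module.finrank ℂ B.ker : ℤ) := by
  refine ⟨.of_isQuasiInverse (isQuasiInverse_of_leftInverse h hB), ?_⟩
  have hk : A.ker = ⊥ := LinearMap.ker_eq_bot.2 (Function.LeftInverse.injective h)
  rw [fredholmIndex, hk, finrank_bot,
    (Submodule.quotientEquivOfIsCompl _ _ (isCompl_range_ker h)).finrank_eq]
  simp

theorem isFredholm_right (h : ∀ x, B (A x) = x) (hB : FiniteDimensional ℂ B.ker) :
    B.IsFredholm ∧ fredholmIndex B = (Module.finrank ℂ B.ker : ℤ) := by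
  refine ⟨.of_isQuasiInverse (isQuasiInverse_of_leftInverse h hB).symm, ?_⟩
  have hr : B.range = ⊤ := LinearMap.range_eq_top.2 (Function.RightInverse.surjective h)
  have : Module.finrank ℂ (E ⧸ B.range) = 0 := by
    have : Subsingleton (E ⧸ B.range) := Submodule.Quotient.subsingleton_iff.2 hr
    exact Module.finrank_zero_of_subsingleton
  rw [fredholmIndex, this]
  simp

end OneSided

/-! ### Composition of Fourier convolution operators -/

section Multipliers

variable {X : SpacePair}

theorem ExtendsConvolution.comp {a b : ℝ → ℂ} {S T : X.line.space →L[ℂ] X.line.space}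
    (hS : ExtendsConvolution X a S) (hT : ExtendsConvolution X b T) :
    ExtendsConvolution X (fun ξ => a ξ * b ξ) (S * T) := by
  intro f u hfu
  obtain ⟨v, hv, hTv⟩ := hT f u hfu
  obtain ⟨w, hw, hSw⟩ := hS (T f) v hTv
  refine ⟨w, ?_, hSw⟩
  filter_upwards [hv, hw] with ξ h1 h2
  rw [h2, h1, mul_assoc]

theorem extendsConvolution_one : ExtendsConvolution X (fun _ => 1) 1 := fun _ u hfu =>
  ⟨u, Eventually.of_forall fun _ => (one_mul _).symm, hfu⟩

theorem ExtendsConvolution.congr {a b : ℝ → ℂ} {T : X.line.space →L[ℂ] X.line.space}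
    (hT : ExtendsConvolution X a T) (hab : ∀ ξ, a ξ = b ξ) : ExtendsConvolution X b T := by
  rwa [← funext hab]

/-- Undo the rescaling of the frequency variable, which preserves null sets in this direction too,
then apply Fourier inversion. -/
theorem fourierL2_injective {u v : Lp ℂ 2 (volume : Measure ℝ)}
    (h : fourierL2 u =ᵐ[volume] fourierL2 v) : u = v := by
  have hq : Measure.QuasiMeasurePreserving (fun η : ℝ => -(2 * Real.pi) * η) volume volume := by
    refine ⟨by fun_prop, ?_⟩
    rw [Real.map_volume_mul_left (neg_ne_zero.2 (by positivity))]
    exact Measure.smul_absolutelyContinuous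
  have h1 : 𝓕 u = 𝓕 v := by
    refine Lp.ext ?_
    filter_upwards [hq.ae h] with η hη
    have e : -(-(2 * Real.pi) * η) / (2 * Real.pi) = η := by
      have := Real.pi_pos
      field_simp
    simpa only [fourierL2, e] using hη
  rw [← FourierTransform.fourierInv_fourier_eq (F := Lp ℂ 2 (volume : Measure ℝ)) u, h1,
    FourierTransform.fourierInv_fourier_eq]

theorem ExtendsConvolution.eqOn {a : ℝ → ℂ} {S T : X.line.space →L[ℂ] X.line.space}
    (hS : ExtendsConvolution X a S) (hT : ExtendsConvolution X a T) {f : X.line.space}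
    (hf : MemLp (f : ℝ →ₘ[volume] ℂ) 2 volume) : S f = T f := by
  obtain ⟨v, hv, hSv⟩ := hS f ⟨f, Lp.mem_Lp_iff_memLp.2 hf⟩ rfl
  obtain ⟨w, hw, hTw⟩ := hT f ⟨f, Lp.mem_Lp_iff_memLp.2 hf⟩ rfl
  have : v = w := fourierL2_injective (hv.trans hw.symm)
  exact Subtype.ext (by rw [hSv, hTw, this])

/-- The functions of `X(ℝ₊)` that are square integrable are dense. -/
def DenseL2 (X : SpacePair) : Prop :=
  Dense {f : X.half.space | MemLp (f : ℝ →ₘ[halfVolume] ℂ) 2 halfVolume}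

theorem memLp_extendFun {f : ℝ →ₘ[halfVolume] ℂ} (hf : MemLp f 2 halfVolume) :
    MemLp (extendFun f) 2 volume := by
  rw [memLp_congr_ae (coeFn_extendFun f), memLp_indicator_iff_restrict measurableSet_Ioi]
  exact hf

theorem coe_extend (f : X.half.space) :
    (X.extend f : ℝ →ₘ[volume] ℂ) = extendFun f := rfl

theorem coe_restrict (f : X.line.space) :
    (X.restrict f : ℝ →ₘ[halfVolume] ℂ) = restrictFun f := rfl

/-- On square-integrable functions the symbol determines the operator, and density with continuity
does the rest. Density is needed only over the half-line, because only zero extensions enter. -/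
theorem ExtendsConvolution.comp_extend_eq (hX : DenseL2 X) {a : ℝ → ℂ}
    {S T : X.line.space →L[ℂ] X.line.space}
    (hS : ExtendsConvolution X a S) (hT : ExtendsConvolution X a T) (f : X.half.space) :
    S (X.extend f) = T (X.extend f) := by
  have : Set.EqOn (fun f => S (X.extend f)) (fun f => T (X.extend f))
      {f : X.half.space | MemLp (f : ℝ →ₘ[halfVolume] ℂ) 2 halfVolume} := fun f hf =>
    hS.eqOn hT (memLp_extendFun hf)
  exact congrFun (Continuous.ext_on hX (by fun_prop) (by fun_prop) this) f

/-- The compression of an operator on `X(ℝ)` to `X(ℝ₊)`. -/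
def compression (T : X.line.space →L[ℂ] X.line.space) : X.half.space →L[ℂ] X.half.space :=
  X.restrict ∘L T ∘L X.extend

theorem compression_apply (T : X.line.space →L[ℂ] X.line.space) (f : X.half.space) :
    compression T f = X.restrict (T (X.extend f)) := rfl

/-- Frees the Wiener–Hopf operator from the arbitrary choice in `fourierConvolution`: any bounded
realization of the symbol gives the same compression. -/
theorem wienerHopf_eq (hX : DenseL2 X) {a : ℝ → ℂ} {T : X.line.space →L[ℂ] X.line.space}
    (ha : MemLp a ∞ (volume : Measure ℝ)) (hT : ExtendsConvolution X a T) :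
    wienerHopf X a = compression T := by
  have h : IsFourierMultiplier X a := ⟨ha, T, hT⟩
  ext1 f
  simp only [wienerHopf, fourierConvolution, dif_pos h, ContinuousLinearMap.comp_apply,
    compression_apply]
  rw [ExtendsConvolution.comp_extend_eq hX h.2.choose_spec hT f]

end Multipliers

/-! ### The operators with symbols `r₁` and `r₋₁` -/

namespace FunctionNorm.AveragingBounded

variable {X : SpacePair} {σ : ℝ}

/-- The identity minus twice exponential averaging. -/
def reflection (h : X.line.AveragingBounded σ) : X.line.space →L[ℂ] X.line.space :=
  1 + (-2 : ℂ) • h.op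

theorem reflection_apply (h : X.line.AveragingBounded σ) (f : X.line.space) :
    h.reflection f = f + (-2 : ℂ) • h.op f := rfl

theorem extendsConvolution_reflection (h : X.line.AveragingBounded σ) :
    ExtendsConvolution X (fun ξ => 1 - 2 * expSymbol σ (-ξ / (2 * Real.pi))) h.reflection := by
  intro f u hfu
  refine ⟨_, isConvolutionL2_sub σ u, ?_⟩
  rw [h.reflection_apply]
  change (f : ℝ →ₘ[volume] ℂ) + (-2 : ℂ) • expConvFun σ f
    = (u : ℝ →ₘ[volume] ℂ) + (-2 : ℂ) • expConvFun σ u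
  rw [hfu]

theorem coeFn_reflection (h : X.line.AveragingBounded σ) (f : X.line.space) :
    (h.reflection f : ℝ →ₘ[volume] ℂ) =ᵐ[volume]
      fun x => (f : ℝ →ₘ[volume] ℂ) x - 2 * expConv σ (f : ℝ →ₘ[volume] ℂ) x := by
  have h1 : (h.reflection f : ℝ →ₘ[volume] ℂ)
    = (f : ℝ →ₘ[volume] ℂ) + (-2 : ℂ) • expConvFun σ f := rfl
  rw [h1]
  filter_upwards [AEEqFun.coeFn_add (f : ℝ →ₘ[volume] ℂ) ((-2 : ℂ) • expConvFun σ f),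
    AEEqFun.coeFn_smul (-2 : ℂ) (expConvFun σ (f : ℝ →ₘ[volume] ℂ)),
    coeFn_expConvFun σ (f : ℝ →ₘ[volume] ℂ)] with x h1 h2 h3
  rw [h1, Pi.add_apply, h2, Pi.smul_apply, h3, smul_eq_mul]
  ring

end FunctionNorm.AveragingBounded

theorem extendsConvolution_pow {X : SpacePair} {T : X.line.space →L[ℂ] X.line.space} {k : ℤ}
    (hT : ExtendsConvolution X (rSymbol k) T) (n : ℕ) :
    ExtendsConvolution X (rSymbol (n * k)) (T ^ n) := by
  induction n with
  | zero => exact extendsConvolution_one.congr fun ξ => by simp [rSymbol]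
  | succ n ih =>
    rw [pow_succ]
    refine (ih.comp hT).congr fun ξ => ?_
    rw [← rSymbol_add]
    congr 1
    push_cast
    ring

/-! ### Restriction, zero extension, and the supports of averages. -/

theorem restrict_extend {X : SpacePair} (f : X.half.space) : X.restrict (X.extend f) = f := by
  refine Subtype.ext (AEEqFun.ext ?_)
  filter_upwards [coeFn_restrictFun (extendFun (f : ℝ →ₘ[halfVolume] ℂ)),
    ae_restrict_of_ae (coeFn_extendFun (f : ℝ →ₘ[halfVolume] ℂ)),
    ae_restrict_mem measurableSet_Ioi] with x h1 h2 h3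
  rw [coe_restrict, coe_extend, h1, h2, indicator_of_mem h3]

theorem coeFn_extend_restrict {X : SpacePair} (g : X.line.space) :
    (X.extend (X.restrict g) : ℝ →ₘ[volume] ℂ) =ᵐ[volume]
      (Ioi 0).indicator (g : ℝ →ₘ[volume] ℂ) := by
  filter_upwards [coeFn_extendFun (restrictFun (g : ℝ →ₘ[volume] ℂ)),
    (ae_restrict_iff' measurableSet_Ioi).1 (coeFn_restrictFun (g : ℝ →ₘ[volume] ℂ))] with x h1 h2
  rw [coe_extend, coe_restrict, h1]
  by_cases hx : x ∈ Ioi (0 : ℝ)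
  · rw [indicator_of_mem hx, indicator_of_mem hx, h2 hx]
  · rw [indicator_of_notMem hx, indicator_of_notMem hx]

/-- Membership in the range of extension by zero. -/
theorem extend_restrict_eq_of_ae {X : SpacePair} {g : X.line.space}
    (hg : ∀ᵐ x, x ∉ Ioi (0 : ℝ) → (g : ℝ →ₘ[volume] ℂ) x = 0) :
    X.extend (X.restrict g) = g := by
  refine Subtype.ext (AEEqFun.ext ?_)
  filter_upwards [coeFn_extend_restrict g, hg] with x h1 h2
  rw [h1]
  by_cases hx : x ∈ Ioi (0 : ℝ)
  · rw [indicator_of_mem hx]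
  · rw [indicator_of_notMem hx, h2 hx]

theorem restrict_congr {X : SpacePair} {g h : X.line.space}
    (hg : ∀ᵐ x, x ∈ Ioi (0 : ℝ) → (g : ℝ →ₘ[volume] ℂ) x = (h : ℝ →ₘ[volume] ℂ) x) :
    X.restrict g = X.restrict h := by
  refine Subtype.ext (AEEqFun.ext ?_)
  filter_upwards [coeFn_restrictFun (g : ℝ →ₘ[volume] ℂ), coeFn_restrictFun (h : ℝ →ₘ[volume] ℂ),
    (ae_restrict_iff' measurableSet_Ioi).2 hg] with x h1 h2 h3
  rw [coe_restrict, coe_restrict, h1, h2, h3]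

theorem expLaw_ae_pos : ∀ᵐ y ∂expLaw, y ∈ Ioi (0 : ℝ) :=
  expLaw_absolutelyContinuous.ae_le (ae_restrict_mem measurableSet_Ioi)

/-- Averaging over the past keeps functions supported on the half-line. -/
theorem expConv_one_eq_zero {f : ℝ → ℂ} (hf : ∀ᵐ x, x ∉ Ioi (0 : ℝ) → f x = 0) :
    ∀ᵐ x : ℝ, x ∉ Ioi (0 : ℝ) → expConv 1 f x = 0 := by
  filter_upwards [ae_ae_sub hf 1] with x hx hx0
  refine integral_eq_zero_of_ae ?_
  filter_upwards [hx, expLaw_ae_pos] with y h1 h2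
  refine h1 ?_
  simp only [mem_Ioi, not_lt] at hx0 h2 ⊢
  linarith

/-- Averaging over the future only depends on the values on the half-line. -/
theorem expConv_neg_one_congr {f g : ℝ → ℂ} (hfg : ∀ᵐ x, x ∈ Ioi (0 : ℝ) → f x = g x) :
    ∀ᵐ x : ℝ, x ∈ Ioi (0 : ℝ) → expConv (-1) f x = expConv (-1) g x := by
  filter_upwards [ae_ae_sub hfg (-1)] with x hx hx0
  refine integral_congr_ae ?_
  filter_upwards [hx, expLaw_ae_pos] with y h1 h2
  refine h1 ?_
  simp only [mem_Ioi] at hx0 h2 ⊢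
  linarith

/-! ### Multiplicativity of the compressions. -/

section HalfLine

variable {X : SpacePair}

open FunctionNorm.AveragingBounded

/-- At x ≤ 0 the average over the past involves only points at which a zero extension vanishes, so
the image is again supported on the half-line. -/
theorem extend_restrict_reflection_one (hp : X.line.AveragingBounded 1) (f : X.half.space) :
    X.extend (X.restrict (hp.reflection (X.extend f))) = hp.reflection (X.extend f) := by
  have h0 : ∀ᵐ x, x ∉ Ioi (0 : ℝ) → (X.extend f : ℝ →ₘ[volume] ℂ) x = 0 := by
    filter_upwards [coeFn_extendFun (f : ℝ →ₘ[halfVolume] ℂ)] with x h1 hx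
    rw [coe_extend, h1, indicator_of_notMem hx]
  refine extend_restrict_eq_of_ae ?_
  filter_upwards [coeFn_reflection hp (X.extend f), h0, expConv_one_eq_zero h0] with x h1 h2 h3 hx
  rw [h1, h2 hx, h3 hx]
  simp

/-- At x > 0 the average over the future involves only points of the half-line, so cutting g off
beforehand changes nothing there. -/
theorem restrict_reflection_neg_one (hm : X.line.AveragingBounded (-1)) (g : X.line.space) :
    X.restrict (hm.reflection (X.extend (X.restrict g))) = X.restrict (hm.reflection g) := by
  have h0 : ∀ᵐ x, x ∈ Ioi (0 : ℝ) → (X.extend (X.restrict g) : ℝ →ₘ[volume] ℂ) x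
      = (g : ℝ →ₘ[volume] ℂ) x := by
    filter_upwards [coeFn_extend_restrict g] with x h1 hx
    rw [h1, indicator_of_mem hx]
  refine restrict_congr ?_
  filter_upwards [coeFn_reflection hm (X.extend (X.restrict g)), coeFn_reflection hm g, h0,
    expConv_neg_one_congr h0] with x h1 h2 h3 h4 hx
  rw [h1, h2, h3 hx, h4 hx]

/-- The zero extensions form an invariant subspace of the operator with symbol r₁, on which it acts
as its compression. -/
theorem compression_pow_one (hp : X.line.AveragingBounded 1) (n : ℕ) :
    compression (hp.reflection ^ n) = compression hp.reflection ^ n := by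
  have key : ∀ n : ℕ, ∀ f : X.half.space,
      (hp.reflection ^ n) (X.extend f) = X.extend ((compression hp.reflection ^ n) f) := by
    intro n
    induction n with
    | zero => intro f; simp
    | succ n ih =>
      intro f
      rw [pow_succ, pow_succ, mul_apply_eq_comp, mul_apply_eq_comp,
        ← ih, compression_apply, extend_restrict_reflection_one]
  ext1 f
  rw [compression_apply, key, restrict_extend]

/-- Here the operator descends along restriction: the restricted image depends on the restriction
only. -/
theorem compression_pow_neg_one (hm : X.line.AveragingBounded (-1)) (n : ℕ) :
    compression (hm.reflection ^ n) = compression hm.reflection ^ n := by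
  have key : ∀ n : ℕ, ∀ g : X.line.space,
      X.restrict ((hm.reflection ^ n) g) = (compression hm.reflection ^ n) (X.restrict g) := by
    intro n
    induction n with
    | zero => intro f; simp
    | succ n ih =>
      intro g
      rw [pow_succ, pow_succ, mul_apply_eq_comp, mul_apply_eq_comp,
        compression_apply, restrict_reflection_neg_one, ih]
  ext1 f
  rw [compression_apply, key, restrict_extend]

theorem extendsConvolution_rSymbol_one (hp : X.line.AveragingBounded 1) : ExtendsConvolution X (rSymbol 1) hp.reflection := by
  rw [rSymbol_one_eq]
  exact hp.extendsConvolution_reflection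

theorem extendsConvolution_rSymbol_neg_one (hm : X.line.AveragingBounded (-1)) : ExtendsConvolution X (rSymbol (-1)) hm.reflection := by
  rw [rSymbol_neg_one_eq]
  exact hm.extendsConvolution_reflection

/-- The composite and the identity both realize the symbol r₋₁r₁ = 1, so they agree on zero
extensions without any computation of iterated averages. -/
theorem reflection_neg_one_one (hp : X.line.AveragingBounded 1)
    (hm : X.line.AveragingBounded (-1)) (hX : DenseL2 X) (f : X.half.space) :
    hm.reflection (hp.reflection (X.extend f)) = X.extend f :=
  ExtendsConvolution.comp_extend_eq hX
    (((extendsConvolution_rSymbol_neg_one hm).comp (extendsConvolution_rSymbol_one hp)).congr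
      fun ξ => by rw [← rSymbol_add]; simp [rSymbol]) extendsConvolution_one f

theorem reflection_one_neg_one (hp : X.line.AveragingBounded 1)
    (hm : X.line.AveragingBounded (-1)) (hX : DenseL2 X) (f : X.half.space) :
    hp.reflection (hm.reflection (X.extend f)) = X.extend f :=
  ExtendsConvolution.comp_extend_eq hX
    (((extendsConvolution_rSymbol_one hp).comp (extendsConvolution_rSymbol_neg_one hm)).congr
      fun ξ => by rw [← rSymbol_add]; simp [rSymbol]) extendsConvolution_one f

/-- The cut-off between the two operators is invisible to the averages over the future that follow.
In the opposite order it is not, and this is the source of the index. -/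
theorem compression_leftInverse (hp : X.line.AveragingBounded 1)
    (hm : X.line.AveragingBounded (-1)) (hX : DenseL2 X) (f : X.half.space) :
    compression hm.reflection (compression hp.reflection f) = f := by
  rw [compression_apply, compression_apply, restrict_reflection_neg_one,
    reflection_neg_one_one hp hm hX, restrict_extend]

/-! ### The kernel of the compression with symbol r₋₁. -/

/-- For `x < 0` the average over the future of a function supported on the half-line is a multiple
of `e^x`. -/
theorem expConv_neg_one_of_neg {f : ℝ → ℂ} (hf : ∀ x, x ∉ Ioi (0 : ℝ) → f x = 0) {x : ℝ}
    (hx : x ≤ 0) : expConv (-1) f x = (Real.exp x : ℂ) * ∫ y, f y ∂expLaw := by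
  rw [expConv, integral_expLaw, integral_expLaw]
  have h1 : ∀ y : ℝ, (Real.exp (-y) : ℂ) * f (x - (-1) * y)
      = (Real.exp x : ℂ) * ((fun z : ℝ => (Real.exp (-z) : ℂ) * f z) (y + x)) := by
    intro y
    have e : x - (-1) * y = y + x := by ring
    simp only [e]
    rw [← mul_assoc, ← Complex.ofReal_mul, ← Real.exp_add]
    ring_nf
  simp only [h1]
  rw [integral_const_mul]
  congr 1
  have h2 : ∫ y in Ioi (0 : ℝ), (fun z : ℝ => (Real.exp (-z) : ℂ) * f z) (y + x)
      = ∫ z in Ioi x, (Real.exp (-z) : ℂ) * f z := by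
    rw [← integral_indicator measurableSet_Ioi, ← integral_indicator measurableSet_Ioi,
      ← integral_add_right_eq_self (μ := volume)
        ((Ioi x).indicator fun z : ℝ => (Real.exp (-z) : ℂ) * f z) x]
    refine integral_congr_ae (Eventually.of_forall fun y => ?_)
    dsimp only
    by_cases hy : 0 < y
    · rw [indicator_of_mem (show y ∈ Ioi (0 : ℝ) from hy), indicator_of_mem (by simpa using hy)]
    · rw [indicator_of_notMem (show y ∉ Ioi (0 : ℝ) from hy),
        indicator_of_notMem (by simpa using hy)]
  rw [h2]
  refine (setIntegral_eq_of_subset_of_forall_sdiff_eq_zero measurableSet_Ioi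
    (Ioi_subset_Ioi hx) ?_)
  intro z hz
  rw [hf z hz.2, mul_zero]

theorem integral_Ioi_exp_neg_two_mul (a : ℝ) :
    ∫ y in Ioi a, Real.exp (-(2 * y)) = Real.exp (-(2 * a)) / 2 := by
  have h := integral_exp_mul_Ioi (a := -2) (by norm_num) a
  have e : ∀ y : ℝ, Real.exp (-(2 * y)) = Real.exp (-2 * y) := fun y => by ring_nf
  simp only [e]
  rw [h]
  ring

/-- For `x > 0` the average over the past of `e^x` on the negative half-line is a multiple of
`e^{-x}`. -/
theorem expConv_one_of_exp {x : ℝ} (hx : 0 < x) :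
    expConv 1 ((Iic (0 : ℝ)).indicator fun z => (Real.exp z : ℂ)) x = (Real.exp (-x) : ℂ) / 2 := by
  rw [expConv, integral_expLaw]
  have h1 : ∀ y : ℝ, (Real.exp (-y) : ℂ)
      * (Iic (0 : ℝ)).indicator (fun z => (Real.exp z : ℂ)) (x - 1 * y)
      = (Ici x).indicator (fun y => ((Real.exp x * Real.exp (-(2 * y)) : ℝ) : ℂ)) y := by
    intro y
    by_cases hy : x ≤ y
    · rw [indicator_of_mem (show x - 1 * y ∈ Iic (0 : ℝ) by simpa using hy),
        indicator_of_mem (show y ∈ Ici x from hy), ← Complex.ofReal_mul, ← Real.exp_add,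
        ← Real.exp_add]
      ring_nf
    · rw [indicator_of_notMem (show x - 1 * y ∉ Iic (0 : ℝ) by simpa using hy),
        indicator_of_notMem (show y ∉ Ici x from hy), mul_zero]
  simp only [h1]
  rw [setIntegral_indicator measurableSet_Ici,
    inter_eq_self_of_subset_right (Ici_subset_Ioi.2 hx),
    integral_Ici_eq_integral_Ioi]
  have h2 : ∫ y in Ioi x, ((Real.exp x * Real.exp (-(2 * y)) : ℝ) : ℂ)
      = ((∫ y in Ioi x, Real.exp x * Real.exp (-(2 * y)) : ℝ) : ℂ) := integral_ofReal
  rw [h2, integral_const_mul, integral_Ioi_exp_neg_two_mul, mul_div_assoc', ← Real.exp_add,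
    show x + -(2 * x) = -x by ring]
  push_cast
  rfl

/-- The defect of the one-sided inverse has rank one. -/
theorem sub_compression_compression (hp : X.line.AveragingBounded 1)
    (hm : X.line.AveragingBounded (-1)) (hX : DenseL2 X) (f : X.half.space) :
    (((f - compression hp.reflection (compression hm.reflection f) : X.half.space) :
      ℝ →ₘ[halfVolume] ℂ) : ℝ → ℂ) =ᵐ[halfVolume]
      fun x => 2 * (∫ y, (f : ℝ →ₘ[halfVolume] ℂ) y ∂expLaw) * (Real.exp (-x) : ℂ) := by
  set g := X.extend f with hg
  set h := hm.reflection g with hh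
  set c := ∫ y, (f : ℝ →ₘ[halfVolume] ℂ) y ∂expLaw with hc
  -- Without the intermediate cut-off the two operators would give back f, so the defect is the
  -- image of the part of h cut away, which lives on the negative half-line.
  have e1 : f - compression hp.reflection (compression hm.reflection f)
      = X.restrict (hp.reflection (h - X.extend (X.restrict h))) := by
    rw [map_sub, map_sub, hh, hg, reflection_one_neg_one hp hm hX, restrict_extend,
      compression_apply, compression_apply]
  have hgc : ∀ x : ℝ, x ≤ 0 → expConv (-1) ((Ioi 0).indicator (f : ℝ →ₘ[halfVolume] ℂ)) x
      = (Real.exp x : ℂ) * c := by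
    intro x hx
    rw [expConv_neg_one_of_neg (fun x hx => indicator_of_notMem hx _) hx, hc]
    congr 1
    refine integral_congr_ae ?_
    filter_upwards [expLaw_ae_pos] with y hy
    rw [indicator_of_mem hy]
  -- On x ≤ 0 the function g vanishes, leaving of h only -2 times the average over the future, which
  -- is c·e^x.
  have hw : ((h - X.extend (X.restrict h) : X.line.space) : ℝ →ₘ[volume] ℂ) =ᵐ[volume]
      fun x => (-2 * c) * (Iic (0 : ℝ)).indicator (fun z => (Real.exp z : ℂ)) x := by
    have e2 : ((h - X.extend (X.restrict h) : X.line.space) : ℝ →ₘ[volume] ℂ)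
        = (h : ℝ →ₘ[volume] ℂ) - (X.extend (X.restrict h) : X.line.space) := rfl
    rw [e2]
    filter_upwards [AEEqFun.coeFn_sub (h : ℝ →ₘ[volume] ℂ)
      (X.extend (X.restrict h) : X.line.space), coeFn_extend_restrict h,
      coeFn_reflection hm g, coeFn_extendFun (f : ℝ →ₘ[halfVolume] ℂ),
      expConv_congr (-1) (coeFn_extendFun (f : ℝ →ₘ[halfVolume] ℂ))] with x h1 h2 h3 h4 h5
    rw [h1, Pi.sub_apply, h2]
    by_cases hx : x ∈ Ioi (0 : ℝ)
    · rw [indicator_of_mem hx, indicator_of_notMem (by simpa using hx)]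
      simp
    · rw [indicator_of_notMem hx, indicator_of_mem (by simpa using hx), hh, h3, hg, coe_extend,
        h4, h5, indicator_of_notMem hx, hgc x (by simpa using hx)]
      ring
  rw [e1]
  filter_upwards [coeFn_restrictFun (hp.reflection (h - X.extend (X.restrict h)) :
    ℝ →ₘ[volume] ℂ), ae_restrict_of_ae (coeFn_reflection hp (h - X.extend (X.restrict h))),
    ae_restrict_of_ae hw, ae_restrict_of_ae (expConv_congr 1 hw),
    ae_restrict_mem measurableSet_Ioi] with x h1 h2 h3 h4 hx
  have hx' : x ∉ Iic (0 : ℝ) := by simpa using hx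
  rw [coe_restrict, h1, h2, h3, h4, indicator_of_notMem hx']
  have h5 : expConv 1 (fun x => (-2 * c) * (Iic (0 : ℝ)).indicator (fun z => (Real.exp z : ℂ)) x) x
      = (-2 * c) * expConv 1 ((Iic (0 : ℝ)).indicator (fun z => (Real.exp z : ℂ))) x :=
    integral_const_mul _ _
  rw [h5, expConv_one_of_exp hx]
  ring

/-- The indicator function of `(0, 1)` belongs to the space. -/
def HasUnitIndicator (X : SpacePair) : Prop :=
  X.half.toFun ((Ioo (0 : ℝ) 1).indicator fun _ => 1) < ∞

/-- On Ker B the operator 1 - AB is the identity, so the rank-one formula makes every element a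
multiple of e^{-x}. Conversely 1 - AB maps into Ker B, and its value at the indicator of (0, 1) is a
nonzero multiple of e^{-x}; this also proves that e^{-x} belongs to the space. -/
theorem finrank_ker_compression (hp : X.line.AveragingBounded 1)
    (hm : X.line.AveragingBounded (-1)) (hX : DenseL2 X) (hI : HasUnitIndicator X) :
    Module.finrank ℂ (compression hm.reflection).ker = 1 := by
  set B := compression hm.reflection with hB
  set A := compression hp.reflection with hA
  have hBA : ∀ f, B (A f) = f := compression_leftInverse hp hm hX
  set j : ℝ →ₘ[halfVolume] ℂ := AEEqFun.mk ((Ioo (0 : ℝ) 1).indicator fun _ => (1 : ℂ))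
    (aestronglyMeasurable_const.indicator measurableSet_Ioo) with hj
  have hjc : j =ᵐ[halfVolume] (Ioo (0 : ℝ) 1).indicator fun _ => (1 : ℂ) := AEEqFun.coeFn_mk _ _
  have hjm : j ∈ X.half.space := by
    refine lt_of_eq_of_lt (X.half.congr ?_) hI
    filter_upwards [hjc] with x hx
    rw [hx]
    by_cases h : x ∈ Ioo (0 : ℝ) 1 <;> simp [h]
  have hcj : ∫ y, j y ∂expLaw ≠ 0 := by
    rw [integral_congr_ae (expLaw_absolutelyContinuous.ae_eq hjc), integral_indicator
      measurableSet_Ioo, integral_const]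
    have h1 : expLaw (Ioo 0 1) ≠ 0 := by
      intro h0
      rw [expLaw, withDensity_apply_eq_zero measurable_expDensity] at h0
      have h2 : ({y : ℝ | ENNReal.ofReal (Real.exp (-y)) ≠ 0} ∩ Ioo 0 1) = Ioo 0 1 :=
        inter_eq_self_of_subset_right fun y _ => by simp [Real.exp_pos]
      rw [h2, Measure.restrict_apply measurableSet_Ioo,
        inter_eq_self_of_subset_left Ioo_subset_Ioi_self] at h0
      simp at h0
    have h3 : expLaw.real (Ioo 0 1) ≠ 0 := by
      rw [Measure.real, ENNReal.toReal_ne_zero]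
      exact ⟨h1, measure_ne_top _ _⟩
    simpa using h3
  set e : X.half.space := ⟨j, hjm⟩ - A (B ⟨j, hjm⟩) with he
  have hec : (e : ℝ →ₘ[halfVolume] ℂ) =ᵐ[halfVolume]
      fun x => 2 * (∫ y, j y ∂expLaw) * (Real.exp (-x) : ℂ) :=
    sub_compression_compression hp hm hX ⟨j, hjm⟩
  have heB : e ∈ B.ker := by
    simp [he, hBA]
  have he0 : (⟨e, heB⟩ : B.ker) ≠ 0 := by
    intro h0
    have h1 : e = 0 := congrArg Subtype.val h0
    have h2 : (e : ℝ →ₘ[halfVolume] ℂ) = 0 := by rw [h1]; rfl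
    rw [h2] at hec
    have hne : NeBot (ae halfVolume) := by
      rw [ae_neBot]
      intro hz
      have := congrArg (fun m : Measure ℝ => m univ) hz
      simp at this
    obtain ⟨x, h3, h4⟩ := (hec.and (AEEqFun.coeFn_zero (μ := halfVolume) (β := ℂ))).exists
    rw [h4] at h3
    simp only [Pi.zero_apply] at h3
    have h5 := h3.symm
    simp [hcj, Complex.exp_ne_zero] at h5
  refine finrank_eq_one _ he0 fun f => ?_
  -- Both f and e are multiples of e^{-x}, with coefficients twice the respective exponential
  -- integrals; the scalar is their ratio.
  refine ⟨(∫ y, (f : X.half.space).1 y ∂expLaw) / ∫ y, j y ∂expLaw, ?_⟩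
  refine Subtype.ext (Subtype.ext (AEEqFun.ext ?_))
  have hf : B (f : X.half.space) = 0 := f.2
  have hfc := sub_compression_compression hp hm hX (f : X.half.space)
  rw [← hB, hf, map_zero, sub_zero] at hfc
  change (((((∫ y, (f : X.half.space).1 y ∂expLaw) / ∫ y, j y ∂expLaw) •
    (e : ℝ →ₘ[halfVolume] ℂ) : ℝ →ₘ[halfVolume] ℂ)) : ℝ → ℂ) =ᵐ[halfVolume] _
  filter_upwards [hfc, hec, AEEqFun.coeFn_smul ((∫ y, (f : X.half.space).1 y ∂expLaw)
    / ∫ y, j y ∂expLaw) (e : ℝ →ₘ[halfVolume] ℂ)] with x h1 h2 h3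
  rw [h3, Pi.smul_apply, h2, h1, smul_eq_mul]
  field_simp

/-- The criterion for an abstract pair of spaces; for each class of spaces only its hypotheses are
left to check. -/
theorem wienerHopf_rSymbol (hp : X.line.AveragingBounded 1)
    (hm : X.line.AveragingBounded (-1)) (hX : DenseL2 X) (hI : HasUnitIndicator X) (n : ℤ) :
    IsFourierMultiplier X (rSymbol n) ∧ (wienerHopf X (rSymbol n)).IsFredholm ∧
      fredholmIndex (wienerHopf X (rSymbol n)) = -n := by
  have hk := finrank_ker_compression hp hm hX hI
  have hl := compression_leftInverse hp hm hX
  obtain ⟨m, rfl | rfl⟩ := n.eq_nat_or_neg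
  · have hT := extendsConvolution_pow (extendsConvolution_rSymbol_one hp) m
    rw [mul_one] at hT
    obtain ⟨h1, h2⟩ := finrank_ker_pow hl hk m
    rw [wienerHopf_eq hX (memLp_rSymbol m) hT]
    rw [compression_pow_one]
    have := isFredholm_left (pow_apply_pow_apply hl m) h1
    rw [h2] at this
    exact ⟨⟨memLp_rSymbol m, _, hT⟩, this⟩
  · have hT := extendsConvolution_pow (extendsConvolution_rSymbol_neg_one hm) m
    rw [mul_neg_one] at hT
    obtain ⟨h1, h2⟩ := finrank_ker_pow hl hk m
    rw [wienerHopf_eq hX (memLp_rSymbol _) hT]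
    rw [compression_pow_neg_one]
    have := isFredholm_right (pow_apply_pow_apply hl m) h1
    rw [h2] at this
    rw [neg_neg]
    exact ⟨⟨memLp_rSymbol _, _, hT⟩, this⟩

end HalfLine

/-! ### Truncations -/

/-- The set on which a function is cut off. -/
def tailSet (f : ℝ →ₘ[halfVolume] ℂ) (n : ℕ) : Set ℝ := {x | (n : ℝ) < x ∨ (n : ℝ) < ‖f x‖}

theorem measurableSet_tailSet (f : ℝ →ₘ[halfVolume] ℂ) (n : ℕ) : MeasurableSet (tailSet f n) :=
  (measurableSet_lt measurable_const measurable_id).union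
    (measurableSet_lt measurable_const f.stronglyMeasurable.norm.measurable)

theorem eventually_notMem_tailSet (f : ℝ →ₘ[halfVolume] ℂ) (x : ℝ) :
    ∀ᶠ n in atTop, x ∉ tailSet f n := by
  obtain ⟨N, hN⟩ := exists_nat_ge (max x ‖f x‖)
  filter_upwards [eventually_ge_atTop N] with n hn
  have hn' : max x ‖f x‖ ≤ n := hN.trans (by exact_mod_cast hn)
  simp only [tailSet, mem_ofPred_eq, not_or, not_lt]
  exact ⟨(le_max_left _ _).trans hn', (le_max_right _ _).trans hn'⟩

/-- The truncation of a function to a bounded function of bounded support. -/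
def truncation (f : ℝ →ₘ[halfVolume] ℂ) (n : ℕ) : ℝ →ₘ[halfVolume] ℂ :=
  AEEqFun.mk ((tailSet f n)ᶜ.indicator f)
    (f.aestronglyMeasurable.indicator (measurableSet_tailSet f n).compl)

theorem coeFn_truncation (f : ℝ →ₘ[halfVolume] ℂ) (n : ℕ) :
    truncation f n =ᵐ[halfVolume] (tailSet f n)ᶜ.indicator f :=
  AEEqFun.coeFn_mk _ _

theorem memLp_truncation (f : ℝ →ₘ[halfVolume] ℂ) (n : ℕ) :
    MemLp (truncation f n) 2 halfVolume := by
  rw [memLp_congr_ae (coeFn_truncation f n),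
    memLp_indicator_iff_restrict (measurableSet_tailSet f n).compl]
  have : IsFiniteMeasure (halfVolume.restrict (tailSet f n)ᶜ) := by
    refine ⟨?_⟩
    rw [Measure.restrict_apply_univ, Measure.restrict_apply (measurableSet_tailSet f n).compl]
    refine lt_of_le_of_lt (measure_mono (t := Icc 0 (n : ℝ)) ?_) (by simp)
    rintro x ⟨h1, h2⟩
    simp only [tailSet, mem_compl_iff, mem_ofPred_eq, not_or, not_lt] at h1
    exact ⟨le_of_lt h2, h1.1⟩
  refine MemLp.of_bound f.aestronglyMeasurable.restrict n ?_
  filter_upwards [ae_restrict_mem (measurableSet_tailSet f n).compl] with x hx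
  simp only [tailSet, mem_compl_iff, mem_ofPred_eq, not_or, not_lt] at hx
  exact hx.2

theorem eval_truncation_le (ρ : FunctionNorm halfVolume) (f : ℝ →ₘ[halfVolume] ℂ) (n : ℕ) :
    ρ.eval (truncation f n) ≤ ρ.eval f := by
  refine ρ.mono ?_
  filter_upwards [coeFn_truncation f n] with x hx
  rw [hx]
  by_cases h : x ∈ (tailSet f n)ᶜ
  · rw [indicator_of_mem h]
  · rw [indicator_of_notMem h]
    simp

theorem eval_sub_truncation (ρ : FunctionNorm halfVolume) (f : ℝ →ₘ[halfVolume] ℂ) (n : ℕ) :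
    ρ.eval (f - truncation f n) = ρ.toFun ((tailSet f n).indicator fun x => ‖f x‖ₑ) := by
  refine ρ.congr ?_
  filter_upwards [coeFn_truncation f n, AEEqFun.coeFn_sub f (truncation f n)] with x h1 h2
  rw [h2, Pi.sub_apply, h1]
  by_cases h : x ∈ tailSet f n
  · rw [indicator_of_mem h, indicator_of_notMem (by simpa using h), sub_zero]
  · rw [indicator_of_notMem h, indicator_of_mem (by simpa using h), sub_self, enorm_zero]

/-- Truncations belong to the space. -/
def truncationMem (X : SpacePair) (f : X.half.space) (n : ℕ) : X.half.space :=
  ⟨truncation f n, (eval_truncation_le X.half f n).trans_lt f.2⟩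

theorem denseL2_of_tendsto {X : SpacePair}
    (h : ∀ f : X.half.space, Tendsto (fun n => X.half.toFun
      ((tailSet (f : ℝ →ₘ[halfVolume] ℂ) n).indicator
        fun x => ‖(f : ℝ →ₘ[halfVolume] ℂ) x‖ₑ)) atTop (𝓝 0)) : DenseL2 X := by
  intro f
  refine mem_closure_of_tendsto (f := truncationMem X f) (b := atTop) ?_
    (Eventually.of_forall fun n => memLp_truncation f n)
  rw [tendsto_iff_norm_sub_tendsto_zero]
  have h1 : ∀ n, ‖truncationMem X f n - f‖ = (X.half.toFun
      ((tailSet (f : ℝ →ₘ[halfVolume] ℂ) n).indicator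
        fun x => ‖(f : ℝ →ₘ[halfVolume] ℂ) x‖ₑ)).toReal := by
    intro n
    rw [norm_sub_rev, ← eval_sub_truncation]
    rfl
  simp only [h1]
  exact (ENNReal.tendsto_toReal ENNReal.zero_ne_top).comp (h f)

/-! ### Density in reflexive spaces -/

/-- For x ≤ 0 the substitution z = x + y turns the average over the future of a function supported
on (0, ∞) into e^x ∫ f(z) e^{-z} dz. Only the inequality is needed. -/
theorem exp_mul_lintegral_le_expAvg (f : ℝ →ₘ[halfVolume] ℂ) :
    ∀ᵐ x : ℝ, (Iic (0 : ℝ)).indicator (fun x => ENNReal.ofReal (Real.exp x)) x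
      * ∫⁻ y, ‖f y‖ₑ ∂expLaw ≤ expAvg (-1) (fun x => ‖extendFun f x‖ₑ) x := by
  have h1 : (fun x => ‖extendFun f x‖ₑ) =ᵐ[volume] (Ioi 0).indicator fun x => ‖f x‖ₑ := by
    filter_upwards [coeFn_extendFun f] with x hx
    rw [hx, enorm_indicator_eq_indicator_enorm]
  filter_upwards [expAvg_congr (-1) h1] with x hx
  rw [hx]
  by_cases hx0 : x ∈ Iic (0 : ℝ)
  swap
  · rw [indicator_of_notMem hx0, zero_mul]
    exact zero_le
  rw [indicator_of_mem hx0, expAvg, lintegral_expLaw, lintegral_expLaw,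
    ← lintegral_const_mul' _ _ ENNReal.ofReal_ne_top, ← lintegral_indicator measurableSet_Ioi,
    ← lintegral_indicator measurableSet_Ioi,
    ← lintegral_add_right_eq_self (μ := volume) (fun z => (Ioi (0 : ℝ)).indicator _ z) x]
  refine lintegral_mono fun y => ?_
  by_cases hy : y + x ∈ Ioi (0 : ℝ)
  · have hy0 : y ∈ Ioi (0 : ℝ) := by
      simp only [mem_Ioi, mem_Iic] at hy hx0 ⊢
      linarith
    have e : x - (-1) * y = y + x := by ring
    rw [indicator_of_mem hy, indicator_of_mem hy0, e, indicator_of_mem hy, ← mul_assoc,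
      ← ENNReal.ofReal_mul (Real.exp_pos _).le, ← Real.exp_add]
    ring_nf
    exact le_rfl
  · rw [indicator_of_notMem hy]
    exact zero_le

/-- A continuous embedding of X(ℝ₊) into L¹(e^{-y} dy), drawn from the averaging bound alone: the
average dominates the exponential integral of |f| times the fixed function w, whose norm is not
zero. -/
theorem exists_lintegral_expLaw_le {X : SpacePair} (hm : X.line.AveragingBounded (-1)) :
    ∃ D : ℝ≥0, ∀ f : ℝ →ₘ[halfVolume] ℂ, ∫⁻ y, ‖f y‖ₑ ∂expLaw ≤ D * X.half.eval f := by
  obtain ⟨C, hC⟩ := hm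
  set w : ℝ → ℝ≥0∞ := (Iic (0 : ℝ)).indicator fun x => ENNReal.ofReal (Real.exp x) with hw
  have hwm : Measurable w := Measurable.indicator (by fun_prop) measurableSet_Iic
  have hk : X.line.toFun w ≠ 0 := by
    intro h0
    have h1 := X.line.eq_zero hwm.aemeasurable h0
    have h2 : volume (Iic (0 : ℝ)) = 0 := by
      refine measure_mono_null (fun x hx => ?_) h1
      simpa [hw, Real.exp_pos] using hx
    simp at h2
  -- The norm of w might be infinite; capping it at 1 keeps a finite nonzero divisor.
  set k : ℝ≥0∞ := min (X.line.toFun w) 1 with hkd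
  have hk0 : k ≠ 0 := by simp [hkd, hk, min_eq_iff]
  have hkt : k ≠ ∞ := ne_top_of_le_ne_top ENNReal.one_ne_top (min_le_right _ _)
  refine ⟨C * k.toNNReal⁻¹, fun f => ?_⟩
  have hkn : k.toNNReal ≠ 0 := by simp [ENNReal.toNNReal_eq_zero_iff, hk0, hkt]
  rw [ENNReal.coe_mul, ENNReal.coe_inv hkn, ENNReal.coe_toNNReal hkt]
  -- Finite minorants r replace the integral, which is not yet known to be finite, so that
  -- homogeneity applies.
  have key : ∀ r : ℝ≥0, (r : ℝ≥0∞) ≤ ∫⁻ y, ‖f y‖ₑ ∂expLaw → r * k ≤ C * X.half.eval f := by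
    intro r hr
    by_cases hr0 : r = 0
    · simp [hr0]
    have h1 : X.line.toFun (fun x => r * w x) ≤ C * X.half.eval f := by
      rw [← X.eval_extendFun]
      refine le_trans (X.line.mono ?_) (hC (extendFun f))
      filter_upwards [exp_mul_lintegral_le_expAvg f] with x hx
      refine le_trans ?_ hx
      rw [mul_comm]
      gcongr
    have h2 : X.line.toFun w ≤ ((r⁻¹ : ℝ≥0) : ℝ≥0∞) * X.line.toFun (fun x => r * w x) := by
      refine le_trans (le_of_eq ?_) (X.line.smul_le r⁻¹ (inv_ne_zero hr0) _)
      congr 1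
      ext x
      rw [← mul_assoc, ← ENNReal.coe_mul, inv_mul_cancel₀ hr0, ENNReal.coe_one, one_mul]
    calc (r : ℝ≥0∞) * k ≤ r * (((r⁻¹ : ℝ≥0) : ℝ≥0∞) * X.line.toFun (fun x => r * w x)) := by
          gcongr
          exact (min_le_left _ _).trans h2
      _ = X.line.toFun (fun x => r * w x) := by
          rw [← mul_assoc, ← ENNReal.coe_mul, mul_inv_cancel₀ hr0, ENNReal.coe_one, one_mul]
      _ ≤ _ := h1
  refine ENNReal.le_of_forall_nnreal_lt fun r hr => ?_
  have := key r hr.le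
  rwa [mul_right_comm, ← div_eq_mul_inv, ENNReal.le_div_iff_mul_le (Or.inl hk0) (Or.inl hkt)]

/-! ### Separating functionals from exponential integrals over sets. -/

section Functional

variable {X : SpacePair} {D : ℝ≥0}

theorem integrable_expLaw
    (hD : ∀ f : ℝ →ₘ[halfVolume] ℂ, ∫⁻ y, ‖f y‖ₑ ∂expLaw ≤ D * X.half.eval f)
    (f : X.half.space) : Integrable (f : ℝ →ₘ[halfVolume] ℂ) expLaw :=
  ⟨(f : ℝ →ₘ[halfVolume] ℂ).stronglyMeasurable.aestronglyMeasurable,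
    (hD f).trans_lt (ENNReal.mul_lt_top ENNReal.coe_lt_top f.2)⟩

/-- Integration over a set against the exponential distribution, as a functional. -/
def setIntegralFunctional
    (hD : ∀ f : ℝ →ₘ[halfVolume] ℂ, ∫⁻ y, ‖f y‖ₑ ∂expLaw ≤ D * X.half.eval f)
    (s : Set ℝ) : X.half.space →L[ℂ] ℂ :=
  LinearMap.mkContinuous
    { toFun := fun f => ∫ y in s, (f : ℝ →ₘ[halfVolume] ℂ) y ∂expLaw
      map_add' := fun f g => by
        rw [← integral_add (integrable_expLaw hD f).integrableOn
          (integrable_expLaw hD g).integrableOn]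
        exact integral_congr_ae (ae_restrict_of_ae (expLaw_absolutelyContinuous.ae_le
          (AEEqFun.coeFn_add (f : ℝ →ₘ[halfVolume] ℂ) g)))
      map_smul' := fun c f => by
        rw [RingHom.id_apply, ← integral_smul]
        exact integral_congr_ae (ae_restrict_of_ae (expLaw_absolutelyContinuous.ae_le
          (AEEqFun.coeFn_smul c (f : ℝ →ₘ[halfVolume] ℂ)))) }
    D fun f => by
      have h1 : ‖∫ y in s, (f : ℝ →ₘ[halfVolume] ℂ) y ∂expLaw‖ₑ ≤ D * X.half.eval f :=
        (enorm_integral_le_lintegral_enorm _).trans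
          ((lintegral_mono' Measure.restrict_le_self le_rfl).trans (hD f))
      have h2 := ENNReal.toReal_mono (ENNReal.mul_ne_top ENNReal.coe_ne_top f.2.ne) h1
      rwa [toReal_enorm, ENNReal.toReal_mul, ENNReal.coe_toReal] at h2

theorem setIntegralFunctional_apply
    (hD : ∀ f : ℝ →ₘ[halfVolume] ℂ, ∫⁻ y, ‖f y‖ₑ ∂expLaw ≤ D * X.half.eval f)
    (s : Set ℝ) (f : X.half.space) :
    setIntegralFunctional hD s f = ∫ y in s, (f : ℝ →ₘ[halfVolume] ℂ) y ∂expLaw := rfl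

theorem tendsto_setIntegralFunctional
    (hD : ∀ f : ℝ →ₘ[halfVolume] ℂ, ∫⁻ y, ‖f y‖ₑ ∂expLaw ≤ D * X.half.eval f)
    (s : Set ℝ) (f : X.half.space) :
    Tendsto (fun n => setIntegralFunctional hD s (truncationMem X f n)) atTop
      (𝓝 (setIntegralFunctional hD s f)) := by
  simp only [setIntegralFunctional_apply]
  have h1 : ∀ n, ∫ y in s, (truncationMem X f n : ℝ →ₘ[halfVolume] ℂ) y ∂expLaw
      = ∫ y in s, (tailSet f n)ᶜ.indicator (f : ℝ →ₘ[halfVolume] ℂ) y ∂expLaw := fun n =>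
    integral_congr_ae (ae_restrict_of_ae (expLaw_absolutelyContinuous.ae_le
      (coeFn_truncation f n)))
  simp only [h1]
  refine tendsto_integral_of_dominated_convergence
    (fun y => ‖(f : ℝ →ₘ[halfVolume] ℂ) y‖) (fun n => ?_)
    (integrable_expLaw hD f).norm.integrableOn (fun n => ?_) ?_
  · exact ((f : ℝ →ₘ[halfVolume] ℂ).stronglyMeasurable.indicator
      (measurableSet_tailSet _ n).compl).aestronglyMeasurable
  · exact Eventually.of_forall fun y => norm_indicator_le_norm_self _ _
  · refine Eventually.of_forall fun y => tendsto_const_nhds.congr' ?_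
    filter_upwards [eventually_notMem_tailSet (f : ℝ →ₘ[halfVolume] ℂ) y] with n hn
    rw [indicator_of_mem hn]

/-- Integrals over all sets determine a class for the exponential law, and its density is positive,
so equality holds almost everywhere for Lebesgue measure on the half-line. -/
theorem eq_of_setIntegralFunctional
    (hD : ∀ f : ℝ →ₘ[halfVolume] ℂ, ∫⁻ y, ‖f y‖ₑ ∂expLaw ≤ D * X.half.eval f)
    {f g : X.half.space}
    (h : ∀ s, setIntegralFunctional hD s f = setIntegralFunctional hD s g) : f = g := by
  have h1 : (f : ℝ →ₘ[halfVolume] ℂ) =ᵐ[expLaw] (g : ℝ →ₘ[halfVolume] ℂ) :=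
    Integrable.ae_eq_of_forall_setIntegral_eq _ _ (integrable_expLaw hD f)
      (integrable_expLaw hD g) fun s _ _ => h s
  refine Subtype.ext (AEEqFun.ext ?_)
  rw [EventuallyEq, expLaw, ae_withDensity_iff measurable_expDensity] at h1
  filter_upwards [h1] with x hx
  exact hx (by simp [Real.exp_pos])

end Functional

/-- Hahn–Banach in the quotient by the closed subspace: the class of x is nonzero there, and a
norming functional is pulled back. -/
theorem exists_functional_of_notMem_closure {E : Type*} [NormedAddCommGroup E] [NormedSpace ℂ E]
    (p : Submodule ℂ E) {x : E} (hx : x ∉ p.topologicalClosure) :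
    ∃ l : StrongDual ℂ E, (∀ y ∈ p, l y = 0) ∧ l x ≠ 0 := by
  have hclosed : IsClosed (p.topologicalClosure : Set E) := p.isClosed_topologicalClosure
  have hne : ‖p.topologicalClosure.mkQ x‖ ≠ 0 := by
    rw [norm_ne_zero_iff]
    simpa using hx
  obtain ⟨l, -, hl⟩ := exists_dual_vector ℂ (p.topologicalClosure.mkQ x) hne
  refine ⟨l ∘L p.topologicalClosure.mkQL, fun y hy => ?_, ?_⟩
  · have : p.topologicalClosure.mkQ y = 0 := by
      simpa using p.le_topologicalClosure hy
    change l (p.topologicalClosure.mkQ y) = 0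
    rw [this, map_zero]
  · change l (p.topologicalClosure.mkQ x) ≠ 0
    rw [hl]
    exact Complex.ofReal_ne_zero.2 hne

/-- A bounded sequence in a reflexive space has a weak limit along an ultrafilter. -/
theorem exists_weak_limit {E : Type*} [NormedAddCommGroup E] [NormedSpace ℂ E]
    (hE : IsReflexive E) (u : ℕ → E) {r : ℝ} (hu : ∀ n, ‖u n‖ ≤ r) :
    ∃ x : E, ∀ l : StrongDual ℂ E, Tendsto (fun n => l (u n)) (hyperfilter ℕ) (𝓝 (l x)) := by
  set J := NormedSpace.inclusionInDoubleDual ℂ E with hJ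
  have hcomp := WeakDual.isCompact_closedBall (𝕜 := ℂ) (E := StrongDual ℂ E) 0 r
  set v : ℕ → WeakDual ℂ (StrongDual ℂ E) := fun n => StrongDual.toWeakDual (J (u n)) with hv
  -- Banach–Alaoglu: the image of the sequence in the bidual stays in a weak-* compact ball.
  -- Reflexivity then brings the limit back to E.
  obtain ⟨w, -, hw⟩ := hcomp.ultrafilter_le_nhds ((hyperfilter ℕ).map v) (by
    rw [le_principal_iff]
    refine Eventually.of_forall (p := fun n => v n ∈ _) fun n => ?_
    rw [mem_preimage, mem_closedBall_zero_iff]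
    exact (NormedSpace.double_dual_bound ℂ E (u n)).trans (hu n))
  obtain ⟨x, hx⟩ := hE (WeakDual.toStrongDual w)
  refine ⟨x, fun l => ?_⟩
  have h1 : Tendsto v (hyperfilter ℕ) (𝓝 w) := hw
  have h2 := ((WeakDual.eval_continuous l).tendsto w).comp h1
  have h3 : w l = l x := by
    have : (WeakDual.toStrongDual w) l = l x := by rw [← hx]; rfl
    exact this
  rw [h3] at h2
  exact h2

/-- If f were outside the closure, some functional would vanish on all square-integrable functions
but not at f. The truncations of f have a weak limit along an ultrafilter, and the set integrals
show it to be f, so the functional vanishes at f as well. -/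
theorem denseL2_of_isReflexive {X : SpacePair} (hm : X.line.AveragingBounded (-1))
    (hE : IsReflexive X.half.space) : DenseL2 X := by
  obtain ⟨D, hD⟩ := exists_lintegral_expLaw_le hm
  set S : Set X.half.space := {f | MemLp (f : ℝ →ₘ[halfVolume] ℂ) 2 halfVolume}
  set p : Submodule ℂ X.half.space :=
    { carrier := S
      add_mem' := fun {f g} hf hg => (MemLp.add hf hg).ae_eq
        (AEEqFun.coeFn_add (f : ℝ →ₘ[halfVolume] ℂ) g).symm
      zero_mem' := MemLp.zero.ae_eq (AEEqFun.coeFn_zero (μ := halfVolume) (β := ℂ)).symm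
      smul_mem' := fun c f hf => (MemLp.const_smul hf c).ae_eq
        (AEEqFun.coeFn_smul c (f : ℝ →ₘ[halfVolume] ℂ)).symm } with hp
  intro f
  by_contra hf
  obtain ⟨l, hl, hlf⟩ := exists_functional_of_notMem_closure p (x := f) hf
  obtain ⟨g, hg⟩ := exists_weak_limit hE (truncationMem X f) (r := ‖f‖) fun n =>
    ENNReal.toReal_mono f.2.ne (eval_truncation_le X.half f n)
  have hfg : g = f := eq_of_setIntegralFunctional hD fun s =>
    tendsto_nhds_unique (hg (setIntegralFunctional hD s))
      ((tendsto_setIntegralFunctional hD s f).mono_left Nat.hyperfilter_le_atTop)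
  have h0 : l g = 0 := by
    refine tendsto_nhds_unique (hg l) (tendsto_const_nhds.congr fun n => ?_)
    exact (hl _ (memLp_truncation f n)).symm
  rw [hfg] at h0
  exact hlf h0

/-! ### Orlicz spaces -/

theorem luxemburg_unitIndicator_lt_top {Ψ : ℝ → ℝ≥0∞ → ℝ≥0∞} (h0 : ∀ x, Ψ x 0 = 0) {s : ℝ≥0}
    (hs : 0 < s) (h1 : ∀ x, Ψ x (1 / s) ≤ 1) :
    luxemburg halfVolume Ψ ((Ioo (0 : ℝ) 1).indicator fun _ => 1) < ∞ := by
  refine (luxemburg_le hs ?_).trans_lt ENNReal.coe_lt_top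
  calc ∫⁻ x, Ψ x ((Ioo (0 : ℝ) 1).indicator (fun _ => 1) x / s) ∂halfVolume
      ≤ ∫⁻ x, (Ioo (0 : ℝ) 1).indicator (fun _ => 1) x ∂halfVolume := by
        refine lintegral_mono fun x => ?_
        by_cases hx : x ∈ Ioo (0 : ℝ) 1
        · simpa only [indicator_of_mem hx] using h1 x
        · simp only [indicator_of_notMem hx, ENNReal.zero_div, h0, le_refl]
    _ = halfVolume (Ioo (0 : ℝ) 1) := by
        rw [lintegral_indicator measurableSet_Ioo, setLIntegral_one]
    _ ≤ volume (Ioo (0 : ℝ) 1) := Measure.restrict_apply_le _ _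
    _ = 1 := by simp

namespace IsYoungDensity

variable {φ : ℝ → ℝ≥0∞}

theorem youngFunction_zero (φ : ℝ → ℝ≥0∞) : youngFunction φ 0 = 0 := by
  simpa using youngFunction_coe φ 0

/-- The supporting line of the Young function at `r`. -/
theorem youngFunction_support (h : IsYoungDensity φ) (r : ℝ≥0) (s : ℝ≥0∞) :
    youngFunction φ r + s * φ r ≤ youngFunction φ s + r * φ r := by
  by_cases hs : s = ∞
  · rw [hs, h.youngFunction_top, top_add]
    exact le_top
  lift s to ℝ≥0 using hs
  rcases le_total s r with hsr | hrs
  · calc youngFunction φ r + s * φ r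
        ≤ youngFunction φ s + (r - s : ℝ≥0) * φ r + s * φ r := by
          gcongr
          exact h.youngFunction_le hsr
      _ = youngFunction φ s + r * φ r := by
          rw [add_assoc, ← add_mul, ← ENNReal.coe_add, tsub_add_cancel_of_le hsr]
  · calc youngFunction φ r + s * φ r
        = youngFunction φ r + (s - r : ℝ≥0) * φ r + r * φ r := by
          rw [add_assoc, ← add_mul, ← ENNReal.coe_add, tsub_add_cancel_of_le hrs]
      _ ≤ youngFunction φ s + r * φ r := by
          gcongr
          exact h.le_youngFunction hrs

/-- The Young function is left-continuous. -/
theorem youngFunction_le_of_forall_lt {m B : ℝ≥0∞}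
    (hB : ∀ r : ℝ≥0, (r : ℝ≥0∞) < m → youngFunction φ r ≤ B) : youngFunction φ m ≤ B := by
  by_cases hm : m = 0
  · rw [hm, youngFunction_zero]
    exact zero_le
  obtain ⟨u, hu, hum, hlim⟩ := exists_seq_strictMono_tendsto' (pos_iff_ne_zero.2 hm)
  -- The two sets can differ only at the endpoint t = m, which is a null set.
  have hset : ({t : ℝ | 0 < t ∧ ENNReal.ofReal t ≤ m} : Set ℝ)
      =ᵐ[volume] ⋃ n, {t : ℝ | 0 < t ∧ ENNReal.ofReal t ≤ u n} := by
    have h1 : ∀ᵐ t : ℝ, t ≠ m.toReal := by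
      rw [ae_iff]
      simp
    filter_upwards [h1] with t ht
    refine propext ⟨fun hx => ?_, fun hx => ?_⟩
    · have hlt : ENNReal.ofReal t < m := by
        refine lt_of_le_of_ne hx.2 fun he => ht ?_
        rw [← he, ENNReal.toReal_ofReal hx.1.le]
      obtain ⟨n, hn⟩ := (hlim.eventually (lt_mem_nhds hlt)).exists
      exact mem_iUnion.2 ⟨n, hx.1, hn.le⟩
    · obtain ⟨n, hn⟩ := mem_iUnion.1 hx
      exact ⟨hn.1, hn.2.trans (hum n).2.le⟩
  rw [youngFunction, setLIntegral_congr hset, setLIntegral_iUnion_of_directed]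
  · refine iSup_le fun n => ?_
    have hn := hB (u n).toNNReal
    rw [ENNReal.coe_toNNReal (hum n).2.ne_top] at hn
    exact hn (hum n).2
  · exact Monotone.directed_le fun i j hij t ht => ⟨ht.1, ht.2.trans (hu.monotone hij)⟩

/-- Jensen's inequality. -/
theorem youngFunction_lintegral_le (h : IsYoungDensity φ) {ν : Measure ℝ} [IsProbabilityMeasure ν]
    {g : ℝ → ℝ≥0∞} (hg : Measurable g) :
    youngFunction φ (∫⁻ y, g y ∂ν) ≤ ∫⁻ y, youngFunction φ (g y) ∂ν := by
  have hΦ : Measurable fun y => youngFunction φ (g y) := (youngFunction_mono φ).measurable.comp hg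
  -- By left continuity it is enough to bound Φ(r) for r below the mean. The supporting line at r
  -- does this if φ(r) is finite; otherwise Φ is infinite beyond r, where g takes values with
  -- positive probability.
  refine youngFunction_le_of_forall_lt fun r hr => ?_
  by_cases hφ : φ r = ∞
  · have hpos : ν {y | (r : ℝ≥0∞) < g y} ≠ 0 := by
      intro h0
      have hle : ∀ᵐ y ∂ν, g y ≤ r := by
        rw [ae_iff]
        simpa using h0
      have := lintegral_mono_ae hle
      rw [lintegral_const, measure_univ, mul_one] at this
      exact absurd hr (not_lt.2 this)
    have htop : ∀ y ∈ {y | (r : ℝ≥0∞) < g y}, youngFunction φ (g y) = ∞ := by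
      intro y hy
      have hy' : (r : ℝ≥0∞) < g y := hy
      obtain ⟨t, ht1, ht2⟩ := ENNReal.lt_iff_exists_nnreal_btwn.1 hy'
      have hrt : r < t := by exact_mod_cast ht1
      refine top_unique (le_trans ?_ (youngFunction_mono φ ht2.le))
      refine le_trans ?_ (h.le_youngFunction hrt.le)
      rw [hφ, ENNReal.mul_top (by exact_mod_cast (tsub_pos_of_lt hrt).ne')]
      simp
    have : ∫⁻ y, youngFunction φ (g y) ∂ν = ∞ := by
      refine top_unique ?_
      calc ∞ = ∫⁻ _ in {y | (r : ℝ≥0∞) < g y}, ∞ ∂ν := by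
            rw [setLIntegral_const, ENNReal.top_mul hpos]
        _ = ∫⁻ y in {y | (r : ℝ≥0∞) < g y}, youngFunction φ (g y) ∂ν :=
            (setLIntegral_congr_fun (measurableSet_lt measurable_const hg) htop).symm
        _ ≤ _ := setLIntegral_le_lintegral _ _
    rw [this]
    exact le_top
  · have h1 := lintegral_mono (μ := ν) fun y => h.youngFunction_support r (g y)
    rw [lintegral_add_left measurable_const, lintegral_add_left hΦ, lintegral_const,
      lintegral_const, measure_univ, mul_one, mul_one, lintegral_mul_const _ hg] at h1
    refine (ENNReal.add_le_add_iff_right (ENNReal.mul_ne_top ENNReal.coe_ne_top hφ)).1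
      (le_trans ?_ h1)
    gcongr

/-- Jensen bounds Φ of an average by the average of Φ, and averaging preserves integrals, so each
scale admissible for f is admissible for its average. -/
theorem averagingBounded (h : IsYoungDensity φ) (σ : ℝ) :
    (orlicz h).line.AveragingBounded σ := by
  refine ⟨1, fun f => ?_⟩
  rw [ENNReal.coe_one, one_mul]
  have hf : Measurable fun x => ‖f x‖ₑ := f.stronglyMeasurable.enorm
  change luxemburg volume (fun _ => youngFunction φ) _
    ≤ luxemburg volume (fun _ => youngFunction φ) _
  refine le_of_forall_gt fun t ht => ?_
  obtain ⟨s, hs, hs1, hs2⟩ := exists_of_luxemburg_lt ht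
  refine (luxemburg_le hs ?_).trans_lt hs2
  have hm : Measurable fun x => youngFunction φ (‖f x‖ₑ / s) :=
    (youngFunction_mono φ).measurable.comp (hf.div_const _)
  calc ∫⁻ x, youngFunction φ (expAvg σ (fun x => ‖f x‖ₑ) x / s)
      ≤ ∫⁻ x, expAvg σ (fun x => youngFunction φ (‖f x‖ₑ / s)) x := by
        refine lintegral_mono fun x => ?_
        rw [expAvg, div_eq_mul_inv, ← lintegral_mul_const _ (by fun_prop)]
        exact h.youngFunction_lintegral_le (by fun_prop)
    _ = ∫⁻ x, youngFunction φ (‖f x‖ₑ / s) := lintegral_expAvg σ hm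
    _ ≤ 1 := hs1

theorem hasUnitIndicator (h : IsYoungDensity φ) : HasUnitIndicator (orlicz h) := by
  obtain ⟨t, ht, hφt⟩ := h.finite
  -- Chosen so that r ≤ t and rφ(t) ≤ 1, whence Φ(r) ≤ rφ(r) ≤ 1; the scale used is 1/r.
  set r : ℝ≥0 := min t.toNNReal ((φ t).toNNReal + 1)⁻¹ with hr
  have hr0 : 0 < r := lt_min (by simpa using ht) (by positivity)
  refine luxemburg_unitIndicator_lt_top (s := r⁻¹) (fun _ => youngFunction_zero φ)
    (inv_pos.2 hr0) fun _ => ?_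
  rw [ENNReal.coe_inv hr0.ne', one_div, inv_inv]
  have hrt : (r : ℝ) ≤ t := by
    have : r ≤ t.toNNReal := min_le_left _ _
    calc (r : ℝ) ≤ t.toNNReal := by exact_mod_cast this
      _ = t := Real.coe_toNNReal _ ht.le
  calc youngFunction φ r ≤ youngFunction φ (0 : ℝ≥0) + (r - 0 : ℝ≥0) * φ r :=
        h.youngFunction_le zero_le
    _ = r * φ r := by
        rw [ENNReal.coe_zero, youngFunction_zero, zero_add, tsub_zero]
    _ ≤ (((φ t).toNNReal + 1)⁻¹ : ℝ≥0) * φ t := by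
        gcongr
        · exact min_le_right _ _
        · exact h.mono (show (0 : ℝ) ≤ r from r.2) ht.le hrt
    _ ≤ 1 := by
        lift φ t to ℝ≥0 using hφt.ne with c
        rw [ENNReal.toNNReal_coe]
        have : (c + 1)⁻¹ * c ≤ 1 := by
          rw [inv_mul_le_iff₀ (by positivity), mul_one]
          exact le_self_add
        exact_mod_cast this

end IsYoungDensity

/-! ### Variable Lebesgue spaces -/

theorem lintegral_le_maximalFunction (f : ℝ → ℂ) {x a b : ℝ} (hab : a < b) (hx : x ∈ Icc a b) :
    ∫⁻ t in Icc a b, ‖f t‖ₑ ≤ ENNReal.ofReal (b - a) * maximalFunction f x := by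
  have h0 : ENNReal.ofReal (b - a) ≠ 0 := by simpa using hab
  have h1 : (∫⁻ t in Icc a b, ‖f t‖ₑ) / ENNReal.ofReal (b - a) ≤ maximalFunction f x :=
    le_iSup₂_of_le a b (le_iSup₂_of_le hab hx le_rfl)
  rwa [ENNReal.div_le_iff' h0 ENNReal.ofReal_ne_top] at h1

theorem lintegral_translate_le_maximalFunction (f : ℝ → ℂ) {σ : ℝ} (hσ : σ = 1 ∨ σ = -1) (x : ℝ)
    {r : ℝ} (hr : 0 < r) :
    ∫⁻ y in Ioo 0 r, ‖f (x - σ * y)‖ₑ ≤ ENNReal.ofReal r * maximalFunction f x := by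
  rw [← lintegral_indicator measurableSet_Ioo]
  rcases hσ with rfl | rfl
  · calc ∫⁻ y, (Ioo 0 r).indicator (fun y => ‖f (x - 1 * y)‖ₑ) y
        ≤ ∫⁻ y, (Icc (x - r) x).indicator (fun t => ‖f t‖ₑ) (x - y) := by
          refine lintegral_mono fun y => ?_
          by_cases hy : y ∈ Ioo 0 r
          · rw [indicator_of_mem hy, indicator_of_mem (show x - y ∈ Icc (x - r) x from
              ⟨by linarith [hy.2], by linarith [hy.1]⟩), one_mul]
          · rw [indicator_of_notMem hy]
            exact zero_le
      _ = ∫⁻ t in Icc (x - r) x, ‖f t‖ₑ := by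
          rw [lintegral_sub_left_eq_self (μ := volume)
            ((Icc (x - r) x).indicator fun t => ‖f t‖ₑ) x, lintegral_indicator measurableSet_Icc]
      _ ≤ ENNReal.ofReal (x - (x - r)) * maximalFunction f x :=
          lintegral_le_maximalFunction f (by linarith) ⟨by linarith, le_rfl⟩
      _ = _ := by rw [sub_sub_cancel]
  · calc ∫⁻ y, (Ioo 0 r).indicator (fun y => ‖f (x - (-1) * y)‖ₑ) y
        ≤ ∫⁻ y, (Icc x (x + r)).indicator (fun t => ‖f t‖ₑ) (y + x) := by
          refine lintegral_mono fun y => ?_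
          by_cases hy : y ∈ Ioo 0 r
          · rw [indicator_of_mem hy, indicator_of_mem (show y + x ∈ Icc x (x + r) from
              ⟨by linarith [hy.1], by linarith [hy.2]⟩), show x - (-1) * y = y + x by ring]
          · rw [indicator_of_notMem hy]
            exact zero_le
      _ = ∫⁻ t in Icc x (x + r), ‖f t‖ₑ := by
          rw [lintegral_add_right_eq_self (μ := volume)
            ((Icc x (x + r)).indicator fun t => ‖f t‖ₑ) x, lintegral_indicator measurableSet_Icc]
      _ ≤ ENNReal.ofReal (x + r - x) * maximalFunction f x :=
          lintegral_le_maximalFunction f (by linarith) ⟨le_rfl, by linarith⟩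
      _ = _ := by rw [add_sub_cancel_left]

/-- The first moment of the exponential distribution. -/
theorem lintegral_exp_mul_lt_top :
    ∫⁻ r in Ioi (0 : ℝ), ENNReal.ofReal (Real.exp (-r)) * ENNReal.ofReal r < ∞ := by
  have h := (Real.GammaIntegral_convergent (s := 2) (by norm_num)).lintegral_lt_top
  refine lt_of_le_of_lt (setLIntegral_mono' measurableSet_Ioi fun r hr => ?_) h
  rw [← ENNReal.ofReal_mul (Real.exp_pos _).le]
  refine ENNReal.ofReal_le_ofReal (le_of_eq ?_)
  norm_num

/-- Exponential averages are dominated by the maximal function. -/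
theorem expAvg_le_maximalFunction {f : ℝ → ℂ} (hf : Measurable f) {σ : ℝ} (hσ : σ = 1 ∨ σ = -1)
    (x : ℝ) :
    expAvg σ (fun x => ‖f x‖ₑ) x
      ≤ (∫⁻ r in Ioi (0 : ℝ), ENNReal.ofReal (Real.exp (-r)) * ENNReal.ofReal r)
        * maximalFunction f x := by
  set g : ℝ → ℝ≥0∞ := fun y => ‖f (x - σ * y)‖ₑ with hg
  have hgm : Measurable g := by fun_prop
  set k : ℝ → ℝ → ℝ≥0∞ := fun y r =>
    {z : ℝ × ℝ | z.1 < z.2}.indicator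
      (fun z => ENNReal.ofReal (Real.exp (-z.2)) * g z.1) (y, r) with hk
  have hkm : Measurable (Function.uncurry k) := by
    refine Measurable.indicator ?_ (measurableSet_lt measurable_fst measurable_snd)
    exact (by fun_prop : Measurable fun z : ℝ × ℝ => ENNReal.ofReal (Real.exp (-z.2))).mul
      (hgm.comp measurable_fst)
  -- Layer cake: e^{-y} is the integral of e^{-r} over r > y. It writes the average as a
  -- superposition of integrals over intervals of length r with endpoint x, each at most r times the
  -- maximal function.
  have h1 : ∀ y ∈ Ioi (0 : ℝ), ENNReal.ofReal (Real.exp (-y)) * g y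
      = ∫⁻ r in Ioi (0 : ℝ), k y r := by
    intro y hy
    have e : ∀ r, k y r = (Ioi y).indicator (fun r => ENNReal.ofReal (Real.exp (-r)) * g y) r :=
      fun r => rfl
    simp only [e]
    rw [setLIntegral_indicator measurableSet_Ioi,
      inter_eq_self_of_subset_left (Ioi_subset_Ioi (le_of_lt hy)),
      lintegral_mul_const _ (by fun_prop), lintegral_Ioi_exp_neg]
  have h2 : ∀ r ∈ Ioi (0 : ℝ), ∫⁻ y in Ioi (0 : ℝ), k y r
      ≤ ENNReal.ofReal (Real.exp (-r)) * ENNReal.ofReal r * maximalFunction f x := by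
    intro r hr
    have e : ∀ y, k y r = (Iio r).indicator (fun y => ENNReal.ofReal (Real.exp (-r)) * g y) y :=
      fun y => rfl
    simp only [e]
    rw [setLIntegral_indicator measurableSet_Iio, inter_comm, Ioi_inter_Iio,
      lintegral_const_mul _ hgm, mul_assoc]
    gcongr
    exact lintegral_translate_le_maximalFunction f hσ x hr
  calc expAvg σ (fun x => ‖f x‖ₑ) x
      = ∫⁻ y in Ioi (0 : ℝ), ENNReal.ofReal (Real.exp (-y)) * g y := lintegral_expLaw g
    _ = ∫⁻ y in Ioi (0 : ℝ), ∫⁻ r in Ioi (0 : ℝ), k y r :=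
        setLIntegral_congr_fun measurableSet_Ioi h1
    _ = ∫⁻ r in Ioi (0 : ℝ), ∫⁻ y in Ioi (0 : ℝ), k y r :=
        lintegral_lintegral_swap hkm.aemeasurable
    _ ≤ ∫⁻ r in Ioi (0 : ℝ), ENNReal.ofReal (Real.exp (-r)) * ENNReal.ofReal r
          * maximalFunction f x := setLIntegral_mono' measurableSet_Ioi h2
    _ = _ := lintegral_mul_const _ (by fun_prop)

namespace IsMaximalExponent

variable {p : ℝ → ℝ}

theorem averagingBounded (h : IsMaximalExponent p) {σ : ℝ} (hσ : σ = 1 ∨ σ = -1) :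
    (variableLebesgue h.toIsVariableExponent).line.AveragingBounded σ := by
  obtain ⟨C, hC⟩ := h.maximal_bounded
  set ρ := (variableLebesgue h.toIsVariableExponent).line
  obtain ⟨c, hc⟩ : ∃ c : ℝ≥0, (c : ℝ≥0∞)
      = ∫⁻ r in Ioi (0 : ℝ), ENNReal.ofReal (Real.exp (-r)) * ENNReal.ofReal r :=
    ⟨_, ENNReal.coe_toNNReal lintegral_exp_mul_lt_top.ne⟩
  -- Adding 1 to c gives the nonzero scalar that `smul_le` requires; the last 1 makes the bound
  -- infinite for f outside the space.
  refine ⟨(c + 1) * C + 1, fun f => ?_⟩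
  by_cases hf : f ∈ ρ.space
  · calc ρ.toFun (expAvg σ fun x => ‖f x‖ₑ)
        ≤ ρ.toFun fun x => ((c + 1 : ℝ≥0) : ℝ≥0∞) * maximalFunction f x := by
          refine ρ.mono (Eventually.of_forall fun x => ?_)
          refine (expAvg_le_maximalFunction f.stronglyMeasurable.measurable hσ x).trans ?_
          rw [← hc]
          change (c : ℝ≥0∞) * _ ≤ ((c + 1 : ℝ≥0) : ℝ≥0∞) * _
          gcongr
          exact le_self_add
      _ ≤ ((c + 1 : ℝ≥0) : ℝ≥0∞) * (C * ρ.eval f) :=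
          (ρ.smul_le _ (by positivity) _).trans (by gcongr; exact hC f hf)
      _ ≤ (((c + 1) * C + 1 : ℝ≥0) : ℝ≥0∞) * ρ.eval f := by
          rw [← mul_assoc, ← ENNReal.coe_mul]
          gcongr
          exact le_self_add
  · have : ρ.eval f = ∞ := by
      by_contra hne
      exact hf (lt_top_iff_ne_top.2 hne)
    rw [this, ENNReal.mul_top (by positivity)]
    exact le_top

theorem hasUnitIndicator (h : IsMaximalExponent p) :
    HasUnitIndicator (variableLebesgue h.toIsVariableExponent) := by
  change luxemburg halfVolume (fun x s => s ^ p x) _ < ∞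
  exact luxemburg_unitIndicator_lt_top (s := 1)
    (fun x => ENNReal.zero_rpow_of_pos (zero_lt_one.trans_le (h.one_le x))) one_pos
    fun x => by simp

/-- Since the exponent is essentially bounded, the modular of f is finite at every scale e, not just
at some scale. Dominated convergence then sends the modular of the tails to 0 at scale e, so their
norm is eventually at most e. -/
theorem denseL2 (h : IsMaximalExponent p) : DenseL2 (variableLebesgue h.toIsVariableExponent) := by
  refine denseL2_of_tendsto fun f => ?_
  set F : ℝ →ₘ[halfVolume] ℂ := f.1 with hF
  obtain ⟨P, hP⟩ := h.sup_lt_top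
  have hpm : AEMeasurable p halfVolume := h.aemeasurable.mono_ac Measure.absolutelyContinuous_restrict
  have hFm : Measurable fun x => ‖F x‖ₑ := F.stronglyMeasurable.enorm
  have hfin : luxemburg halfVolume (fun x s => s ^ p x) (fun x => ‖F x‖ₑ) < ∞ := f.2
  obtain ⟨s, hs, hs1, -⟩ := exists_of_luxemburg_lt hfin
  change Tendsto (fun n => luxemburg halfVolume (fun x s => s ^ p x)
    ((tailSet F n).indicator fun x => ‖F x‖ₑ)) atTop (𝓝 0)
  rw [ENNReal.tendsto_nhds_zero]
  intro ε hε
  obtain ⟨e, he0, heε⟩ := ENNReal.lt_iff_exists_nnreal_btwn.1 hε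
  have he : 0 < e := by exact_mod_cast he0
  -- Passing from scale s to e costs a factor s/e; taking at least 1 lets the power with exponent
  -- p(x) be bounded by the one with exponent P.
  set K : ℝ≥0 := max (s / e) 1 with hK
  have hdom : ∫⁻ x, (‖F x‖ₑ / e) ^ p x ∂halfVolume ≠ ∞ := by
    refine ne_top_of_le_ne_top (b := ((K ^ P : ℝ≥0) : ℝ≥0∞) * 1)
      (ENNReal.mul_ne_top ENNReal.coe_ne_top ENNReal.one_ne_top) ?_
    refine le_trans ?_ (mul_le_mul_right hs1 _)
    rw [← lintegral_const_mul' _ _ ENNReal.coe_ne_top]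
    refine lintegral_mono_ae ?_
    filter_upwards [ae_restrict_of_ae hP] with x hx
    have h1 : ‖F x‖ₑ / e ≤ K * (‖F x‖ₑ / s) := by
      calc ‖F x‖ₑ / e = ((s / e : ℝ≥0) : ℝ≥0∞) * (‖F x‖ₑ / s) := by
            rw [ENNReal.coe_div he.ne', ← ENNReal.mul_div_right_comm,
              ENNReal.mul_div_cancel (by exact_mod_cast hs.ne') ENNReal.coe_ne_top]
        _ ≤ K * (‖F x‖ₑ / s) := by
            gcongr
            exact le_max_left _ _
    have hp0 : 0 ≤ p x := zero_le_one.trans (h.one_le x)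
    calc (‖F x‖ₑ / e) ^ p x ≤ (K * (‖F x‖ₑ / s)) ^ p x := ENNReal.rpow_le_rpow h1 hp0
      _ = (K : ℝ≥0∞) ^ p x * (‖F x‖ₑ / s) ^ p x := ENNReal.mul_rpow_of_nonneg _ _ hp0
      _ ≤ ((K ^ P : ℝ≥0) : ℝ≥0∞) * (‖F x‖ₑ / s) ^ p x := by
          gcongr
          rw [ENNReal.coe_rpow_of_nonneg _ (hp0.trans hx)]
          exact ENNReal.rpow_le_rpow_of_exponent_le (by exact_mod_cast le_max_right _ _) hx
  have hlim : Tendsto (fun n => ∫⁻ x, ((tailSet F n).indicator (fun x => ‖F x‖ₑ) x / e) ^ p x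
      ∂halfVolume) atTop (𝓝 (∫⁻ _, 0 ∂halfVolume)) := by
    refine tendsto_lintegral_of_dominated_convergence' (fun x => (‖F x‖ₑ / e) ^ p x)
      (fun n => ?_) (fun n => ?_) hdom ?_
    · exact (((hFm.indicator (measurableSet_tailSet F n)).div_const _).aemeasurable).pow hpm
    · refine Eventually.of_forall fun x => ?_
      refine ENNReal.rpow_le_rpow ?_ (zero_le_one.trans (h.one_le x))
      exact ENNReal.div_le_div_right (indicator_le_self _ _ x) _
    · refine Eventually.of_forall fun x => tendsto_const_nhds.congr' ?_
      filter_upwards [eventually_notMem_tailSet F x] with n hn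
      rw [indicator_of_notMem hn, ENNReal.zero_div,
        ENNReal.zero_rpow_of_pos (zero_lt_one.trans_le (h.one_le x))]
  rw [lintegral_zero] at hlim
  filter_upwards [hlim.eventually (ge_mem_nhds one_pos)] with n hn
  exact (luxemburg_le he hn).trans heε.le

end IsMaximalExponent

/-! ### Lorentz spaces -/

/-- Jensen for the convex function (· - l)⁺. -/
theorem expAvg_tsub_le (σ : ℝ) (g : ℝ → ℝ≥0∞) (l : ℝ≥0∞) (x : ℝ) :
    expAvg σ g x - l ≤ expAvg σ (fun x => g x - l) x := by
  have := lintegral_sub_le (μ := expLaw) (fun _ => l) (fun y => g (x - σ * y)) measurable_const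
  rw [lintegral_const, measure_univ, mul_one] at this
  exact this

/-- Take the level l that is optimal for g. Averaging does not increase ∫ (g - l)⁺, and any level
bounds the integral of the rearrangement of the average from above. -/
theorem rearrangementAverage_expAvg_le (σ : ℝ) {g : ℝ → ℝ≥0∞} (hg : Measurable g) {t : ℝ}
    (ht : 0 < t) :
    rearrangementAverage volume (expAvg σ g) t ≤ rearrangementAverage volume g t := by
  refine ENNReal.div_le_div_right ?_ _
  obtain ⟨l, hl⟩ := exists_lintegral_Ioo_rearrangement hg.aemeasurable (μ := volume) ht
  refine (lintegral_Ioo_rearrangement_le (measurable_expAvg σ hg).aemeasurable t l).trans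
    (le_trans ?_ hl)
  gcongr ?_ + _
  rw [← lintegral_expAvg σ (g := fun x => g x - l) (hg.sub_const l)]
  exact lintegral_mono fun x => expAvg_tsub_le σ g l x

theorem lorentz_averagingBounded {p q : ℝ} (hq : 1 < q) (σ : ℝ) :
    (lorentz p q hq).line.AveragingBounded σ := by
  refine ⟨1, fun f => ?_⟩
  rw [ENNReal.coe_one, one_mul]
  exact lorentzFun_mono_of_average (zero_le_one.trans hq.le) fun t ht =>
    rearrangementAverage_expAvg_le σ f.stronglyMeasurable.enorm ht

theorem rearrangementAverage_unitIndicator_le (t : ℝ) :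
    rearrangementAverage halfVolume ((Ioo (0 : ℝ) 1).indicator fun _ => 1) t
      ≤ min (ENNReal.ofReal t) 1 / ENNReal.ofReal t := by
  set j : ℝ → ℝ≥0∞ := (Ioo (0 : ℝ) 1).indicator fun _ => 1 with hj
  refine ENNReal.div_le_div_right (le_min ?_ ?_) _
  · calc ∫⁻ s in Ioo 0 t, rearrangement halfVolume j s ≤ ∫⁻ _ in Ioo 0 t, 1 := by
          refine lintegral_mono fun s => rearrangement_le_iff.2 ?_
          have : {x | 1 < j x} = ∅ := by
            ext x
            simp only [mem_ofPred_eq, mem_empty_iff_false, iff_false, not_lt]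
            exact indicator_le_self _ _ x
          rw [distribution, this, measure_empty]
          exact zero_le
      _ = ENNReal.ofReal t := by simp
  · calc ∫⁻ s in Ioo 0 t, rearrangement halfVolume j s
        ≤ ∫⁻ s in Ioi (0 : ℝ), rearrangement halfVolume j s :=
          lintegral_mono_set Ioo_subset_Ioi_self
      _ = ∫⁻ x, j x ∂halfVolume :=
          lintegral_rearrangement (measurable_const.indicator measurableSet_Ioo).aemeasurable
      _ = halfVolume (Ioo (0 : ℝ) 1) := by
          rw [lintegral_indicator measurableSet_Ioo, setLIntegral_one]
      _ ≤ volume (Ioo (0 : ℝ) 1) := Measure.restrict_apply_le _ _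
      _ = 1 := by simp

theorem lorentz_hasUnitIndicator {p q : ℝ} (hp : 1 < p) (hq : 1 < q) :
    HasUnitIndicator (lorentz p q hq) := by
  have hq0 : 0 < q := by positivity
  have hp0 : 0 < p := by positivity
  set j : ℝ → ℝ≥0∞ := (Ioo (0 : ℝ) 1).indicator fun _ => 1 with hj
  change lorentzFun halfVolume p q j < ∞
  refine ENNReal.rpow_lt_top_of_nonneg (by positivity) (ne_of_lt ?_)
  rw [← Ioc_union_Ioi_eq_Ioi zero_le_one]
  refine (lintegral_union_le _ _ _).trans_lt (ENNReal.add_lt_top.2 ⟨?_, ?_⟩)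
  -- Near 0 the bound g** ≤ 1 leaves a power integrable because q/p > 0.
  · have hint : IntegrableOn (fun t : ℝ => t ^ (q / p - 1)) (Ioc 0 1) := by
      rw [← intervalIntegrable_iff_integrableOn_Ioc_of_le zero_le_one]
      exact intervalIntegral.intervalIntegrable_rpow' (by
        have : 0 < q / p := by positivity
        linarith)
    refine (setLIntegral_mono' measurableSet_Ioc fun t ht => ?_).trans_lt hint.lintegral_lt_top
    have ht0 : 0 < t := ht.1
    have h1 : rearrangementAverage halfVolume j t ≤ 1 :=
      (rearrangementAverage_unitIndicator_le t).trans
        ((ENNReal.div_le_div_right (min_le_left _ _) _).trans ENNReal.div_self_le_one)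
    calc (ENNReal.ofReal (t ^ (1 / p)) * rearrangementAverage halfVolume j t) ^ q
          / ENNReal.ofReal t
        ≤ (ENNReal.ofReal (t ^ (1 / p)) * 1) ^ q / ENNReal.ofReal t := by gcongr
      _ = ENNReal.ofReal (t ^ (q / p - 1)) := by
          rw [mul_one, ENNReal.ofReal_rpow_of_nonneg (by positivity) hq0.le, ← Real.rpow_mul ht0.le,
            ← ENNReal.ofReal_div_of_pos ht0, Real.rpow_sub_one ht0.ne']
          ring_nf
  -- Beyond 1 the bound g** ≤ 1/t leaves a power integrable because p > 1.
  · have hint : IntegrableOn (fun t : ℝ => t ^ ((1 / p - 1) * q - 1)) (Ioi 1) := by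
      refine integrableOn_Ioi_rpow_of_lt ?_ one_pos
      have h1 : 1 / p < 1 := by rw [div_lt_one hp0]; exact hp
      nlinarith
    refine (setLIntegral_mono' measurableSet_Ioi fun t ht => ?_).trans_lt hint.lintegral_lt_top
    have ht0 : 0 < t := one_pos.trans ht
    have h1 : rearrangementAverage halfVolume j t ≤ 1 / ENNReal.ofReal t :=
      (rearrangementAverage_unitIndicator_le t).trans
        (ENNReal.div_le_div_right (min_le_right _ _) _)
    calc (ENNReal.ofReal (t ^ (1 / p)) * rearrangementAverage halfVolume j t) ^ q
          / ENNReal.ofReal t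
        ≤ (ENNReal.ofReal (t ^ (1 / p)) * (1 / ENNReal.ofReal t)) ^ q / ENNReal.ofReal t := by
          gcongr
      _ = ENNReal.ofReal (t ^ ((1 / p - 1) * q - 1)) := by
          rw [← mul_div_assoc, mul_one, ← ENNReal.ofReal_div_of_pos ht0, ← Real.rpow_sub_one ht0.ne',
            ENNReal.ofReal_rpow_of_nonneg (by positivity) hq0.le, ← Real.rpow_mul ht0.le,
            ← ENNReal.ofReal_div_of_pos ht0, ← Real.rpow_sub_one ht0.ne']

theorem lintegral_Ioi_inv_eq_top : ∫⁻ t in Ioi (1 : ℝ), (ENNReal.ofReal t)⁻¹ = ∞ := by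
  by_contra hne
  refine not_integrableOn_Ioi_inv (a := 1) ⟨by fun_prop, ?_⟩
  refine lt_of_le_of_lt (le_of_eq ?_) (lt_top_iff_ne_top.2 hne)
  refine setLIntegral_congr_fun measurableSet_Ioi fun t ht => ?_
  have ht0 : (0 : ℝ) < t := one_pos.trans ht
  rw [← ENNReal.ofReal_inv_of_pos ht0, Real.enorm_eq_ofReal (inv_nonneg.2 ht0.le)]

/-! ### Tails of functions of finite Lorentz norm. -/

section Tails

variable {μ : Measure ℝ} {p q : ℝ} {g : ℝ → ℝ≥0∞}

/-- The integrand of the Lorentz norm. -/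
def lorentzIntegrand (μ : Measure ℝ) (p q : ℝ) (g : ℝ → ℝ≥0∞) (t : ℝ) : ℝ≥0∞ :=
  (ENNReal.ofReal (t ^ (1 / p)) * rearrangementAverage μ g t) ^ q / ENNReal.ofReal t

theorem measurable_lorentzIntegrand (μ : Measure ℝ) (p q : ℝ) (g : ℝ → ℝ≥0∞) :
    Measurable (lorentzIntegrand μ p q g) :=
  (((ENNReal.measurable_ofReal.comp (by fun_prop)).mul
    (measurable_rearrangementAverage μ g)).pow_const q).div ENNReal.measurable_ofReal

theorem lorentzIntegrand_mono (hq : 0 ≤ q) {h : ℝ → ℝ≥0∞} (hgh : ∀ x, g x ≤ h x) (t : ℝ) :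
    lorentzIntegrand μ p q g t ≤ lorentzIntegrand μ p q h t := by
  refine ENNReal.div_le_div_right (ENNReal.rpow_le_rpow ?_ hq) _
  gcongr
  exact ENNReal.div_le_div_right (lintegral_mono fun s =>
    rearrangement_mono (Eventually.of_forall hgh) s) _

/-- A function of finite Lorentz norm has level sets of finite measure. -/
theorem distribution_lt_top_of_lorentz (hp : 0 < p) (hq : 0 < q)
    (hfin : ∫⁻ t in Ioi (0 : ℝ), lorentzIntegrand μ p q g t ≠ ∞) {l : ℝ≥0∞} (hl : 0 < l) :
    distribution μ g l < ∞ := by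
  by_contra hcon
  have htop : distribution μ g l = ∞ := not_lt_top_iff.1 hcon
  have hle : ∀ t, l ≤ rearrangement μ g t := by
    intro t
    by_contra hlt
    have := rearrangement_le_iff.1 (not_le.1 hlt).le
    rw [htop] at this
    exact absurd this (by simp)
  refine hfin (top_unique ?_)
  have hlq : l ^ q ≠ 0 := (ENNReal.rpow_pos_of_nonneg hl hq.le).ne'
  -- A level set of infinite measure forces g** ≥ l everywhere on (1, ∞), where t^{1/p} ≥ 1, and ∫
  -- dt/t diverges there.
  calc ∞ = l ^ q * ∫⁻ t in Ioi (1 : ℝ), (ENNReal.ofReal t)⁻¹ := by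
        rw [lintegral_Ioi_inv_eq_top, ENNReal.mul_top hlq]
    _ = ∫⁻ t in Ioi (1 : ℝ), l ^ q * (ENNReal.ofReal t)⁻¹ :=
        (lintegral_const_mul _ (by fun_prop)).symm
    _ ≤ ∫⁻ t in Ioi (1 : ℝ), lorentzIntegrand μ p q g t := by
        refine setLIntegral_mono' measurableSet_Ioi fun t ht => ?_
        have ht1 : (1 : ℝ) < t := ht
        have ht0 : (0 : ℝ) < t := one_pos.trans ht1
        rw [lorentzIntegrand, div_eq_mul_inv]
        gcongr
        have h1 : 1 ≤ ENNReal.ofReal (t ^ (1 / p)) := by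
          rw [ENNReal.one_le_ofReal]
          exact Real.one_le_rpow ht1.le (by positivity)
        have h2 : l ≤ rearrangementAverage μ g t := by
          rw [rearrangementAverage, ENNReal.le_div_iff_mul_le (Or.inl (by simpa using ht0))
            (Or.inl ENNReal.ofReal_ne_top)]
          calc l * ENNReal.ofReal t = ∫⁻ _ in Ioo 0 t, l := by
                rw [setLIntegral_const, Real.volume_Ioo, sub_zero]
            _ ≤ _ := lintegral_mono hle
        calc l = 1 * l := (one_mul l).symm
          _ ≤ _ := mul_le_mul' h1 h2
    _ ≤ _ := lintegral_mono_set (Ioi_subset_Ioi zero_le_one)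

theorem lintegral_rearrangement_ne_top_of_lorentz (hq : 0 < q)
    (hfin : ∫⁻ t in Ioi (0 : ℝ), lorentzIntegrand μ p q g t ≠ ∞) :
    ∀ᵐ t ∂(volume.restrict (Ioi (0 : ℝ))), ∫⁻ s in Ioo 0 t, rearrangement μ g s ≠ ∞ := by
  filter_upwards [ae_lt_top (measurable_lorentzIntegrand μ p q g) hfin,
    ae_restrict_mem measurableSet_Ioi] with t ht ht0 htop
  have ht0' : (0 : ℝ) < t := ht0
  have h1 : ENNReal.ofReal (t ^ (1 / p)) ≠ 0 := by
    simpa using Real.rpow_pos_of_pos ht0' _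
  rw [lorentzIntegrand, rearrangementAverage, htop, ENNReal.top_div_of_ne_top ENNReal.ofReal_ne_top,
    ENNReal.mul_top h1, ENNReal.top_rpow_of_pos hq,
    ENNReal.top_div_of_ne_top ENNReal.ofReal_ne_top] at ht
  exact lt_irrefl _ ht

end Tails

theorem antitone_tailSet (f : ℝ →ₘ[halfVolume] ℂ) : Antitone (tailSet f) := by
  intro m n hmn x hx
  have : (m : ℝ) ≤ n := by exact_mod_cast hmn
  exact hx.imp (fun h => this.trans_lt h) fun h => this.trans_lt h

/-- For each ε the sets where the tail exceeds ε decrease to the empty set within a set of finite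
measure, so their measure eventually drops below t. -/
theorem tendsto_rearrangement_tail (f : ℝ →ₘ[halfVolume] ℂ)
    (hfin : ∀ l : ℝ≥0∞, 0 < l → distribution halfVolume (fun x => ‖f x‖ₑ) l < ∞) {t : ℝ}
    (ht : 0 < t) :
    Tendsto (fun n => rearrangement halfVolume ((tailSet f n).indicator fun x => ‖f x‖ₑ) t)
      atTop (𝓝 0) := by
  rw [ENNReal.tendsto_nhds_zero]
  intro ε hε
  have hm : Measurable fun x => ‖f x‖ₑ := f.stronglyMeasurable.enorm
  set s : ℕ → Set ℝ := fun n => {x | ε < ‖f x‖ₑ} ∩ tailSet f n with hs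
  have hlim : Tendsto (halfVolume ∘ s) atTop (𝓝 (halfVolume (⋂ n, s n))) := by
    refine tendsto_measure_iInter_atTop (fun n => ?_) (fun i j hij => ?_) ⟨0, ?_⟩
    · exact ((measurableSet_lt measurable_const hm).inter
        (measurableSet_tailSet f n)).nullMeasurableSet
    · exact inter_subset_inter_right _ (antitone_tailSet f hij)
    · exact ne_top_of_le_ne_top (hfin ε hε).ne (measure_mono inter_subset_left)
  have hempty : ⋂ n, s n = ∅ := by
    rw [eq_empty_iff_forall_notMem]
    intro x hx
    obtain ⟨n, hn⟩ := (eventually_notMem_tailSet f x).exists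
    exact hn (mem_iInter.1 hx n).2
  rw [hempty, measure_empty] at hlim
  have hpos : (0 : ℝ≥0∞) < ENNReal.ofReal t := by simpa using ht
  filter_upwards [hlim.eventually (ge_mem_nhds hpos)] with n hn
  rw [rearrangement_le_iff]
  refine le_trans (measure_mono fun x hx => ?_) hn
  have hx' : ε < (tailSet f n).indicator (fun x => ‖f x‖ₑ) x := hx
  by_cases hmem : x ∈ tailSet f n
  · rw [indicator_of_mem hmem] at hx'
    exact ⟨hx', hmem⟩
  · rw [indicator_of_notMem hmem] at hx'
    exact absurd hx' not_lt_zero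

/-- Dominated convergence twice: first inside ∫ g* over (0, t), which is finite for almost every t,
then in the outer integral of the norm. -/
theorem lorentz_denseL2 {p q : ℝ} (hp : 1 < p) (hq : 1 < q) : DenseL2 (lorentz p q hq) := by
  have hq0 : 0 < q := by positivity
  have hp0 : 0 < p := by positivity
  refine denseL2_of_tendsto fun f => ?_
  set F : ℝ →ₘ[halfVolume] ℂ := f.1 with hF
  set g : ℝ → ℝ≥0∞ := fun x => ‖F x‖ₑ with hg
  set T : ℕ → ℝ → ℝ≥0∞ := fun n => (tailSet F n).indicator g with hT
  change Tendsto (fun n => (∫⁻ t in Ioi (0 : ℝ), lorentzIntegrand halfVolume p q (T n) t)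
    ^ (1 / q)) atTop (𝓝 0)
  have hfin : ∫⁻ t in Ioi (0 : ℝ), lorentzIntegrand halfVolume p q g t ≠ ∞ := by
    intro htop
    have h1 : (∫⁻ t in Ioi (0 : ℝ), lorentzIntegrand halfVolume p q g t) ^ (1 / q) < ∞ := f.2
    rw [htop, ENNReal.top_rpow_of_pos (by positivity)] at h1
    exact lt_irrefl _ h1
  have hTg : ∀ n x, T n x ≤ g x := fun n x => indicator_le_self _ _ x
  have hdist : ∀ l : ℝ≥0∞, 0 < l → distribution halfVolume g l < ∞ := fun l hl =>
    distribution_lt_top_of_lorentz hp0 hq0 hfin hl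
  have hlim : Tendsto (fun n => ∫⁻ t in Ioi (0 : ℝ), lorentzIntegrand halfVolume p q (T n) t)
      atTop (𝓝 (∫⁻ _ in Ioi (0 : ℝ), 0)) := by
    refine tendsto_lintegral_of_dominated_convergence (lorentzIntegrand halfVolume p q g)
      (fun n => measurable_lorentzIntegrand _ _ _ _)
      (fun n => Eventually.of_forall fun t => lorentzIntegrand_mono hq0.le (hTg n) t) hfin ?_
    filter_upwards [lintegral_rearrangement_ne_top_of_lorentz hq0 hfin,
      ae_restrict_mem measurableSet_Ioi] with t ht ht0
    have ht0' : (0 : ℝ) < t := ht0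
    have h1 : Tendsto (fun n => ∫⁻ s in Ioo 0 t, rearrangement halfVolume (T n) s) atTop
        (𝓝 (∫⁻ _ in Ioo 0 t, 0)) := by
      refine tendsto_lintegral_of_dominated_convergence (rearrangement halfVolume g)
        (fun n => (rearrangement_antitone _ _).measurable)
        (fun n => Eventually.of_forall fun s => rearrangement_mono
          (Eventually.of_forall (hTg n)) s) ht ?_
      filter_upwards [ae_restrict_mem measurableSet_Ioo] with s hs
      exact tendsto_rearrangement_tail F hdist hs.1
    rw [lintegral_zero] at h1
    have ht1 : ENNReal.ofReal t ≠ 0 := by simpa using ht0'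
    have h2 := ENNReal.Tendsto.div_const h1 (b := ENNReal.ofReal t) (Or.inr ht1)
    have h3 := ENNReal.Tendsto.const_mul (a := ENNReal.ofReal (t ^ (1 / p))) h2
      (Or.inr ENNReal.ofReal_ne_top)
    have h4 := ENNReal.Tendsto.div_const (h3.ennrpow_const q) (b := ENNReal.ofReal t) (Or.inr ht1)
    rw [ENNReal.zero_div, mul_zero, ENNReal.zero_rpow_of_pos hq0, ENNReal.zero_div] at h4
    exact h4
  rw [lintegral_zero] at hlim
  have := hlim.ennrpow_const (1 / q)
  rwa [ENNReal.zero_rpow_of_pos (by positivity)] at this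

end WienerHopf

end

/-- In the Orlicz case reflexivity enters only through the density of square-integrable functions.
-/
theorem mainTheorem9 (X : WienerHopf.SpacePair) (hX : WienerHopf.IsAdmissible X) (n : ℤ) :
    WienerHopf.IsFourierMultiplier X (WienerHopf.rSymbol n) ∧
      (WienerHopf.wienerHopf X (WienerHopf.rSymbol n)).IsFredholm ∧
      WienerHopf.fredholmIndex (WienerHopf.wienerHopf X (WienerHopf.rSymbol n)) = -n := by
  cases hX with
  | lorentz p q hp hq =>
    exact WienerHopf.wienerHopf_rSymbol (WienerHopf.lorentz_averagingBounded hq 1)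
      (WienerHopf.lorentz_averagingBounded hq (-1)) (WienerHopf.lorentz_denseL2 hp hq)
      (WienerHopf.lorentz_hasUnitIndicator hp hq) n
  | orlicz φ hφ hrefl =>
    exact WienerHopf.wienerHopf_rSymbol (hφ.averagingBounded 1) (hφ.averagingBounded (-1))
      (WienerHopf.denseL2_of_isReflexive (hφ.averagingBounded (-1)) hrefl) hφ.hasUnitIndicator n
  | variableLebesgue p hp =>
    exact WienerHopf.wienerHopf_rSymbol (hp.averagingBounded (Or.inl rfl))
      (hp.averagingBounded (Or.inr rfl)) hp.denseL2 hp.hasUnitIndicator n
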